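/- **Setting.** Let $M$ be a smooth four-dimensional manifold with an area metric $G$, i.e. a smooth covariant tensor field of rank four with $G(X,Y,A,B)=G(A,B,X,Y)=-G(Y,X,A,B)$ such that at every point $p$ the induced map $\Lambda^2T_pM\to\Lambda^2T_p^*M$, $(X\wedge Y)\mapsto (A\wedge B\mapsto G(X,Y,A,B))$, is invertible. In a frame $(e_0,e_1,e_2,e_3)$ of $T_pM$ the Petrov matrix of a rank-four tensor is the $6\times6$ matrix of its components $G_{abcd}=G(e_a,e_b,e_c,e_d)$ with respect to the index pairs $[01],[02],[03],[12],[31],[23]$, in this order. In a frame the volume form is $(\omega_G)_{abcd}=|\det \mathrm{Petrov}(G)|^{1/6}\epsilon_{abcd}$ with $\epsilon_{0123}=1$, and $J=\omega_G^{-1}G$ is the endomorphism of bivectors with matrix $\mathrm{Petrov}(\omega_G)^{-1}\mathrm{Petrov}(G)$; $\omega_G$ and $J$ depend on the frame only through its orientation, which changes their sign. The Segré type of $J$ lists the sizes of its Jordan blocks: an entry $A\bar A$ stands for two blocks of size $A$ with non-real complex conjugate eigenvalues, a bare entry $B$ for a block of size $B$ with a real eigenvalue (order is irrelevant). Let $\Sigma$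 be the $6\times 6$ matrix with ones on the antidiagonal and zeros elsewhere. **Normal forms.** Consider the following 23 metaclasses, each labelled by a Segré type and with a symmetric matrix $N$ depending on real scalars $\sigma_i,\tau_i,\lambda_i$ and signs $\epsilon_i\in\{1,-1\}$: - **I** $[1\bar1\,1\bar1\,1\bar1]$: $\begin{pmatrix}-\tau_1&0&0&0&0&\sigma_1\\ 0&-\tau_3&0&0&\sigma_3&0\\ 0&0&-\tau_2&\sigma_2&0&0\\ 0&0&\sigma_2&\tau_2&0&0\\ 0&\sigma_3&0&0&\tau_3&0\\ \sigma_1&0&0&0&0&\tau_1\end{pmatrix}$ - **II** $[2\bar2\,1\bar1]$: $\begin{pmatrix}0&0&0&0&-\tau_1&\sigma_1\\ 0&0&0&0&\sigma_1&\tau_1\\ 0&0&-\tau_2&\sigma_2&0&0\\ 0&0&\sigma_2&\tau_2&0&0\\ -\tau_1&\sigma_1&0&0&0&1\\ \sigma_1&\tau_1&0&0&1&0\end{pmatrix}$ - **III** $[3\bar3]$: $\begin{pmatrix}0&0&0&0&-\tau_1&\sigma_1\\ 0&0&0&0&\sigma_1&\tau_1\\ 0&0&-\tau_1&\sigma_1&0&1\\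 0&0&\sigma_1&\tau_1&1&0\\ -\tau_1&\sigma_1&0&1&0&0\\ \sigma_1&\tau_1&1&0&0&0\end{pmatrix}$ - **IV** $[1\bar1\,1\bar1\,11]$: $\begin{pmatrix}-\tau_1&0&0&0&0&\sigma_1\\ 0&-\tau_2&0&0&\sigma_2&0\\ 0&0&\lambda_1&\lambda_2&0&0\\ 0&0&\lambda_2&\lambda_1&0&0\\ 0&\sigma_2&0&0&\tau_2&0\\ \sigma_1&0&0&0&0&\tau_1\end{pmatrix}$ - **V** $[2\bar2\,11]$: $\begin{pmatrix}0&0&0&0&-\tau_1&\sigma_1\\ 0&0&0&0&\sigma_1&\tau_1\\ 0&0&\lambda_1&\lambda_2&0&0\\ 0&0&\lambda_2&\lambda_1&0&0\\ -\tau_1&\sigma_1&0&0&0&1\\ \sigma_1&\tau_1&0&0&1&0\end{pmatrix}$ - **VI** $[1\bar1\,1111]$: $\begin{pmatrix}-\tau_1&0&0&0&0&\sigma_1\\ 0&\lambda_3&0&0&\lambda_4&0\\ 0&0&\lambda_1&\lambda_2&0&0\\ 0&0&\lambda_2&\lambda_1&0&0\\ 0&\lambda_4&0&0&\lambda_3&0\\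 \sigma_1&0&0&0&0&\tau_1\end{pmatrix}$ - **VII** $[111111]$: $\begin{pmatrix}\lambda_5&0&0&0&0&\lambda_6\\ 0&\lambda_3&0&0&\lambda_4&0\\ 0&0&\lambda_1&\lambda_2&0&0\\ 0&0&\lambda_2&\lambda_1&0&0\\ 0&\lambda_4&0&0&\lambda_3&0\\ \lambda_6&0&0&0&0&\lambda_5\end{pmatrix}$ - **VIII** $[6]$: $\begin{pmatrix}0&0&0&0&0&\lambda_1\\ 0&0&0&0&\lambda_1&1\\ 0&0&0&\lambda_1&1&0\\ 0&0&\lambda_1&\epsilon_1&0&0\\ 0&\lambda_1&1&0&0&0\\ \lambda_1&1&0&0&0&0\end{pmatrix}$ - **IX** $[42]$: $\begin{pmatrix}0&0&0&0&0&\lambda_1\\ 0&0&0&0&\lambda_1&1\\ 0&0&0&\lambda_2&0&0\\ 0&0&\lambda_2&\epsilon_1&0&0\\ 0&\lambda_1&0&0&\epsilon_2&0\\ \lambda_1&1&0&0&0&0\end{pmatrix}$ - **X** $[4\,1\bar1]$: $\begin{pmatrix}0&0&0&0&0&\lambda_1\\ 0&0&0&0&\lambda_1&1\\ 0&0&-\tau_1&\sigma_1&0&0\\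 0&0&\sigma_1&\tau_1&0&0\\ 0&\lambda_1&0&0&\epsilon_1&0\\ \lambda_1&1&0&0&0&0\end{pmatrix}$ - **XI** $[411]$: $\begin{pmatrix}0&0&0&0&0&\lambda_1\\ 0&0&0&0&\lambda_1&1\\ 0&0&\lambda_3&\lambda_2&0&0\\ 0&0&\lambda_2&\lambda_3&0&0\\ 0&\lambda_1&0&0&\epsilon_1&0\\ \lambda_1&1&0&0&0&0\end{pmatrix}$ - **XII** $[2\bar2\,2]$: $\begin{pmatrix}0&0&0&0&-\tau_1&\sigma_1\\ 0&0&0&0&\sigma_1&\tau_1\\ 0&0&0&\lambda_1&0&0\\ 0&0&\lambda_1&\epsilon_1&0&0\\ -\tau_1&\sigma_1&0&0&0&1\\ \sigma_1&\tau_1&0&0&1&0\end{pmatrix}$ - **XIII** $[222]$: $\begin{pmatrix}0&0&0&0&0&\lambda_1\\ 0&\epsilon_2&0&0&\lambda_2&0\\ 0&0&0&\lambda_3&0&0\\ 0&0&\lambda_3&\epsilon_3&0&0\\ 0&\lambda_2&0&0&0&0\\ \lambda_1&0&0&0&0&\epsilon_1\end{pmatrix}$ - **XIV** $[22\,1\bar1]$: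 $\begin{pmatrix}0&0&0&0&0&\lambda_1\\ 0&\epsilon_2&0&0&\lambda_2&0\\ 0&0&-\tau_1&\sigma_1&0&0\\ 0&0&\sigma_1&\tau_1&0&0\\ 0&\lambda_2&0&0&0&0\\ \lambda_1&0&0&0&0&\epsilon_1\end{pmatrix}$ - **XV** $[2211]$: $\begin{pmatrix}0&0&0&0&0&\lambda_1\\ 0&\epsilon_2&0&0&\lambda_2&0\\ 0&0&\lambda_3&\lambda_4&0&0\\ 0&0&\lambda_4&\lambda_3&0&0\\ 0&\lambda_2&0&0&0&0\\ \lambda_1&0&0&0&0&\epsilon_1\end{pmatrix}$ - **XVI** $[2\,1\bar1\,1\bar1]$: $\begin{pmatrix}0&0&0&0&0&\lambda_1\\ 0&-\tau_2&0&0&\sigma_2&0\\ 0&0&-\tau_1&\sigma_1&0&0\\ 0&0&\sigma_1&\tau_1&0&0\\ 0&\sigma_2&0&0&\tau_2&0\\ \lambda_1&0&0&0&0&\epsilon_1\end{pmatrix}$ - **XVII** $[211\,1\bar1]$: $\begin{pmatrix}0&0&0&0&0&\lambda_1\\ 0&-\tau_1&0&0&\sigma_1&0\\ 0&0&\lambda_2&\lambda_3&0&0\\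 0&0&\lambda_3&\lambda_2&0&0\\ 0&\sigma_1&0&0&\tau_1&0\\ \lambda_1&0&0&0&0&\epsilon_1\end{pmatrix}$ - **XVIII** $[21111]$: $\begin{pmatrix}0&0&0&0&0&\lambda_1\\ 0&\lambda_4&0&0&\lambda_5&0\\ 0&0&\lambda_2&\lambda_3&0&0\\ 0&0&\lambda_3&\lambda_2&0&0\\ 0&\lambda_5&0&0&\lambda_4&0\\ \lambda_1&0&0&0&0&\epsilon_1\end{pmatrix}$ - **XIX** $[51]$: $\begin{pmatrix}0&0&0&0&0&\lambda_1\\ 0&0&0&0&\lambda_1&1\\ 0&0&\frac{\epsilon_1}{2}(\lambda_1-\lambda_2)&\frac12(\lambda_1+\lambda_2)&\frac{1}{\sqrt2}&0\\ 0&0&\frac12(\lambda_1+\lambda_2)&\frac{\epsilon_1}{2}(\lambda_1-\lambda_2)&\frac{\epsilon_1}{\sqrt2}&0\\ 0&\lambda_1&\frac{1}{\sqrt2}&\frac{\epsilon_1}{\sqrt2}&0&0\\ \lambda_1&1&0&0&0&0\end{pmatrix}$ - **XX** $[33]$: $\begin{pmatrix}0&0&0&0&0&\lambda_1\\ 0&\frac12(\lambda_1-\lambda_2)&0&-\frac{1}{\sqrt2}&\frac12(\lambda_1+\lambda_2)&\frac{1}{\sqrt2}\\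 0&0&0&\lambda_2&0&0\\ 0&-\frac{1}{\sqrt2}&\lambda_2&0&\frac{1}{\sqrt2}&0\\ 0&\frac12(\lambda_1+\lambda_2)&0&\frac{1}{\sqrt2}&\frac12(\lambda_1-\lambda_2)&\frac{1}{\sqrt2}\\ \lambda_1&\frac{1}{\sqrt2}&0&0&\frac{1}{\sqrt2}&0\end{pmatrix}$ - **XXI** $[321]$: $\begin{pmatrix}\epsilon_2&0&0&0&0&\lambda_2\\ 0&0&\frac{\epsilon_1}{\sqrt2}&\frac{1}{\sqrt2}&\lambda_1&0\\ 0&\frac{\epsilon_1}{\sqrt2}&\frac{\epsilon_1}{2}(\lambda_1-\lambda_3)&\frac12(\lambda_1+\lambda_3)&0&0\\ 0&\frac{1}{\sqrt2}&\frac12(\lambda_1+\lambda_3)&\frac{\epsilon_1}{2}(\lambda_1-\lambda_3)&0&0\\ 0&\lambda_1&0&0&0&0\\ \lambda_2&0&0&0&0&0\end{pmatrix}$ - **XXII** $[31\,1\bar1]$: $\begin{pmatrix}-\tau_1&0&0&0&0&\sigma_1\\ 0&0&\frac{\epsilon_1}{\sqrt2}&\frac{1}{\sqrt2}&\lambda_1&0\\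 0&\frac{\epsilon_1}{\sqrt2}&\frac{\epsilon_1}{2}(\lambda_1-\lambda_2)&\frac12(\lambda_1+\lambda_2)&0&0\\ 0&\frac{1}{\sqrt2}&\frac12(\lambda_1+\lambda_2)&\frac{\epsilon_1}{2}(\lambda_1-\lambda_2)&0&0\\ 0&\lambda_1&0&0&0&0\\ \sigma_1&0&0&0&0&\tau_1\end{pmatrix}$ - **XXIII** $[3111]$: $\begin{pmatrix}\lambda_3&0&0&0&0&\lambda_4\\ 0&\frac{\epsilon_1}{2}(\lambda_1-\lambda_2)&\frac{\epsilon_1}{\sqrt2}&0&\frac12(\lambda_1+\lambda_2)&0\\ 0&\frac{\epsilon_1}{\sqrt2}&0&\lambda_1&\frac{1}{\sqrt2}&0\\ 0&0&\lambda_1&0&0&0\\ 0&\frac12(\lambda_1+\lambda_2)&\frac{1}{\sqrt2}&0&\frac{\epsilon_1}{2}(\lambda_1-\lambda_2)&0\\ \lambda_4&0&0&0&0&\lambda_3\end{pmatrix}$ Scalars are called admissible if all $\tau_i>0$ and $|\det N|=1$. A family is a metaclass together with a choice of the signs $\epsilon_i$, where in XIII, XIV and XV the interchangeable blocks of size two are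 listed with positive signs first (so that only the number of positive signs matters). **Theorem.** 1. There are 23 metaclasses, with pairwise different Segré types, and 46 families. 2. For every family admissible scalars exist. The family has at most six scalars, of which at most five are independent: near every admissible tuple of scalars, being admissible is equivalent to one fixed scalar being a certain smooth function of the others. 3. For every point $p$ of $M$ and each of the two orientations of $T_pM$ there is exactly one family for which some frame of that orientation has the property that $\mathrm{Petrov}(G)$ equals $N$ for some admissible scalars or, in a metaclass in which no real Jordan block has odd size (I, II, III, VIII, IX, X, XII, XIII, XIV, XVI), equals $N$ or $\Sigma^tN\Sigma$ for some admissible scalars. In particular, different families are different algebraic classes under orientation-preserving changes of frame. 4. The metaclass of this family is the only one of the 23 whose label is the Segré type of $J$ at $p$ (computed in any frame). -/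

import Mathlib

open scoped Manifold ContDiff Topology

/-! # Area metrics on a four-dimensional manifold -/

/-- An area metric on a smooth four-dimensional manifold `M`: a smooth covariant tensor field of
rank four with the two index symmetries, such that the induced map
`Ĝ : Λ²TₚM → Λ²Tₚ*M`, `Ĝ(X ∧ Y)(A ∧ B) = G(X, Y, A, B)`, is invertible at every point
(`Λ²Tₚ*M` is the dual of `Λ²TₚM`). Smoothness of the tensor field means that it sends smooth local
vector fields to smooth functions. -/
structure AreaMetric (M : Type*) [TopologicalSpace M]
    [ChartedSpace (EuclideanSpace ℝ (Fin 4)) M] [IsManifold (𝓡 4) ∞ M] where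
  toFun (p : M) : MultilinearMap ℝ (fun _ : Fin 4 => TangentSpace (𝓡 4) p) ℝ
  pair_symm (p : M) (X Y A B : TangentSpace (𝓡 4) p) :
    toFun p ![X, Y, A, B] = toFun p ![A, B, X, Y]
  antisymm (p : M) (X Y A B : TangentSpace (𝓡 4) p) :
    toFun p ![X, Y, A, B] = -toFun p ![Y, X, A, B]
  invertible (p : M) :
    ∃ Ghat : (⋀[ℝ]^2 (TangentSpace (𝓡 4) p)) ≃ₗ[ℝ]
        Module.Dual ℝ (⋀[ℝ]^2 (TangentSpace (𝓡 4) p)),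
      ∀ X Y A B : TangentSpace (𝓡 4) p,
        Ghat (exteriorPower.ιMulti ℝ 2 ![X, Y]) (exteriorPower.ιMulti ℝ 2 ![A, B]) =
          toFun p ![X, Y, A, B]
  smooth (U : Set M) (hU : IsOpen U) (X Y A B : (p : M) → TangentSpace (𝓡 4) p)
    (hX : ContMDiffOn (𝓡 4) (𝓡 4).tangent ∞ (fun p => (⟨p, X p⟩ : TangentBundle (𝓡 4) M)) U)
    (hY : ContMDiffOn (𝓡 4) (𝓡 4).tangent ∞ (fun p => (⟨p, Y p⟩ : TangentBundle (𝓡 4) M)) U)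
    (hA : ContMDiffOn (𝓡 4) (𝓡 4).tangent ∞ (fun p => (⟨p, A p⟩ : TangentBundle (𝓡 4) M)) U)
    (hB : ContMDiffOn (𝓡 4) (𝓡 4).tangent ∞ (fun p => (⟨p, B p⟩ : TangentBundle (𝓡 4) M)) U) :
    ContMDiffOn (𝓡 4) 𝓘(ℝ, ℝ) ∞ (fun p => toFun p ![X p, Y p, A p, B p]) U

/-- The value of the area metric at `p`, as a function of four tangent vectors. -/
noncomputable def AreaMetric.at {M : Type*} [TopologicalSpace M]
    [ChartedSpace (EuclideanSpace ℝ (Fin 4)) M] [IsManifold (𝓡 4) ∞ M]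
    (G : AreaMetric M) (p : M) (X Y A B : TangentSpace (𝓡 4) p) : ℝ :=
  G.toFun p ![X, Y, A, B]

/-! # Petrov notation, the volume form and the endomorphism `J` -/

/-- The index pairs `[01], [02], [03], [12], [31], [23]`, in this order. -/
def petrovPair : Fin 6 → Fin 4 × Fin 4 :=
  ![(0, 1), (0, 2), (0, 3), (1, 2), (3, 1), (2, 3)]

/-- The Petrov matrix of a rank four tensor `F` in the frame `b`. -/
noncomputable def petrov {V : Type*} [AddCommGroup V] [Module ℝ V] (F : V → V → V → V → ℝ)
    (b : Module.Basis (Fin 4) ℝ V) : Matrix (Fin 6) (Fin 6) ℝ :=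
  Matrix.of fun A B => F (b (petrovPair A).1) (b (petrovPair A).2)
    (b (petrovPair B).1) (b (petrovPair B).2)

/-- The volume form `ω_F = |det Petrov(F)|^{1/6} ε` of a rank four tensor `F`, where `ε` is the
alternating form with `ε(b 0, b 1, b 2, b 3) = 1`. -/
noncomputable def areaVolumeForm {V : Type*} [AddCommGroup V] [Module ℝ V]
    (F : V → V → V → V → ℝ) (b : Module.Basis (Fin 4) ℝ V) : V [⋀^Fin 4]→ₗ[ℝ] ℝ :=
  |(petrov F b).det| ^ (1 / 6 : ℝ) • b.det

/-- The matrix, in the frame `b`, of the endomorphism `J = ω_F⁻¹ F` of the space of bivectors. -/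
noncomputable def endoJ {V : Type*} [AddCommGroup V] [Module ℝ V]
    (F : V → V → V → V → ℝ) (b : Module.Basis (Fin 4) ℝ V) : Matrix (Fin 6) (Fin 6) ℝ :=
  (petrov (fun X Y A B => areaVolumeForm F b ![X, Y, A, B]) b)⁻¹ * petrov F b

/-- The Petrov matrix of the symbol `Σ`, whose components are numerically those of `ε`. -/
def sigmaMatrix : Matrix (Fin 6) (Fin 6) ℝ :=
  !![0, 0, 0, 0, 0, 1;
     0, 0, 0, 0, 1, 0;
     0, 0, 0, 1, 0, 0;
     0, 0, 1, 0, 0, 0;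
     0, 1, 0, 0, 0, 0;
     1, 0, 0, 0, 0, 0]

/-! # Segré types -/

/-- A Segré symbol `[A Ā … B C …]`: `pairs` holds the sizes `A, …` of the pairs of complex conjugate
blocks, one entry for each pair, and `reals` the sizes `B, C, …` of the real blocks. -/
structure SegreSymbol where
  pairs : Multiset ℕ
  reals : Multiset ℕ
  deriving DecidableEq

/-- The `k × k` Jordan block with eigenvalue `z`. -/
def jordanBlock (k : ℕ) (z : ℂ) : Matrix (Fin k) (Fin k) ℂ :=
  Matrix.of fun i j => if i = j then z else if (i : ℕ) + 1 = j then 1 else 0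

/-- The real matrix `A` has the Segré type `s`: its complex Jordan form consists of a block with
eigenvalue `z i` and a block of the same size with eigenvalue `conj (z i)`, where `z i` is not real,
for every entry of `s.pairs`, and of a block with a real eigenvalue `x i` for every entry of
`s.reals`. -/
def HasSegreType (A : Matrix (Fin 6) (Fin 6) ℝ) (s : SegreSymbol) : Prop :=
  ∃ (m n : ℕ) (c : Fin m → ℕ) (r : Fin n → ℕ) (z : Fin m → ℂ) (x : Fin n → ℝ),
    Multiset.map c Finset.univ.val = s.pairs ∧ Multiset.map r Finset.univ.val = s.reals ∧
    (∀ i, (z i).im ≠ 0) ∧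
    ∃ (e : (Σ i : Fin m ⊕ Fin m ⊕ Fin n, Fin (Sum.elim c (Sum.elim c r) i)) ≃ Fin 6)
      (S : Matrix (Fin 6) (Fin 6) ℂ), IsUnit S.det ∧
      A.map (fun a => (a : ℂ)) * S =
        S * Matrix.reindex e e (Matrix.blockDiagonal' fun i =>
          jordanBlock (Sum.elim c (Sum.elim c r) i)
            (Sum.elim z (Sum.elim (fun j => (starRingEnd ℂ) (z j)) (fun j => (x j : ℂ))) i))

/-! # Metaclasses and normal forms -/

/-- The 23 metaclasses. -/
inductive Metaclass
  | I | II | III | IV | V | VI | VII | VIII | IX | X | XI | XII | XIII | XIV | XV | XVI | XVII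
  | XVIII | XIX | XX | XXI | XXII | XXIII
  deriving DecidableEq

namespace Metaclass

/-- The Segré symbol that labels the metaclass. -/
def segre : Metaclass → SegreSymbol
  | I => ⟨{1, 1, 1}, 0⟩
  | II => ⟨{2, 1}, 0⟩
  | III => ⟨{3}, 0⟩
  | IV => ⟨{1, 1}, {1, 1}⟩
  | V => ⟨{2}, {1, 1}⟩
  | VI => ⟨{1}, {1, 1, 1, 1}⟩
  | VII => ⟨0, {1, 1, 1, 1, 1, 1}⟩
  | VIII => ⟨0, {6}⟩
  | IX => ⟨0, {4, 2}⟩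
  | X => ⟨{1}, {4}⟩
  | XI => ⟨0, {4, 1, 1}⟩
  | XII => ⟨{2}, {2}⟩
  | XIII => ⟨0, {2, 2, 2}⟩
  | XIV => ⟨{1}, {2, 2}⟩
  | XV => ⟨0, {2, 2, 1, 1}⟩
  | XVI => ⟨{1, 1}, {2}⟩
  | XVII => ⟨{1}, {2, 1, 1}⟩
  | XVIII => ⟨0, {2, 1, 1, 1, 1}⟩
  | XIX => ⟨0, {5, 1}⟩
  | XX => ⟨0, {3, 3}⟩
  | XXI => ⟨0, {3, 2, 1}⟩
  | XXII => ⟨{1}, {3, 1}⟩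
  | XXIII => ⟨0, {3, 1, 1, 1}⟩

/-- The number of scalars `σ`, which is also the number of scalars `τ`. -/
def numPairs : Metaclass → ℕ
  | I => 3 | II => 2 | III => 1 | IV => 2 | V => 1 | VI => 1 | VII => 0
  | VIII => 0 | IX => 0 | X => 1 | XI => 0 | XII => 1 | XIII => 0 | XIV => 1 | XV => 0
  | XVI => 2 | XVII => 1 | XVIII => 0 | XIX => 0 | XX => 0 | XXI => 0 | XXII => 1 | XXIII => 0

/-- The number of scalars `λ`. -/
def numReals : Metaclass → ℕ
  | I => 0 | II => 0 | III => 0 | IV => 2 | V => 2 | VI => 4 | VII => 6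
  | VIII => 1 | IX => 2 | X => 1 | XI => 3 | XII => 1 | XIII => 3 | XIV => 2 | XV => 4
  | XVI => 1 | XVII => 3 | XVIII => 5 | XIX => 2 | XX => 2 | XXI => 3 | XXII => 2 | XXIII => 4

/-- The number of signs `ε`. -/
def numSigns : Metaclass → ℕ
  | I => 0 | II => 0 | III => 0 | IV => 0 | V => 0 | VI => 0 | VII => 0
  | VIII => 1 | IX => 2 | X => 1 | XI => 1 | XII => 1 | XIII => 3 | XIV => 2 | XV => 2
  | XVI => 1 | XVII => 1 | XVIII => 1 | XIX => 1 | XX => 0 | XXI => 2 | XXII => 1 | XXIII => 1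

/-- The normal form of the metaclass with signs `ε` and scalars `σ`, `τ`, `l`, all numbered
from 0. -/
noncomputable def normalForm : (m : Metaclass) → (Fin m.numSigns → ℤˣ) →
    (Fin m.numPairs → ℝ) → (Fin m.numPairs → ℝ) → (Fin m.numReals → ℝ) →
    Matrix (Fin 6) (Fin 6) ℝ
  | I => fun _ (σ τ : Fin 3 → ℝ) _ =>
    !![-τ 0, 0, 0, 0, 0, σ 0;
       0, -τ 2, 0, 0, σ 2, 0;
       0, 0, -τ 1, σ 1, 0, 0;
       0, 0, σ 1, τ 1, 0, 0;
       0, σ 2, 0, 0, τ 2, 0;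
       σ 0, 0, 0, 0, 0, τ 0]
  | II => fun _ (σ τ : Fin 2 → ℝ) _ =>
    !![0, 0, 0, 0, -τ 0, σ 0;
       0, 0, 0, 0, σ 0, τ 0;
       0, 0, -τ 1, σ 1, 0, 0;
       0, 0, σ 1, τ 1, 0, 0;
       -τ 0, σ 0, 0, 0, 0, 1;
       σ 0, τ 0, 0, 0, 1, 0]
  | III => fun _ (σ τ : Fin 1 → ℝ) _ =>
    !![0, 0, 0, 0, -τ 0, σ 0;
       0, 0, 0, 0, σ 0, τ 0;
       0, 0, -τ 0, σ 0, 0, 1;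
       0, 0, σ 0, τ 0, 1, 0;
       -τ 0, σ 0, 0, 1, 0, 0;
       σ 0, τ 0, 1, 0, 0, 0]
  | IV => fun _ (σ τ : Fin 2 → ℝ) (l : Fin 2 → ℝ) =>
    !![-τ 0, 0, 0, 0, 0, σ 0;
       0, -τ 1, 0, 0, σ 1, 0;
       0, 0, l 0, l 1, 0, 0;
       0, 0, l 1, l 0, 0, 0;
       0, σ 1, 0, 0, τ 1, 0;
       σ 0, 0, 0, 0, 0, τ 0]
  | V => fun _ (σ τ : Fin 1 → ℝ) (l : Fin 2 → ℝ) =>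
    !![0, 0, 0, 0, -τ 0, σ 0;
       0, 0, 0, 0, σ 0, τ 0;
       0, 0, l 0, l 1, 0, 0;
       0, 0, l 1, l 0, 0, 0;
       -τ 0, σ 0, 0, 0, 0, 1;
       σ 0, τ 0, 0, 0, 1, 0]
  | VI => fun _ (σ τ : Fin 1 → ℝ) (l : Fin 4 → ℝ) =>
    !![-τ 0, 0, 0, 0, 0, σ 0;
       0, l 2, 0, 0, l 3, 0;
       0, 0, l 0, l 1, 0, 0;
       0, 0, l 1, l 0, 0, 0;
       0, l 3, 0, 0, l 2, 0;
       σ 0, 0, 0, 0, 0, τ 0]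
  | VII => fun _ _ _ (l : Fin 6 → ℝ) =>
    !![l 4, 0, 0, 0, 0, l 5;
       0, l 2, 0, 0, l 3, 0;
       0, 0, l 0, l 1, 0, 0;
       0, 0, l 1, l 0, 0, 0;
       0, l 3, 0, 0, l 2, 0;
       l 5, 0, 0, 0, 0, l 4]
  | VIII => fun (ε : Fin 1 → ℤˣ) _ _ (l : Fin 1 → ℝ) =>
    !![0, 0, 0, 0, 0, l 0;
       0, 0, 0, 0, l 0, 1;
       0, 0, 0, l 0, 1, 0;
       0, 0, l 0, ((ε 0 : ℤ) : ℝ), 0, 0;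
       0, l 0, 1, 0, 0, 0;
       l 0, 1, 0, 0, 0, 0]
  | IX => fun (ε : Fin 2 → ℤˣ) _ _ (l : Fin 2 → ℝ) =>
    !![0, 0, 0, 0, 0, l 0;
       0, 0, 0, 0, l 0, 1;
       0, 0, 0, l 1, 0, 0;
       0, 0, l 1, ((ε 0 : ℤ) : ℝ), 0, 0;
       0, l 0, 0, 0, ((ε 1 : ℤ) : ℝ), 0;
       l 0, 1, 0, 0, 0, 0]
  | X => fun (ε : Fin 1 → ℤˣ) (σ τ : Fin 1 → ℝ) (l : Fin 1 → ℝ) =>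
    !![0, 0, 0, 0, 0, l 0;
       0, 0, 0, 0, l 0, 1;
       0, 0, -τ 0, σ 0, 0, 0;
       0, 0, σ 0, τ 0, 0, 0;
       0, l 0, 0, 0, ((ε 0 : ℤ) : ℝ), 0;
       l 0, 1, 0, 0, 0, 0]
  | XI => fun (ε : Fin 1 → ℤˣ) _ _ (l : Fin 3 → ℝ) =>
    !![0, 0, 0, 0, 0, l 0;
       0, 0, 0, 0, l 0, 1;
       0, 0, l 2, l 1, 0, 0;
       0, 0, l 1, l 2, 0, 0;
       0, l 0, 0, 0, ((ε 0 : ℤ) : ℝ), 0;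
       l 0, 1, 0, 0, 0, 0]
  | XII => fun (ε : Fin 1 → ℤˣ) (σ τ : Fin 1 → ℝ) (l : Fin 1 → ℝ) =>
    !![0, 0, 0, 0, -τ 0, σ 0;
       0, 0, 0, 0, σ 0, τ 0;
       0, 0, 0, l 0, 0, 0;
       0, 0, l 0, ((ε 0 : ℤ) : ℝ), 0, 0;
       -τ 0, σ 0, 0, 0, 0, 1;
       σ 0, τ 0, 0, 0, 1, 0]
  | XIII => fun (ε : Fin 3 → ℤˣ) _ _ (l : Fin 3 → ℝ) =>
    !![0, 0, 0, 0, 0, l 0;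
       0, ((ε 1 : ℤ) : ℝ), 0, 0, l 1, 0;
       0, 0, 0, l 2, 0, 0;
       0, 0, l 2, ((ε 2 : ℤ) : ℝ), 0, 0;
       0, l 1, 0, 0, 0, 0;
       l 0, 0, 0, 0, 0, ((ε 0 : ℤ) : ℝ)]
  | XIV => fun (ε : Fin 2 → ℤˣ) (σ τ : Fin 1 → ℝ) (l : Fin 2 → ℝ) =>
    !![0, 0, 0, 0, 0, l 0;
       0, ((ε 1 : ℤ) : ℝ), 0, 0, l 1, 0;
       0, 0, -τ 0, σ 0, 0, 0;
       0, 0, σ 0, τ 0, 0, 0;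
       0, l 1, 0, 0, 0, 0;
       l 0, 0, 0, 0, 0, ((ε 0 : ℤ) : ℝ)]
  | XV => fun (ε : Fin 2 → ℤˣ) _ _ (l : Fin 4 → ℝ) =>
    !![0, 0, 0, 0, 0, l 0;
       0, ((ε 1 : ℤ) : ℝ), 0, 0, l 1, 0;
       0, 0, l 2, l 3, 0, 0;
       0, 0, l 3, l 2, 0, 0;
       0, l 1, 0, 0, 0, 0;
       l 0, 0, 0, 0, 0, ((ε 0 : ℤ) : ℝ)]
  | XVI => fun (ε : Fin 1 → ℤˣ) (σ τ : Fin 2 → ℝ) (l : Fin 1 → ℝ) =>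
    !![0, 0, 0, 0, 0, l 0;
       0, -τ 1, 0, 0, σ 1, 0;
       0, 0, -τ 0, σ 0, 0, 0;
       0, 0, σ 0, τ 0, 0, 0;
       0, σ 1, 0, 0, τ 1, 0;
       l 0, 0, 0, 0, 0, ((ε 0 : ℤ) : ℝ)]
  | XVII => fun (ε : Fin 1 → ℤˣ) (σ τ : Fin 1 → ℝ) (l : Fin 3 → ℝ) =>
    !![0, 0, 0, 0, 0, l 0;
       0, -τ 0, 0, 0, σ 0, 0;
       0, 0, l 1, l 2, 0, 0;
       0, 0, l 2, l 1, 0, 0;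
       0, σ 0, 0, 0, τ 0, 0;
       l 0, 0, 0, 0, 0, ((ε 0 : ℤ) : ℝ)]
  | XVIII => fun (ε : Fin 1 → ℤˣ) _ _ (l : Fin 5 → ℝ) =>
    !![0, 0, 0, 0, 0, l 0;
       0, l 3, 0, 0, l 4, 0;
       0, 0, l 1, l 2, 0, 0;
       0, 0, l 2, l 1, 0, 0;
       0, l 4, 0, 0, l 3, 0;
       l 0, 0, 0, 0, 0, ((ε 0 : ℤ) : ℝ)]
  | XIX => fun (ε : Fin 1 → ℤˣ) _ _ (l : Fin 2 → ℝ) =>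
    let e : ℝ := ((ε 0 : ℤ) : ℝ)
    !![0, 0, 0, 0, 0, l 0;
       0, 0, 0, 0, l 0, 1;
       0, 0, e / 2 * (l 0 - l 1), (l 0 + l 1) / 2, 1 / √2, 0;
       0, 0, (l 0 + l 1) / 2, e / 2 * (l 0 - l 1), e / √2, 0;
       0, l 0, 1 / √2, e / √2, 0, 0;
       l 0, 1, 0, 0, 0, 0]
  | XX => fun _ _ _ (l : Fin 2 → ℝ) =>
    !![0, 0, 0, 0, 0, l 0;
       0, (l 0 - l 1) / 2, 0, -(1 / √2), (l 0 + l 1) / 2, 1 / √2;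
       0, 0, 0, l 1, 0, 0;
       0, -(1 / √2), l 1, 0, 1 / √2, 0;
       0, (l 0 + l 1) / 2, 0, 1 / √2, (l 0 - l 1) / 2, 1 / √2;
       l 0, 1 / √2, 0, 0, 1 / √2, 0]
  | XXI => fun (ε : Fin 2 → ℤˣ) _ _ (l : Fin 3 → ℝ) =>
    let e : ℝ := ((ε 0 : ℤ) : ℝ)
    !![((ε 1 : ℤ) : ℝ), 0, 0, 0, 0, l 1;
       0, 0, e / √2, 1 / √2, l 0, 0;
       0, e / √2, e / 2 * (l 0 - l 2), (l 0 + l 2) / 2, 0, 0;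
       0, 1 / √2, (l 0 + l 2) / 2, e / 2 * (l 0 - l 2), 0, 0;
       0, l 0, 0, 0, 0, 0;
       l 1, 0, 0, 0, 0, 0]
  | XXII => fun (ε : Fin 1 → ℤˣ) (σ τ : Fin 1 → ℝ) (l : Fin 2 → ℝ) =>
    let e : ℝ := ((ε 0 : ℤ) : ℝ)
    !![-τ 0, 0, 0, 0, 0, σ 0;
       0, 0, e / √2, 1 / √2, l 0, 0;
       0, e / √2, e / 2 * (l 0 - l 1), (l 0 + l 1) / 2, 0, 0;
       0, 1 / √2, (l 0 + l 1) / 2, e / 2 * (l 0 - l 1), 0, 0;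
       0, l 0, 0, 0, 0, 0;
       σ 0, 0, 0, 0, 0, τ 0]
  | XXIII => fun (ε : Fin 1 → ℤˣ) _ _ (l : Fin 4 → ℝ) =>
    let e : ℝ := ((ε 0 : ℤ) : ℝ)
    !![l 2, 0, 0, 0, 0, l 3;
       0, e / 2 * (l 0 - l 1), e / √2, 0, (l 0 + l 1) / 2, 0;
       0, e / √2, 0, l 0, 1 / √2, 0;
       0, 0, l 0, 0, 0, 0;
       0, (l 0 + l 1) / 2, 1 / √2, 0, e / 2 * (l 0 - l 1), 0;
       l 3, 0, 0, 0, 0, l 2]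

/-- In XIII, XIV and XV the real blocks of size two are interchangeable, so that only the number of
signs `+1` matters: the blocks are listed with the positive signs first. -/
def SignsSorted : (m : Metaclass) → (Fin m.numSigns → ℤˣ) → Prop
  | XIII => fun (ε : Fin 3 → ℤˣ) => (ε 0 = -1 → ε 1 = -1) ∧ (ε 1 = -1 → ε 2 = -1)
  | XIV => fun (ε : Fin 2 → ℤˣ) => ε 0 = -1 → ε 1 = -1
  | XV => fun (ε : Fin 2 → ℤˣ) => ε 0 = -1 → ε 1 = -1
  | _ => fun _ => True

/-- The index set of the scalars: first the `σ`, then the `τ`, then the `λ`. -/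
abbrev ScalarIndex (m : Metaclass) : Type :=
  Fin m.numPairs ⊕ Fin m.numPairs ⊕ Fin m.numReals

end Metaclass

/-- A family of normal forms: a metaclass with a choice of the signs, up to the order of
interchangeable blocks. -/
abbrev NormalFamily : Type :=
  {f : Σ m : Metaclass, Fin m.numSigns → ℤˣ // f.1.SignsSorted f.2}

namespace NormalFamily

/-- The metaclass of a family. -/
def metaclass (f : NormalFamily) : Metaclass := f.1.1

/-- The normal form of the family `f` with the scalars `θ`. -/
noncomputable def form (f : NormalFamily) (θ : f.metaclass.ScalarIndex → ℝ) :
    Matrix (Fin 6) (Fin 6) ℝ :=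
  f.1.1.normalForm f.1.2 (fun i => θ (.inl i)) (fun i => θ (.inr (.inl i)))
    (fun i => θ (.inr (.inr i)))

/-- The scalars that occur in the family: every `τ` is positive, and the normal form has
determinant `±1`. -/
def Admissible (f : NormalFamily) (θ : f.metaclass.ScalarIndex → ℝ) : Prop :=
  (∀ i, 0 < θ (.inr (.inl i))) ∧ |(f.form θ).det| = 1

/-- The tensor `F` takes, in the frame `b`, the normal form of the family `f` for admissible scalars.
If no real block of the metaclass has odd size, the form may also be the one conjugated by `Σ`. -/
def TakenBy (f : NormalFamily) {V : Type*} [AddCommGroup V] [Module ℝ V]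
    (F : V → V → V → V → ℝ) (b : Module.Basis (Fin 4) ℝ V) : Prop :=
  ∃ θ : f.metaclass.ScalarIndex → ℝ, f.Admissible θ ∧
    (petrov F b = f.form θ ∨
      (∀ k ∈ f.metaclass.segre.reals, Even k) ∧
        petrov F b = sigmaMatrix.transpose * f.form θ * sigmaMatrix)

end NormalFamily

/-! In a frame an area metric is a symmetric invertible 6×6 matrix `A`. A change of frame `g` acts
on it by congruence with `Λ²g`, and `Λ²g` multiplies `Σ`, the wedge product of bivectors, by `det
g`. Once the frame is scaled so that `|det A| = 1`, the problem is to classify symmetric matrices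
`A`, or equivalently endomorphisms `ΣA` that are self-adjoint for `Σ`, up to the isometries of `Σ`
that come from `SL(4)`.

Classification under the full isometry group. Over `ℂ⁶` with its conjugation, non-degeneracy yields
for some eigenvalue a Jordan chain on which `Σ` is antidiagonal. A complex chain can be scaled to
constant 1, a real one only to a sign. The orthogonal complement of a real chain, or of a conjugate
pair of chains, is again stable and non-degenerate, so induction gives a full decomposition
(`exists_hasLabels`). Its labels (eigenvalues, sizes, signs) determine the pair of form and
endomorphism up to a real isometry (`IsChainFamily.exists_equiv`). Since `Σ` has signature (3,3),
the signs of the odd real blocks add up to zero (`IsChainFamily.balanced`); a finite enumeration of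
the remaining shapes gives the 46 families (`exists_family`), and each normal form realises its
shape (`Metaclass.hasLabels_normalForm`). Conversely, the labels of the real chains are invariants:
block sizes come from ranks (`HasSegreType.unique`), and signs from the inertia of the hermitian
forms `B (star x) (N ^ k x)`, `N = J - t` (`IsChainFamily.real_perm`).

From isometries to oriented frames. An isometry of determinant 1 is `Λ²g` or `-Λ²g` with `det g = 1`
(`IsSpecialSigma.isWedge`), and the sign is invisible to congruence. An isometry of determinant -1
is corrected by reversing a real chain of odd length (`IsChainFamily.exists_det_neg_one`). If there
is none, composition with `Σ`, itself an isometry of determinant -1, leads to the form conjugated by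
`Σ`.

Dependence of the scalars. Up to sign the determinant of a normal form is the product of its
eigenvalues, which is homogeneous of degree 6. By Euler's relation its differential does not vanish
where the determinant is `±1`, and the implicit function theorem applies
(`NormalFamily.exists_implicit`). -/

open Polynomial Module

/-! # Self-adjoint endomorphisms of a complex space with a real structure -/

section Chains

set_option linter.unusedSectionVars false

variable {E : Type*} [AddCommGroup E] [Module ℂ E] [StarAddMonoid E] [StarModule ℂ E]

/-- `B` is a symmetric bilinear form and `J` an endomorphism that is self-adjoint for `B`, both
compatible with the conjugation `star`. -/
structure RealSelfAdjoint (B : LinearMap.BilinForm ℂ E) (J : Module.End ℂ E) : Prop where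
  symm : ∀ x y, B x y = B y x
  map_star : ∀ x y, B (star x) (star y) = star (B x y)
  selfAdj : ∀ x y, B (J x) y = B x (J y)
  star_apply : ∀ x, J (star x) = star (J x)

/-- The vector `w` generates a Jordan chain of length `k` with eigenvalue `z`, on which `B` is
antidiagonal with entries `ε`. -/
structure IsJordanChain (B : LinearMap.BilinForm ℂ E) (J : Module.End ℂ E) (z : ℂ) (k : ℕ) (ε : ℂ)
    (w : E) : Prop where
  pos : 0 < k
  pow_eq_zero : ((J - z • 1) ^ k) w = 0
  pairing : ∀ j, j < k → B w (((J - z • 1) ^ j) w) = if j + 1 = k then ε else 0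

/-- The cyclic subspaces generated by `w` and `w'` are orthogonal. -/
def IsOrth (B : LinearMap.BilinForm ℂ E) (J : Module.End ℂ E) (w w' : E) : Prop :=
  ∀ p : ℂ[X], B w (aeval J p w') = 0

lemma sub_smul_one_pow_eq_aeval (J : Module.End ℂ E) (z : ℂ) (j : ℕ) :
    (J - z • 1) ^ j = aeval J ((X - C z) ^ j) := by
  simp [Algebra.algebraMap_eq_smul_one]

variable {B : LinearMap.BilinForm ℂ E} {J : Module.End ℂ E}

lemma aeval_mem {U : Submodule ℂ E} (hU : ∀ x ∈ U, J x ∈ U) (p : ℂ[X]) {x : E} (hx : x ∈ U) :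
    aeval J p x ∈ U := by
  induction p using Polynomial.induction_on generalizing x with
  | C a => simpa [Algebra.algebraMap_eq_smul_one] using U.smul_mem a hx
  | add p q hp hq => simpa using U.add_mem (hp hx) (hq hx)
  | monomial n a h =>
    have := h (hU x hx)
    simpa [pow_succ] using this

lemma sub_pow_mem {U : Submodule ℂ E} (hU : ∀ x ∈ U, J x ∈ U) (z : ℂ) (j : ℕ) {x : E}
    (hx : x ∈ U) : ((J - z • 1) ^ j) x ∈ U := by
  rw [sub_smul_one_pow_eq_aeval]
  exact aeval_mem hU _ hx

namespace RealSelfAdjoint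

variable (h : RealSelfAdjoint B J)
include h

lemma aeval_selfAdj (p : ℂ[X]) (x y : E) : B (aeval J p x) y = B x (aeval J p y) := by
  induction p using Polynomial.induction_on generalizing x y with
  | C a => simp [Algebra.algebraMap_eq_smul_one]
  | add p q hp hq => simp [hp, hq]
  | monomial n a ih =>
    have h1 : aeval J (C a * X ^ (n + 1)) = aeval J (C a * X ^ n) * J := by simp [pow_succ, mul_assoc]
    have h2 : aeval J (C a * X ^ (n + 1)) = J * aeval J (C a * X ^ n) := by
      rw [show (C a * X ^ (n + 1) : ℂ[X]) = X * (C a * X ^ n) by ring, map_mul, aeval_X]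
    conv_lhs => rw [h1]
    rw [h2]
    simp only [Module.End.mul_apply]
    rw [ih, h.selfAdj]

lemma sub_pow_selfAdj (z : ℂ) (j : ℕ) (x y : E) :
    B (((J - z • 1) ^ j) x) y = B x (((J - z • 1) ^ j) y) := by
  rw [sub_smul_one_pow_eq_aeval, h.aeval_selfAdj]

lemma star_sub_pow (z : ℂ) (j : ℕ) (x : E) :
    ((J - star z • 1) ^ j) (star x) = star (((J - z • 1) ^ j) x) := by
  induction j generalizing x with
  | zero => simp
  | succ j ih =>
    rw [pow_succ, pow_succ, Module.End.mul_apply, Module.End.mul_apply, ← ih]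
    simp [h.star_apply, star_smul]

/-- Conjugating the coefficients of `p` gives `q`. Bare existence is enough, because `IsOrth`
quantifies over all polynomials. -/
lemma star_aeval (p : ℂ[X]) (x : E) :
    ∃ q : ℂ[X], aeval J p (star x) = star (aeval J q x) := by
  induction p using Polynomial.induction_on generalizing x with
  | C a => exact ⟨C (star a), by simp [Algebra.algebraMap_eq_smul_one]⟩
  | add p q hp hq =>
    obtain ⟨p', hp'⟩ := hp x
    obtain ⟨q', hq'⟩ := hq x
    exact ⟨p' + q', by simp [hp', hq']⟩
  | monomial n a ih =>
    obtain ⟨q, hq⟩ := ih (J x)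
    refine ⟨q * X, ?_⟩
    rw [pow_succ, ← mul_assoc, map_mul, aeval_X, Module.End.mul_apply, h.star_apply, hq]
    simp

lemma isOrth_symm {w w' : E} (hw : IsOrth B J w w') : IsOrth B J w' w := fun p => by
  rw [h.symm, h.aeval_selfAdj]
  exact hw p

lemma isOrth_star {w w' : E} (hw : IsOrth B J w w') : IsOrth B J (star w) (star w') := fun p => by
  obtain ⟨q, hq⟩ := h.star_aeval p w'
  rw [hq, h.map_star, hw q, star_zero]

/-- By Bézout every polynomial is a combination of the coprime powers `(X - z)^k` and `(X - z')^l`.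
The second kills `w'`; the first, moved across `B`, kills `w`. -/
lemma isOrth_of_ne {z z' : ℂ} (hz : z ≠ z') {k l : ℕ} {w w' : E}
    (hw : ((J - z • 1) ^ k) w = 0) (hw' : ((J - z' • 1) ^ l) w' = 0) : IsOrth B J w w' := by
  intro r
  have hc : IsCoprime ((X - C z : ℂ[X]) ^ k) ((X - C z') ^ l) :=
    (Polynomial.isCoprime_X_sub_C_of_isUnit_sub (sub_ne_zero.2 hz).isUnit).pow
  obtain ⟨a, b, hab⟩ := hc
  have h1 : r = (X - C z) ^ k * (r * a) + (r * b) * (X - C z') ^ l := by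
    calc r = r * (a * (X - C z) ^ k + b * (X - C z') ^ l) := by rw [hab, mul_one]
      _ = _ := by ring
  rw [h1, map_add, LinearMap.add_apply, map_mul, map_mul (aeval J) (r * b), Module.End.mul_apply,
    Module.End.mul_apply, ← sub_smul_one_pow_eq_aeval, ← sub_smul_one_pow_eq_aeval, hw', map_zero,
    add_zero, ← h.sub_pow_selfAdj, hw]
  simp

lemma chain_star {z : ℂ} {k : ℕ} {ε : ℂ} (hε : star ε = ε) {w : E} (hw : IsJordanChain B J z k ε w) :
    IsJordanChain B J (star z) k ε (star w) where
  pos := hw.pos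
  pow_eq_zero := by rw [h.star_sub_pow, hw.pow_eq_zero, star_zero]
  pairing := fun j hj => by
    rw [h.star_sub_pow, h.map_star, hw.pairing j hj]
    split_ifs <;> simp [hε]

/-- A vector whose top pairing is `ε = ± 1` can be changed by a polynomial in `J` so that all other
pairings vanish. -/
lemma exists_isJordanChain {U : Submodule ℂ E} (hU : ∀ x ∈ U, J x ∈ U) {z : ℂ} {k : ℕ} {ε : ℂ}
    (hε : ε * ε = 1) (hε' : star ε = ε) {w : E} (hwU : w ∈ U)
    (hw : ((J - z • 1) ^ (k + 1)) w = 0) (hp : B w (((J - z • 1) ^ k) w) = ε) :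
    ∃ w' ∈ U, (star w = w → star z = z → star w' = w') ∧ IsJordanChain B J z (k + 1) ε w' := by
  -- Induction from the top: after `m` corrections the `m` pairings just below the top one vanish.
  suffices H : ∀ m : ℕ, ∃ w' ∈ U, (star w = w → star z = z → star w' = w') ∧
      ((J - z • 1) ^ (k + 1)) w' = 0 ∧ B w' (((J - z • 1) ^ k) w') = ε ∧
      ∀ j, j < k → k ≤ j + m → B w' (((J - z • 1) ^ j) w') = 0 by
    obtain ⟨w', h1, h2, h3, h4, h5⟩ := H k
    refine ⟨w', h1, h2, Nat.succ_pos _, h3, fun j hj => ?_⟩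
    split_ifs with hjk
    · obtain rfl : j = k := by omega
      exact h4
    · exact h5 j (by omega) (by omega)
  intro m
  induction m with
  | zero => exact ⟨w, hwU, fun h _ => h, hw, hp, fun j h1 h2 => by omega⟩
  | succ m ih =>
    obtain ⟨v, hvU, hvs, hv0, hvk, hvj⟩ := ih
    set N := J - z • (1 : Module.End ℂ E) with hN
    by_cases hm : k ≤ m
    · exact ⟨v, hvU, hvs, hv0, hvk, fun j h1 h2 => hvj j h1 (by omega)⟩
    push Not at hm
    have hzero : ∀ i, k < i → (N ^ i) v = 0 := fun i hi => by
      obtain ⟨d, rfl⟩ := Nat.exists_eq_add_of_lt hi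
      rw [show k + d + 1 = d + (k + 1) by ring, pow_add, Module.End.mul_apply, hv0, map_zero]
    set s := B v ((N ^ (k - (m + 1))) v) with hs
    -- Adding `a • N ^ (m + 1) v` changes the pairing at `j = k - (m + 1)` by `2 * a * ε`, which is
    -- `-s` because `ε * ε = 1`. The pairings at larger `j` are unaffected, since the shifted powers
    -- exceed `k` and kill `v`.
    set a : ℂ := -(ε * s / 2) with ha
    have hexp : ∀ j, B (v + a • (N ^ (m + 1)) v) ((N ^ j) (v + a • (N ^ (m + 1)) v)) =
        B v ((N ^ j) v) + 2 * a * B v ((N ^ (j + (m + 1))) v)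
          + a * a * B v ((N ^ (j + (m + 1) + (m + 1))) v) := by
      intro j
      simp only [map_add, map_smul, LinearMap.add_apply, LinearMap.smul_apply, smul_eq_mul]
      rw [h.sub_pow_selfAdj, h.sub_pow_selfAdj, ← Module.End.mul_apply, ← Module.End.mul_apply,
        ← Module.End.mul_apply, ← pow_add, ← pow_add, ← pow_add, show (m + 1 + (j + (m + 1))) =
          j + (m + 1) + (m + 1) by ring, show m + 1 + j = j + (m + 1) by ring]
      ring
    refine ⟨v + a • (N ^ (m + 1)) v, U.add_mem hvU (U.smul_mem _ (sub_pow_mem hU z _ hvU)), ?_, ?_,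
      ?_, ?_⟩
    · intro h1 h2
      have h3 := hvs h1 h2
      have h4 : ∀ j, star ((N ^ j) v) = (N ^ j) v := fun j => by
        have := h.star_sub_pow z j v
        rw [h2, h3] at this
        exact this.symm
      have h5 : star s = s := by rw [hs, ← h.map_star, h3, h4]
      have h6 : star a = a := by
        rw [ha, star_neg, star_div₀, star_mul, h5, hε']
        simp [mul_comm]
      rw [star_add, star_smul, h3, h4, h6]
    · rw [map_add, map_smul, hv0, ← Module.End.mul_apply, ← pow_add, hzero _ (by omega)]
      simp
    · rw [hexp, hzero (k + (m + 1)) (by omega), hzero (k + (m + 1) + (m + 1)) (by omega), hvk]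
      simp
    · intro j hj1 hj2
      rw [hexp, hzero (j + (m + 1) + (m + 1)) (by omega)]
      by_cases hjm : k ≤ j + m
      · rw [hvj j hj1 hjm, hzero _ (by omega)]
        simp
      · obtain rfl : j = k - (m + 1) := by omega
        rw [show k - (m + 1) + (m + 1) = k by omega, hvk, ← hs, ha]
        simp only [map_zero, mul_zero, add_zero]
        linear_combination (-s) * hε

end RealSelfAdjoint

end Chains

/-! ### Orthogonal systems of chains and complements of cyclic subspaces -/

section Systems

set_option linter.unusedSectionVars false

variable {E : Type*} [AddCommGroup E] [Module ℂ E] [StarAddMonoid E] [StarModule ℂ E]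
variable {B : LinearMap.BilinForm ℂ E} {J : Module.End ℂ E}

/-- A system of mutually orthogonal chains in `U`: complex chains with their labels (eigenvalue in
the upper half plane and length), which stand for themselves and their conjugates, and real chains
with their labels (eigenvalue, length and sign). -/
structure IsSystem (B : LinearMap.BilinForm ℂ E) (J : Module.End ℂ E) (U : Submodule ℂ E)
    (P : List ((ℂ × ℕ) × E)) (R : List ((ℝ × ℕ × ℤˣ) × E)) : Prop where
  pair : ∀ p ∈ P, p.2 ∈ U ∧ 0 < p.1.1.im ∧ IsJordanChain B J p.1.1 p.1.2 1 p.2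
  real : ∀ r ∈ R, r.2 ∈ U ∧ star r.2 = r.2 ∧
    IsJordanChain B J (r.1.1 : ℂ) r.1.2.1 ((r.1.2.2 : ℤ) : ℂ) r.2
  pair_pair : P.Pairwise fun p q => IsOrth B J p.2 q.2 ∧ IsOrth B J p.2 (star q.2)
  real_real : R.Pairwise fun p q => IsOrth B J p.2 q.2
  pair_real : ∀ p ∈ P, ∀ r ∈ R, IsOrth B J p.2 r.2

/-- `U` contains a system of chains with the given lists of labels. -/
def HasLabels (B : LinearMap.BilinForm ℂ E) (J : Module.End ℂ E) (U : Submodule ℂ E)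
    (LP : List (ℂ × ℕ)) (LR : List (ℝ × ℕ × ℤˣ)) : Prop :=
  ∃ P R, IsSystem B J U P R ∧ P.map Prod.fst = LP ∧ R.map Prod.fst = LR

lemma units_coe_mul_self (e : ℤˣ) : ((e : ℤ) : ℂ) * ((e : ℤ) : ℂ) = 1 := by
  rcases Int.units_eq_one_or e with rfl | rfl <;> simp

lemma units_coe_star (e : ℤˣ) : star (((e : ℤ) : ℂ)) = ((e : ℤ) : ℂ) := by
  rcases Int.units_eq_one_or e with rfl | rfl <;> simp

lemma isOrth_of_subspaces {U V : Submodule ℂ E} (hV : ∀ x ∈ V, J x ∈ V)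
    (hUV : ∀ x ∈ U, ∀ y ∈ V, B x y = 0) {w w' : E} (hw : w ∈ U) (hw' : w' ∈ V) :
    IsOrth B J w w' := fun p => hUV _ hw _ (aeval_mem hV p hw')

lemma HasLabels.append {U V : Submodule ℂ E} {LP LP' : List (ℂ × ℕ)} {LR LR' : List (ℝ × ℕ × ℤˣ)}
    (hB : RealSelfAdjoint B J)
    (hU : HasLabels B J U LP LR) (hV : HasLabels B J V LP' LR') (hVJ : ∀ x ∈ V, J x ∈ V)
    (hVs : ∀ x ∈ V, star x ∈ V) (hUV : ∀ x ∈ U, ∀ y ∈ V, B x y = 0) :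
    HasLabels B J (U ⊔ V) (LP ++ LP') (LR ++ LR') := by
  obtain ⟨P, R, h, rfl, rfl⟩ := hU
  obtain ⟨P', R', h', rfl, rfl⟩ := hV
  have key : ∀ {w w' : E}, w ∈ U → w' ∈ V → IsOrth B J w w' := isOrth_of_subspaces hVJ hUV
  refine ⟨P ++ P', R ++ R', ⟨?_, ?_, ?_, ?_, ?_⟩, by simp, by simp⟩
  · intro p hp
    rcases List.mem_append.1 hp with hp | hp
    · exact ⟨Submodule.mem_sup_left (h.pair p hp).1, (h.pair p hp).2⟩
    · exact ⟨Submodule.mem_sup_right (h'.pair p hp).1, (h'.pair p hp).2⟩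
  · intro p hp
    rcases List.mem_append.1 hp with hp | hp
    · exact ⟨Submodule.mem_sup_left (h.real p hp).1, (h.real p hp).2⟩
    · exact ⟨Submodule.mem_sup_right (h'.real p hp).1, (h'.real p hp).2⟩
  · refine List.pairwise_append.2 ⟨h.pair_pair, h'.pair_pair, fun p hp q hq => ?_⟩
    exact ⟨key (h.pair p hp).1 (h'.pair q hq).1, key (h.pair p hp).1 (hVs _ (h'.pair q hq).1)⟩
  · refine List.pairwise_append.2 ⟨h.real_real, h'.real_real, fun p hp q hq => ?_⟩
    exact key (h.real p hp).1 (h'.real q hq).1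
  · intro p hp r hr
    rcases List.mem_append.1 hp with hp | hp <;> rcases List.mem_append.1 hr with hr | hr
    · exact h.pair_real p hp r hr
    · exact key (h.pair p hp).1 (h'.real r hr).1
    · exact hB.isOrth_symm (key (h.real r hr).1 (h'.pair p hp).1)
    · exact h'.pair_real p hp r hr

lemma HasLabels.mono {U V : Submodule ℂ E} {LP : List (ℂ × ℕ)} {LR : List (ℝ × ℕ × ℤˣ)}
    (hU : HasLabels B J U LP LR) (hUV : U ≤ V) : HasLabels B J V LP LR := by
  obtain ⟨P, R, h, rfl, rfl⟩ := hU
  exact ⟨P, R, ⟨fun p hp => ⟨hUV (h.pair p hp).1, (h.pair p hp).2⟩,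
    fun p hp => ⟨hUV (h.real p hp).1, (h.real p hp).2⟩, h.pair_pair, h.real_real, h.pair_real⟩,
    rfl, rfl⟩

lemma HasLabels.nil (U : Submodule ℂ E) : HasLabels B J U [] [] :=
  ⟨[], [], ⟨by simp, by simp, by simp, by simp, by simp⟩, rfl, rfl⟩

lemma List.Perm.exists_map_eq {α β : Type*} {f : α → β} {l' l : List β} (h : l'.Perm l) :
    ∀ {m : List α}, m.map f = l' → ∃ m', m.Perm m' ∧ m'.map f = l := by
  induction h with
  | nil => exact fun {m} hm => ⟨m, .refl _, hm⟩
  | cons x _ ih =>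
    intro m hm
    obtain ⟨a, m₁, rfl, rfl, h₁⟩ := List.map_eq_cons_iff.1 hm
    obtain ⟨m', h1, h2⟩ := ih h₁
    exact ⟨a :: m', h1.cons a, by simp [h2]⟩
  | swap x y l =>
    intro m hm
    obtain ⟨a, m₁, rfl, rfl, h₁⟩ := List.map_eq_cons_iff.1 hm
    obtain ⟨b, m₂, rfl, rfl, rfl⟩ := List.map_eq_cons_iff.1 h₁
    exact ⟨b :: a :: m₂, List.Perm.swap _ _ _, rfl⟩
  | trans _ _ ih1 ih2 =>
    intro m hm
    obtain ⟨m1, h1, h2⟩ := ih1 hm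
    obtain ⟨m2, h3, h4⟩ := ih2 h2
    exact ⟨m2, h1.trans h3, h4⟩

lemma HasLabels.perm {U : Submodule ℂ E} {LP LP' : List (ℂ × ℕ)} {LR LR' : List (ℝ × ℕ × ℤˣ)}
    (hB : RealSelfAdjoint B J) (hU : HasLabels B J U LP LR) (hP : LP.Perm LP')
    (hR : LR.Perm LR') : HasLabels B J U LP' LR' := by
  obtain ⟨P, R, h, h1, h2⟩ := hU
  obtain ⟨P', hP', h3⟩ := hP.exists_map_eq h1
  obtain ⟨R', hR', h4⟩ := hR.exists_map_eq h2
  refine ⟨P', R', ⟨fun p hp => h.pair p (hP'.mem_iff.2 hp), fun p hp => h.real p (hR'.mem_iff.2 hp),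
    (hP'.pairwise_iff ?_).1 h.pair_pair, (hR'.pairwise_iff ?_).1 h.real_real,
    fun p hp r hr => h.pair_real p (hP'.mem_iff.2 hp) r (hR'.mem_iff.2 hr)⟩, h3, h4⟩
  · rintro x y ⟨hx, hy⟩
    exact ⟨hB.isOrth_symm hx, by simpa using hB.isOrth_star (hB.isOrth_symm hy)⟩
  · exact fun hx => hB.isOrth_symm hx

lemma RealSelfAdjoint.pairing_chain (hB : RealSelfAdjoint B J) {z : ℂ} {k : ℕ} {ε : ℂ} {w : E}
    (hw : IsJordanChain B J z k ε w) (i j : ℕ) :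
    B (((J - z • 1) ^ i) w) (((J - z • 1) ^ j) w) = if i + j + 1 = k then ε else 0 := by
  rw [hB.sub_pow_selfAdj, ← Module.End.mul_apply, ← pow_add]
  by_cases h : i + j < k
  · exact hw.pairing _ h
  · rw [if_neg (by omega), show i + j = (i + j - k) + k by omega, pow_add, Module.End.mul_apply,
      hw.pow_eq_zero]
    simp

lemma RealSelfAdjoint.pairing_orth (hB : RealSelfAdjoint B J) {w w' : E} (h : IsOrth B J w w')
    (z z' : ℂ) (i j : ℕ) : B (((J - z • 1) ^ i) w) (((J - z' • 1) ^ j) w') = 0 := by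
  rw [sub_smul_one_pow_eq_aeval, sub_smul_one_pow_eq_aeval, hB.aeval_selfAdj,
    ← Module.End.mul_apply, ← map_mul]
  exact h _

/-- The vectors of `U` orthogonal to the cyclic subspaces generated by the `g b`. -/
def cyclicCompl (B : LinearMap.BilinForm ℂ E) (J : Module.End ℂ E) (U : Submodule ℂ E)
    {β : Type*} (g : β → E) : Submodule ℂ E where
  carrier := {x | x ∈ U ∧ ∀ b, IsOrth B J (g b) x}
  add_mem' := fun hx hy => ⟨U.add_mem hx.1 hy.1, fun b p => by simp [hx.2 b p, hy.2 b p]⟩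
  zero_mem' := ⟨U.zero_mem, fun b p => by simp⟩
  smul_mem' := fun c x hx => ⟨U.smul_mem c hx.1, fun b p => by simp [hx.2 b p]⟩

lemma apply_mem_cyclicCompl {U : Submodule ℂ E} (hU : ∀ x ∈ U, J x ∈ U) {β : Type*} {g : β → E}
    {x : E} (hx : x ∈ cyclicCompl B J U g) : J x ∈ cyclicCompl B J U g :=
  ⟨hU x hx.1, fun b p => by
    have := hx.2 b (p * X)
    rwa [map_mul, aeval_X, Module.End.mul_apply] at this⟩

/-- The vectors orthogonal to all powers `N ^ i w` form a `J`-stable subspace, because `N` moves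
across `B` and raises `i`. Powers with `i ≥ k` vanish, so `k` conditions imply orthogonality for
every polynomial in `J`. -/
lemma isOrth_of_pairing (hB : RealSelfAdjoint B J) {z : ℂ} {k : ℕ} {ε : ℂ} {w x : E}
    (hw : IsJordanChain B J z k ε w)
    (hx : ∀ i < k, B (((J - z • 1) ^ i) w) x = 0) : IsOrth B J w x := by
  let V : Submodule ℂ E :=
    { carrier := {x : E | ∀ i : ℕ, B (((J - z • (1 : Module.End ℂ E)) ^ i : Module.End ℂ E) w) x = 0}
      add_mem' := fun ha hb i => by simp [ha i, hb i]
      zero_mem' := fun i => by simp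
      smul_mem' := fun c x h i => by simp [h i] }
  have hV : ∀ y ∈ V, J y ∈ V := fun y hy i => by
    have h1 : J y = (J - z • 1) y + z • y := by simp
    rw [h1, map_add, map_smul, hy i, smul_zero, add_zero]
    have := hB.sub_pow_selfAdj z 1 (((J - z • 1) ^ i) w) y
    rw [pow_one] at this
    rw [← this, ← Module.End.mul_apply, ← pow_succ']
    exact hy (i + 1)
  have hxV : x ∈ V := fun i => by
    by_cases h : i < k
    · exact hx i h
    · rw [show i = (i - k) + k by omega, pow_add, Module.End.mul_apply, hw.pow_eq_zero]
      simp
  intro p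
  simpa using aeval_mem hV p hxV 0

section Complement

variable {U : Submodule ℂ E} {β : Type*} [Fintype β] {g : β → E} {z ε : β → ℂ} {k : ℕ}

/-- `B` pairs place `i` of a chain only with place `k - 1 - i`, with value `ε`; as `ε * ε = 1`,
reversing the chain and multiplying by `ε` gives the dual vectors. Indexing by `β` covers a single
real chain and a conjugate pair of chains at once. -/
lemma cyclic_dual (hB : RealSelfAdjoint B J) (hε : ∀ b, ε b * ε b = 1)
    (hch : ∀ b, IsJordanChain B J (z b) k (ε b) (g b))
    (horth : ∀ b b', b ≠ b' → IsOrth B J (g b) (g b')) (p q : β × Fin k) [DecidableEq β] :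
    B (((J - z p.1 • 1) ^ (p.2 : ℕ)) (g p.1))
      (ε q.1 • ((J - z q.1 • 1) ^ (k - 1 - q.2 : ℕ)) (g q.1)) = if p = q then 1 else 0 := by
  obtain ⟨b, i⟩ := p
  obtain ⟨b', j⟩ := q
  rw [map_smul]
  by_cases hb : b = b'
  · subst hb
    simp only [hB.pairing_chain (hch b), Prod.mk.injEq, true_and]
    have := i.2
    have := j.2
    by_cases hij : i = j
    · subst hij
      rw [if_pos (by omega), if_pos rfl, smul_eq_mul, hε]
    · rw [if_neg, if_neg hij, smul_zero]
      intro h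
      exact hij (Fin.ext (by omega))
  · simp [hB.pairing_orth (horth b b' hb), hb]

lemma nondegenerate_cyclicCompl (hB : RealSelfAdjoint B J) (hU : ∀ x ∈ U, J x ∈ U)
    (hε : ∀ b, ε b * ε b = 1) (hch : ∀ b, IsJordanChain B J (z b) k (ε b) (g b))
    (horth : ∀ b b', b ≠ b' → IsOrth B J (g b) (g b')) (hg : ∀ b, g b ∈ U)
    (hnd : ∀ x ∈ U, (∀ y ∈ U, B x y = 0) → x = 0) :
    ∀ x ∈ cyclicCompl B J U g, (∀ y ∈ cyclicCompl B J U g, B x y = 0) → x = 0 := by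
  classical
  intro x hx hxy
  refine hnd x hx.1 fun y hy => ?_
  set w : β × Fin k → E := fun p => ((J - z p.1 • 1) ^ (p.2 : ℕ)) (g p.1)
  set w' : β × Fin k → E := fun q => ε q.1 • ((J - z q.1 • 1) ^ (k - 1 - q.2 : ℕ)) (g q.1)
  have hxw : ∀ q, B x (w' q) = 0 := fun q => by
    rw [hB.symm, map_smul, LinearMap.smul_apply, sub_smul_one_pow_eq_aeval, hB.aeval_selfAdj,
      hx.2 q.1, smul_zero]
  have hw'U : ∀ q, w' q ∈ U := fun q => U.smul_mem _ (sub_pow_mem hU _ _ (hg q.1))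
  -- Subtracting the orthogonal projection to the cyclic span puts `y` into the complement, and `x`
  -- does not see the subtracted part.
  have hy' : y - ∑ q, B (w q) y • w' q ∈ cyclicCompl B J U g := by
    refine ⟨U.sub_mem hy (U.sum_mem fun q _ => U.smul_mem _ (hw'U q)), fun b => ?_⟩
    refine isOrth_of_pairing hB (hch b) fun i hi => ?_
    have := fun q => cyclic_dual hB hε hch horth (b, ⟨i, hi⟩) q
    simp only [] at this
    rw [map_sub, map_sum]
    simp only [map_smul, w', this, smul_eq_mul, mul_ite, mul_one, mul_zero] 
    simp [w]
  have h1 := hxy _ hy'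
  rw [map_sub, map_sum] at h1
  simpa [hxw] using h1

/-- Rank and nullity for the map that pairs a vector of `U` with all chain vectors: the dual vectors
make it surjective, and its kernel is the complement. -/
lemma finrank_cyclicCompl [FiniteDimensional ℂ E] (hB : RealSelfAdjoint B J)
    (hU : ∀ x ∈ U, J x ∈ U)
    (hε : ∀ b, ε b * ε b = 1) (hch : ∀ b, IsJordanChain B J (z b) k (ε b) (g b))
    (horth : ∀ b b', b ≠ b' → IsOrth B J (g b) (g b')) (hg : ∀ b, g b ∈ U) :
    Fintype.card β * k + finrank ℂ (cyclicCompl B J U g) = finrank ℂ U := by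
  classical
  set w : β × Fin k → E := fun p => ((J - z p.1 • 1) ^ (p.2 : ℕ)) (g p.1)
  set w' : β × Fin k → E := fun q => ε q.1 • ((J - z q.1 • 1) ^ (k - 1 - q.2 : ℕ)) (g q.1)
  have hw'U : ∀ q, w' q ∈ U := fun q => U.smul_mem _ (sub_pow_mem hU _ _ (hg q.1))
  let φ : U →ₗ[ℂ] (β × Fin k → ℂ) := LinearMap.pi fun p => (B (w p)).comp U.subtype
  have hsurj : LinearMap.range φ = ⊤ := by
    rw [LinearMap.range_eq_top]
    intro f
    refine ⟨∑ q, f q • ⟨w' q, hw'U q⟩, ?_⟩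
    ext p
    have := fun q => cyclic_dual hB hε hch horth p q
    simp only [φ, LinearMap.pi_apply, LinearMap.comp_apply, map_sum, map_smul, Submodule.subtype_apply,
      w, w', this]
    simp
  have hker : (LinearMap.ker φ).map U.subtype = cyclicCompl B J U g := by
    ext x
    constructor
    · rintro ⟨y, hy, rfl⟩
      refine ⟨y.2, fun b => isOrth_of_pairing hB (hch b) fun i hi => ?_⟩
      exact congrFun (LinearMap.mem_ker.1 hy) (b, ⟨i, hi⟩)
    · rintro ⟨hx, hx'⟩
      refine ⟨⟨x, hx⟩, ?_, rfl⟩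
      refine LinearMap.mem_ker.2 (funext fun p => ?_)
      change B (((J - z p.1 • 1) ^ (p.2 : ℕ)) (g p.1)) x = 0
      rw [sub_smul_one_pow_eq_aeval, hB.aeval_selfAdj]
      exact hx' p.1 _
  have h1 := LinearMap.finrank_range_add_finrank_ker φ
  rw [hsurj, finrank_top] at h1
  rw [← hker, ← LinearEquiv.finrank_eq (Submodule.equivSubtypeMap U (LinearMap.ker φ)), ← h1]
  simp

end Complement

end Systems

/-! ### Decomposition into orthogonal Jordan chains -/

section Decomposition

set_option linter.unusedSectionVars false

variable {E : Type*} [AddCommGroup E] [Module ℂ E] [StarAddMonoid E] [StarModule ℂ E]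
variable {B : LinearMap.BilinForm ℂ E} {J : Module.End ℂ E}

/-- Let `k + 1` be the exact nilpotency exponent of `N` on the generalised eigenspace in `U`. Some
`y` there has `N ^ k y ≠ 0`, so by non-degeneracy `N ^ k y` pairs non-trivially with some `u` in
`U`; only the component of `u` in the generalised eigenspace contributes. -/
lemma exists_top_pairing_ne_zero [FiniteDimensional ℂ E] (hB : RealSelfAdjoint B J)
    {U : Submodule ℂ E} (hU : ∀ x ∈ U, J x ∈ U) (hnd : ∀ x ∈ U, (∀ y ∈ U, B x y = 0) → x = 0)
    {z : ℂ} {v : E} (hv : v ∈ U) (hv0 : v ≠ 0) (hvz : J v = z • v) :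
    ∃ k : ℕ, ∃ x ∈ U, ∃ y ∈ U, ((J - z • 1) ^ (k + 1)) x = 0 ∧ ((J - z • 1) ^ (k + 1)) y = 0 ∧
      B x (((J - z • 1) ^ k) y) ≠ 0 := by
  classical
  set N : Module.End ℂ E := J - z • 1 with hN
  have hNU : ∀ x ∈ U, N x ∈ U := fun x hx => by
    have := sub_pow_mem hU z 1 hx
    rwa [pow_one] at this
  let f : Module.End ℂ U := N.restrict hNU
  have hf : ∀ (n : ℕ) (x : U), ((f ^ n) x : E) = (N ^ n) x := fun n x => by
    simp only [f]
    rw [Module.End.pow_restrict n]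
    rfl
  -- Fitting's lemma: for large `n` kernel and range of `N ^ n` on `U` are complementary. The
  -- condition `1 ≤ n` makes `N ^ n` kill the eigenvector `v`, which excludes nilpotency exponent
  -- zero.
  obtain ⟨n, hn, hn1⟩ :=
    (f.eventually_isCompl_ker_pow_range_pow.and (Filter.eventually_ge_atTop 1)).exists
  have hex : ∃ K : ℕ, ∀ x ∈ U, (N ^ n) x = 0 → (N ^ K) x = 0 := ⟨n, fun x _ h => h⟩
  have hK := Nat.find_spec hex
  have hmin := fun m => Nat.find_min (m := m) hex
  obtain hK0 | ⟨k, hk⟩ : Nat.find hex = 0 ∨ ∃ k, Nat.find hex = k + 1 := by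
    rcases Nat.find hex with _ | k
    · exact .inl rfl
    · exact .inr ⟨k, rfl⟩
  · exfalso
    rw [hK0] at hK
    refine hv0 ?_
    have h := hK v hv
    rw [pow_zero] at h
    refine h ?_
    obtain ⟨m, rfl⟩ := Nat.exists_eq_add_of_le' hn1
    rw [pow_succ, Module.End.mul_apply, hN]
    simp [hvz]
  rw [hk] at hK
  have := hmin k (by omega)
  push Not at this
  obtain ⟨y, hyU, hyn, hy⟩ := this
  obtain ⟨u, huU, hu⟩ : ∃ u ∈ U, B ((N ^ k) y) u ≠ 0 := by
    by_contra! hcon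
    exact hy (hnd _ (sub_pow_mem hU z k hyU) hcon)
  -- The Fitting decomposition `u = x + N ^ n q`. The second summand is orthogonal to `N ^ k y`,
  -- since `N ^ n` can be moved onto `y`, which it kills.
  obtain ⟨x, hx, r, ⟨q, rfl⟩, hsum⟩ := Submodule.mem_sup.1 (hn.codisjoint.eq_top ▸
    Submodule.mem_top : (⟨u, huU⟩ : U) ∈ LinearMap.ker (f ^ n) ⊔ LinearMap.range (f ^ n))
  have hxn : (N ^ n) (x : E) = 0 := by rw [← hf, LinearMap.mem_ker.1 hx]; rfl
  refine ⟨k, x, x.2, y, hyU, hK _ x.2 hxn, hK _ hyU hyn, fun h0 => hu ?_⟩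
  have h1 : u = (x : E) + (N ^ n) (q : E) := by
    rw [← hf, ← Submodule.coe_add, hsum]
  rw [hB.symm, h1, map_add, LinearMap.add_apply, h0, zero_add, hB.sub_pow_selfAdj,
    ← Module.End.mul_apply, ← pow_add, add_comm, pow_add, Module.End.mul_apply]
  change B q ((N ^ k) ((N ^ n) y)) = 0
  rw [hyn]
  simp

/-- The form `(x, y) ↦ B x (N ^ k y)` is symmetric, so by polarisation it is non-zero on some `(u,
u)`. Over `ℂ` a square root rescales that value to 1. -/
lemma exists_complex_chain [FiniteDimensional ℂ E] (hB : RealSelfAdjoint B J)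
    {U : Submodule ℂ E} (hU : ∀ x ∈ U, J x ∈ U) (hnd : ∀ x ∈ U, (∀ y ∈ U, B x y = 0) → x = 0)
    {z : ℂ} {v : E} (hv : v ∈ U) (hv0 : v ≠ 0) (hvz : J v = z • v) :
    ∃ k : ℕ, ∃ w ∈ U, IsJordanChain B J z k 1 w := by
  obtain ⟨k, x, hx, y, hy, hx0, hy0, hxy⟩ := exists_top_pairing_ne_zero hB hU hnd hv hv0 hvz
  obtain ⟨u, huU, hu0, hu⟩ : ∃ u ∈ U, ((J - z • 1) ^ (k + 1)) u = 0 ∧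
      B u (((J - z • 1) ^ k) u) ≠ 0 := by
    by_contra! hcon
    have h1 := hcon x hx hx0
    have h2 := hcon y hy hy0
    have h3 := hcon (x + y) (U.add_mem hx hy) (by rw [map_add, hx0, hy0, add_zero])
    have h4 : B y (((J - z • 1) ^ k) x) = B x (((J - z • 1) ^ k) y) := by
      rw [← hB.sub_pow_selfAdj, hB.symm]
    simp only [map_add, LinearMap.add_apply, h1, h2, h4, zero_add, add_zero] at h3
    refine hxy ?_
    linear_combination h3 / 2
  obtain ⟨c, hc⟩ := IsAlgClosed.exists_pow_nat_eq (B u (((J - z • 1) ^ k) u))⁻¹ zero_lt_two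
  obtain ⟨w, hw, -, hch⟩ := hB.exists_isJordanChain hU (z := z) (k := k) (ε := 1) (by simp) (by simp)
    (U.smul_mem c huU) (by rw [map_smul, hu0, smul_zero]) (by
      simp only [map_smul, LinearMap.smul_apply, smul_eq_mul]
      rw [← mul_assoc, ← pow_two, hc, inv_mul_cancel₀ hu])
  exact ⟨_, w, hw, hch⟩

/-- As for complex chains, but the generator must be fixed by the conjugation. Splitting vectors
into real and imaginary parts finds a real `u` with non-zero real top pairing; real scaling
normalises only its absolute value, which is why a sign remains. -/
lemma exists_real_chain [FiniteDimensional ℂ E] (hB : RealSelfAdjoint B J)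
    {U : Submodule ℂ E} (hU : ∀ x ∈ U, J x ∈ U) (hUs : ∀ x ∈ U, star x ∈ U)
    (hnd : ∀ x ∈ U, (∀ y ∈ U, B x y = 0) → x = 0)
    {t : ℝ} {v : E} (hv : v ∈ U) (hv0 : v ≠ 0) (hvz : J v = (t : ℂ) • v) :
    ∃ (k : ℕ) (e : ℤˣ), ∃ w ∈ U, star w = w ∧ IsJordanChain B J t k ((e : ℤ) : ℂ) w := by
  obtain ⟨k, x, hx, y, hy, hx0, hy0, hxy⟩ := exists_top_pairing_ne_zero hB hU hnd hv hv0 hvz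
  have ht : star (t : ℂ) = t := by simp
  set N : Module.End ℂ E := J - (t : ℂ) • 1 with hN
  have hNs : ∀ (j : ℕ) (x : E), (N ^ j) (star x) = star ((N ^ j) x) := fun j x => by
    have := hB.star_sub_pow (t : ℂ) j x
    rwa [ht] at this
  obtain ⟨u, huU, hus, hu0, hu⟩ : ∃ u ∈ U, star u = u ∧ (N ^ (k + 1)) u = 0 ∧
      B u ((N ^ k) u) ≠ 0 := by
    by_contra! hcon
    -- Polarisation among real vectors, followed below by the splitting `x = b + I c` with `b` and
    -- `c` real.
    have hpol : ∀ a ∈ U, ∀ b ∈ U, star a = a → star b = b → (N ^ (k + 1)) a = 0 →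
        (N ^ (k + 1)) b = 0 → B a ((N ^ k) b) = 0 := by
      intro a ha b hb has hbs ha0 hb0
      have h1 := hcon a ha has ha0
      have h2 := hcon b hb hbs hb0
      have h3 := hcon (a + b) (U.add_mem ha hb) (by rw [star_add, has, hbs])
        (by rw [map_add, ha0, hb0, add_zero])
      have h4 : B b ((N ^ k) a) = B a ((N ^ k) b) := by
        rw [← hB.sub_pow_selfAdj, hB.symm]
      simp only [map_add, LinearMap.add_apply, h1, h2, h4, zero_add, add_zero] at h3
      linear_combination h3 / 2
    have hre : ∀ a ∈ U, (N ^ (k + 1)) a = 0 → ∃ b ∈ U, ∃ c ∈ U, star b = b ∧ star c = c ∧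
        (N ^ (k + 1)) b = 0 ∧ (N ^ (k + 1)) c = 0 ∧ a = b + Complex.I • c := by
      intro a ha ha0
      have hsa : (N ^ (k + 1)) (star a) = 0 := by rw [hNs, ha0, star_zero]
      refine ⟨(1 / 2 : ℂ) • (a + star a), U.smul_mem _ (U.add_mem ha (hUs a ha)),
        (-Complex.I / 2) • (a - star a), U.smul_mem _ (U.sub_mem ha (hUs a ha)), ?_, ?_, ?_, ?_, ?_⟩
      · simp [star_smul, add_comm]
      · rw [star_smul, star_sub, star_star, ← neg_sub a (star a), smul_neg, ← neg_smul]
        congr 1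
        simp [neg_div]
      · rw [map_smul, map_add, ha0, hsa]; simp
      · rw [map_smul, map_sub, ha0, hsa]; simp
      · rw [smul_smul, show Complex.I * (-Complex.I / 2) = 1 / 2 by
          rw [← mul_div_assoc, mul_neg, Complex.I_mul_I, neg_neg], ← smul_add,
          add_add_sub_cancel, ← two_smul ℂ a, smul_smul]
        norm_num
    obtain ⟨b, hb, c, hc, hbs, hcs, hb0, hc0, rfl⟩ := hre x hx hx0
    obtain ⟨b', hb', c', hc', hbs', hcs', hb0', hc0', rfl⟩ := hre y hy hy0
    apply hxy
    simp only [map_add, map_smul, LinearMap.add_apply, LinearMap.smul_apply]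
    rw [hpol b hb b' hb' hbs hbs' hb0 hb0', hpol b hb c' hc' hbs hcs' hb0 hc0',
      hpol c hc b' hb' hcs hbs' hc0 hb0', hpol c hc c' hc' hcs hcs' hc0 hc0']
    simp
  have hreal : star (B u ((N ^ k) u)) = B u ((N ^ k) u) := by
    rw [← hB.map_star, ← hNs, hus]
  obtain ⟨r, hr⟩ : ∃ r : ℝ, B u ((N ^ k) u) = r := by
    obtain ⟨r, hr⟩ := Complex.conj_eq_iff_real.1 hreal
    exact ⟨r, hr⟩
  have hr0 : r ≠ 0 := by
    rintro rfl
    exact hu (by simp [hr])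
  obtain ⟨e, he⟩ : ∃ e : ℤˣ, r = ((e : ℤ) : ℝ) * |r| := by
    rcases lt_or_gt_of_ne hr0 with h | h
    · exact ⟨-1, by simp [abs_of_neg h]⟩
    · exact ⟨1, by simp [abs_of_pos h]⟩
  -- Chosen so that `c * c * |r| = 1`; scaling by `c` turns the top pairing `r` into its sign `e`.
  set c : ℝ := (√|r|)⁻¹ with hc
  have hcc : c * c * |r| = 1 := by
    have h1 : √|r| * √|r| = |r| := Real.mul_self_sqrt (abs_nonneg r)
    have h2 : √|r| ≠ 0 := Real.sqrt_ne_zero'.2 (abs_pos.2 hr0)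
    rw [hc, ← mul_inv, h1, inv_mul_cancel₀ (abs_ne_zero.2 hr0)]
  obtain ⟨w, hw, hws, hch⟩ := hB.exists_isJordanChain hU (z := t) (k := k) (ε := ((e : ℤ) : ℂ))
    (units_coe_mul_self e) (units_coe_star e)
    (U.smul_mem (c : ℂ) huU) (by change (N ^ (k + 1)) _ = 0; rw [map_smul, hu0, smul_zero]) (by
      change B _ ((N ^ k) _) = _
      simp only [map_smul, LinearMap.smul_apply, smul_eq_mul]
      have he' : (r : ℂ) = ((e : ℤ) : ℂ) * ((|r| : ℝ) : ℂ) := by exact_mod_cast congrArg Complex.ofReal he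
      have hcc' : (c : ℂ) * c * ((|r| : ℝ) : ℂ) = 1 := by exact_mod_cast congrArg Complex.ofReal hcc
      rw [hr, he']
      linear_combination ((e : ℤ) : ℂ) * hcc')
  exact ⟨_, e, w, hw, hws (by rw [star_smul, hus]; simp) ht, hch⟩

/-- Strong induction on the dimension: a real chain, or a complex chain with its conjugate, splits
off, and the complement of its cyclic span inherits stability under `J` and `star` as well as
non-degeneracy. -/
theorem exists_hasLabels [FiniteDimensional ℂ E] (hB : RealSelfAdjoint B J) (n : ℕ) :
    ∀ U : Submodule ℂ E, finrank ℂ U = n → (∀ x ∈ U, J x ∈ U) → (∀ x ∈ U, star x ∈ U) →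
      (∀ x ∈ U, (∀ y ∈ U, B x y = 0) → x = 0) →
      ∃ LP LR, HasLabels B J U LP LR ∧
        2 * (LP.map Prod.snd).sum + (LR.map fun r => r.2.1).sum = n := by
  induction n using Nat.strong_induction_on with
  | _ n ih =>
  intro U hn hU hUs hnd
  rcases Nat.eq_zero_or_pos n with rfl | hpos
  · exact ⟨[], [], HasLabels.nil U, by simp⟩
  have : Nontrivial U := Module.nontrivial_of_finrank_pos (R := ℂ) (by omega)
  obtain ⟨z, hz⟩ := Module.End.exists_eigenvalue (J.restrict hU)
  obtain ⟨v, hv⟩ := hz.exists_hasEigenvector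
  have hvz : J v = z • (v : E) := congrArg Subtype.val hv.apply_eq_smul
  have hv0 : (v : E) ≠ 0 := fun h => hv.2 (Subtype.ext h)
  -- Conjugating the eigenvector if necessary, the eigenvalue may be taken in the closed upper half
  -- plane.
  obtain ⟨z, v, hvU, hv0, hvz, hz⟩ : ∃ (z : ℂ) (v : E), v ∈ U ∧ v ≠ 0 ∧ J v = z • v ∧ 0 ≤ z.im := by
    by_cases h : 0 ≤ z.im
    · exact ⟨z, v, v.2, hv0, hvz, h⟩
    · refine ⟨star z, star (v : E), hUs _ v.2, star_ne_zero.2 hv0, ?_, ?_⟩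
      · rw [hB.star_apply, hvz, star_smul]
      · change 0 ≤ ((starRingEnd ℂ) z).im
        rw [Complex.conj_im]; linarith
  rcases hz.eq_or_lt with hz | hz
  · obtain ⟨t, rfl⟩ : ∃ t : ℝ, z = t := ⟨z.re, Complex.ext rfl (by simp [← hz])⟩
    obtain ⟨k, e, w, hw, hws, hch⟩ := exists_real_chain hB hU hUs hnd hvU hv0 hvz
    set V := cyclicCompl B J U (fun _ : Unit => w) with hV
    have hε : ∀ _ : Unit, ((e : ℤ) : ℂ) * ((e : ℤ) : ℂ) = 1 := fun _ => units_coe_mul_self e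
    have horth : ∀ b b' : Unit, b ≠ b' → IsOrth B J w w := fun b b' h => (h rfl).elim
    have hfin := finrank_cyclicCompl (g := fun _ : Unit => w) hB hU hε (fun _ => hch) horth
      (fun _ => hw)
    rw [Fintype.card_unit, one_mul, hn, ← hV] at hfin
    have hVs : ∀ x ∈ V, star x ∈ V := fun x hx => ⟨hUs x hx.1, fun b => by
      have := hB.isOrth_star (hx.2 b)
      rwa [hws] at this⟩
    have hkpos := hch.pos
    obtain ⟨LP, LR, ⟨P, R, hPR, rfl, rfl⟩, hsum⟩ := ih (finrank ℂ V) (by omega) V rfl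
      (fun x hx => apply_mem_cyclicCompl hU hx) hVs
      (nondegenerate_cyclicCompl (g := fun _ : Unit => w) hB hU hε (fun _ => hch) horth
        (fun _ => hw) hnd)
    refine ⟨_, _, ⟨P, ((t, k, e), w) :: R, ⟨fun p hp => ⟨(hPR.pair p hp).1.1, (hPR.pair p hp).2⟩, ?_,
      hPR.pair_pair, ?_, ?_⟩, rfl, rfl⟩, ?_⟩
    · intro r hr
      rcases List.mem_cons.1 hr with rfl | hr
      · exact ⟨hw, hws, hch⟩
      · exact ⟨(hPR.real r hr).1.1, (hPR.real r hr).2⟩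
    · exact List.pairwise_cons.2 ⟨fun r hr => (hPR.real r hr).1.2 (), hPR.real_real⟩
    · intro p hp r hr
      rcases List.mem_cons.1 hr with rfl | hr
      · exact hB.isOrth_symm ((hPR.pair p hp).1.2 ())
      · exact hPR.pair_real p hp r hr
    · simp only [List.map_cons, List.sum_cons]
      simp only [List.map_map] at hsum ⊢
      omega
  · obtain ⟨k, w, hw, hch⟩ := exists_complex_chain hB hU hnd hvU hv0 hvz
    have hne : z ≠ star z := fun h => by
      have := congrArg Complex.im h
      change z.im = ((starRingEnd ℂ) z).im at this
      rw [Complex.conj_im] at this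
      linarith
    have hch' := hB.chain_star (by simp) hch
    have ho := hB.isOrth_of_ne hne hch.pow_eq_zero hch'.pow_eq_zero
    -- A non-real chain is split off together with its conjugate, so that the complement is stable
    -- under `star`. The two are orthogonal because their eigenvalues differ.
    let g : Bool → E := fun b => if b then w else star w
    let zz : Bool → ℂ := fun b => if b then z else star z
    set V := cyclicCompl B J U g with hV
    have hε : ∀ _ : Bool, (1 : ℂ) * 1 = 1 := fun _ => by simp
    have hg : ∀ b, g b ∈ U := by
      rintro (_ | _)
      · exact hUs w hw
      · exact hw
    have hchb : ∀ b, IsJordanChain B J (zz b) k 1 (g b) := by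
      rintro (_ | _)
      · exact hch'
      · exact hch
    have horth : ∀ b b' : Bool, b ≠ b' → IsOrth B J (g b) (g b') := by
      rintro (_ | _) (_ | _) h
      · exact (h rfl).elim
      · exact hB.isOrth_symm ho
      · exact ho
      · exact (h rfl).elim
    have hfin := finrank_cyclicCompl hB hU hε hchb horth hg
    rw [Fintype.card_bool, hn, ← hV] at hfin
    have hVs : ∀ x ∈ V, star x ∈ V := fun x hx => ⟨hUs x hx.1, by
      rintro (_ | _)
      · exact hB.isOrth_star (hx.2 true)
      · have := hB.isOrth_star (hx.2 false)
        rwa [show star (g false) = g true from star_star w] at this⟩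
    have hkpos := hch.pos
    obtain ⟨LP, LR, ⟨P, R, hPR, rfl, rfl⟩, hsum⟩ := ih (finrank ℂ V) (by omega) V rfl
      (fun x hx => apply_mem_cyclicCompl hU hx) hVs
      (nondegenerate_cyclicCompl hB hU hε hchb horth hg hnd)
    refine ⟨_, _, ⟨((z, k), w) :: P, R, ⟨?_, fun p hp => ⟨(hPR.real p hp).1.1, (hPR.real p hp).2⟩,
      ?_, hPR.real_real, ?_⟩, rfl, rfl⟩, ?_⟩
    · intro p hp
      rcases List.mem_cons.1 hp with rfl | hp
      · exact ⟨hw, hz, hch⟩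
      · exact ⟨(hPR.pair p hp).1.1, (hPR.pair p hp).2⟩
    · refine List.pairwise_cons.2 ⟨fun p hp => ⟨(hPR.pair p hp).1.2 true, ?_⟩, hPR.pair_pair⟩
      exact (hVs _ (hPR.pair p hp).1).2 true
    · intro p hp r hr
      rcases List.mem_cons.1 hp with rfl | hp
      · exact (hPR.real r hr).1.2 true
      · exact hPR.pair_real p hp r hr
    · simp only [List.map_cons, List.sum_cons]
      simp only [List.map_map] at hsum ⊢
      omega

end Decomposition

/-! ### Indexed chain families, their bases and isometries between them -/

section ChainFamilies

set_option linter.unusedSectionVars false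

/-- The index set of all complex chains of a system with labels `LP` and `LR`: the chains with
eigenvalue in the upper half plane, their conjugates, and the real chains. -/
abbrev ChainIndex (LP : List (ℂ × ℕ)) (LR : List (ℝ × ℕ × ℤˣ)) : Type :=
  Fin LP.length ⊕ Fin LP.length ⊕ Fin LR.length

variable {LP : List (ℂ × ℕ)} {LR : List (ℝ × ℕ × ℤˣ)}

/-- The length of a chain. -/
def chainSize (LP : List (ℂ × ℕ)) (LR : List (ℝ × ℕ × ℤˣ)) : ChainIndex LP LR → ℕ :=
  Sum.elim (fun i => (LP.get i).2) (Sum.elim (fun i => (LP.get i).2) fun i => (LR.get i).2.1)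

/-- The eigenvalue of a chain. -/
def chainEigenvalue (LP : List (ℂ × ℕ)) (LR : List (ℝ × ℕ × ℤˣ)) : ChainIndex LP LR → ℂ :=
  Sum.elim (fun i => (LP.get i).1)
    (Sum.elim (fun i => (starRingEnd ℂ) (LP.get i).1) fun i => ((LR.get i).1 : ℂ))

/-- The sign of a chain. -/
def chainSign (LP : List (ℂ × ℕ)) (LR : List (ℝ × ℕ × ℤˣ)) : ChainIndex LP LR → ℂ :=
  Sum.elim (fun _ => 1) (Sum.elim (fun _ => 1) fun i => (((LR.get i).2.2 : ℤ) : ℂ))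

/-- The conjugate chain. -/
def chainBar : ChainIndex LP LR → ChainIndex LP LR :=
  Sum.elim (fun i => .inr (.inl i)) (Sum.elim (fun i => .inl i) fun i => .inr (.inr i))

lemma chainSize_chainBar (i : ChainIndex LP LR) :
    chainSize LP LR (chainBar i) = chainSize LP LR i := by
  rcases i with i | i | i <;> rfl

lemma chainEigenvalue_chainBar (i : ChainIndex LP LR) :
    chainEigenvalue LP LR (chainBar i) = star (chainEigenvalue LP LR i) := by
  rcases i with i | i | i
  · rfl
  · exact (star_star _).symm
  · exact (Complex.conj_ofReal _).symm

lemma chainSign_mul_self (i : ChainIndex LP LR) : chainSign LP LR i * chainSign LP LR i = 1 := by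
  rcases i with i | i | i
  · simp [chainSign]
  · simp [chainSign]
  · exact units_coe_mul_self _

lemma sum_chainSize : ∑ i : ChainIndex LP LR, chainSize LP LR i =
    2 * (LP.map Prod.snd).sum + (LR.map fun r => r.2.1).sum := by
  have h1 : ∑ i : Fin LP.length, (LP.get i).2 = (LP.map Prod.snd).sum := by
    rw [← List.sum_ofFn]
    congr 1
    conv_rhs => rw [← List.ofFn_get LP, List.map_ofFn]
    rfl
  have h2 : ∑ i : Fin LR.length, (LR.get i).2.1 = (LR.map fun r => r.2.1).sum := by
    rw [← List.sum_ofFn]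
    congr 1
    conv_rhs => rw [← List.ofFn_get LR, List.map_ofFn]
    rfl
  simp only [Fintype.sum_sum_type, chainSize, Sum.elim_inl, Sum.elim_inr, h1, h2]
  ring

variable {E : Type*} [AddCommGroup E] [Module ℂ E] [StarAddMonoid E] [StarModule ℂ E]
variable {B : LinearMap.BilinForm ℂ E} {J : Module.End ℂ E}

/-- A conjugation-stable family of mutually orthogonal chains with the labels `LP` and `LR`. -/
structure IsChainFamily (B : LinearMap.BilinForm ℂ E) (J : Module.End ℂ E)
    (W : ChainIndex LP LR → E) : Prop where
  chain : ∀ i, IsJordanChain B J (chainEigenvalue LP LR i) (chainSize LP LR i) (chainSign LP LR i)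
    (W i)
  orth : ∀ i j, i ≠ j → IsOrth B J (W i) (W j)
  star_eq : ∀ i, star (W i) = W (chainBar i)

lemma List.Pairwise.rel_get_ne {α : Type*} {r : α → α → Prop} (hr : ∀ a b, r a b → r b a)
    {l : List α} (h : l.Pairwise r) (i j : Fin l.length) (hij : i ≠ j) : r (l.get i) (l.get j) := by
  rcases lt_or_gt_of_ne hij with h1 | h1
  · exact List.pairwise_iff_get.1 h i j h1
  · exact hr _ _ (List.pairwise_iff_get.1 h j i h1)

/-- The conjugates of the listed complex chains are added. The one orthogonality that a system does
not record, between a chain and its own conjugate, holds because the eigenvalues lie in opposite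
half planes. -/
lemma HasLabels.exists_isChainFamily (hB : RealSelfAdjoint B J) {U : Submodule ℂ E}
    (h : HasLabels B J U LP LR) :
    (∀ p ∈ LP, 0 < p.1.im) ∧ ∃ W : ChainIndex LP LR → E, IsChainFamily B J W := by
  obtain ⟨P, R, h, rfl, rfl⟩ := h
  refine ⟨?_, ?_⟩
  · simp only [List.mem_map]
    rintro _ ⟨p, hp, rfl⟩
    exact (h.pair p hp).2.1
  let cP : Fin (P.map Prod.fst).length → Fin P.length := Fin.cast (by simp)
  let cR : Fin (R.map Prod.fst).length → Fin R.length := Fin.cast (by simp)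
  have hcP : ∀ i, (P.map Prod.fst).get i = (P.get (cP i)).1 := fun i => by simp [cP]
  have hcR : ∀ i, (R.map Prod.fst).get i = (R.get (cR i)).1 := fun i => by simp [cR]
  have hP : ∀ i, P.get (cP i) ∈ P := fun i => List.get_mem _ _
  have hR : ∀ i, R.get (cR i) ∈ R := fun i => List.get_mem _ _
  have hPne : ∀ i j, i ≠ j → cP i ≠ cP j := fun i j hij h => hij (Fin.cast_injective _ h)
  have hRne : ∀ i j, i ≠ j → cR i ≠ cR j := fun i j hij h => hij (Fin.cast_injective _ h)
  have hself : ∀ p ∈ P, IsOrth B J p.2 (star p.2) := fun p hp => by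
    refine hB.isOrth_of_ne ?_ (h.pair p hp).2.2.pow_eq_zero
      (hB.chain_star (by simp) (h.pair p hp).2.2).pow_eq_zero
    intro h1
    have := congrArg Complex.im h1
    change _ = ((starRingEnd ℂ) p.1.1).im at this
    rw [Complex.conj_im] at this
    linarith [(h.pair p hp).2.1]
  have hPP : ∀ i j, i ≠ j → IsOrth B J (P.get (cP i)).2 (P.get (cP j)).2 ∧
      IsOrth B J (P.get (cP i)).2 (star (P.get (cP j)).2) := fun i j hij =>
    h.pair_pair.rel_get_ne (fun x y hxy => ⟨hB.isOrth_symm hxy.1,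
      by simpa using hB.isOrth_star (hB.isOrth_symm hxy.2)⟩) _ _ (hPne i j hij)
  have hPP' : ∀ i j, IsOrth B J (P.get (cP i)).2 (star (P.get (cP j)).2) := fun i j => by
    by_cases hij : i = j
    · subst hij
      exact hself _ (hP _)
    · exact (hPP i j hij).2
  have hPR : ∀ i j, IsOrth B J (star (P.get (cP i)).2) (R.get (cR j)).2 := fun i j => by
    have := hB.isOrth_star (h.pair_real _ (hP i) _ (hR j))
    rwa [(h.real _ (hR j)).2.1] at this
  refine ⟨Sum.elim (fun i => (P.get (cP i)).2) (Sum.elim (fun i => star (P.get (cP i)).2)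
    fun i => (R.get (cR i)).2), ⟨?_, ?_, ?_⟩⟩
  · rintro (i | i | i)
    · have := (h.pair _ (hP i)).2.2
      simpa only [chainEigenvalue, chainSize, chainSign, Sum.elim_inl, Sum.elim_inr, hcP] using this
    · have := hB.chain_star (by simp) (h.pair _ (hP i)).2.2
      rw [← starRingEnd_apply] at this
      simpa only [chainEigenvalue, chainSize, chainSign, Sum.elim_inl, Sum.elim_inr, hcP] using this
    · have := (h.real _ (hR i)).2.2
      simpa only [chainEigenvalue, chainSize, chainSign, Sum.elim_inl, Sum.elim_inr, hcR] using this
  · rintro (i | i | i) (j | j | j) hij <;> simp only [Sum.elim_inl, Sum.elim_inr]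
    · exact (hPP i j fun h => hij (by rw [h])).1
    · exact hPP' i j
    · exact h.pair_real _ (hP i) _ (hR j)
    · exact hB.isOrth_symm (hPP' j i)
    · exact hB.isOrth_star (hPP i j fun h => hij (by rw [h])).1
    · exact hPR i j
    · exact hB.isOrth_symm (h.pair_real _ (hP j) _ (hR i))
    · exact hB.isOrth_symm (hPR j i)
    · exact h.real_real.rel_get_ne (fun x y hxy => hB.isOrth_symm hxy) _ _
        (hRne i j fun h => hij (by rw [h]))
  · rintro (i | i | i)
    · rfl
    · exact star_star _
    · exact (h.real _ (hR i)).2.1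

/-- The index set of the vectors of all chains. -/
abbrev ChainVecIndex (LP : List (ℂ × ℕ)) (LR : List (ℝ × ℕ × ℤˣ)) : Type :=
  Σ i : ChainIndex LP LR, Fin (chainSize LP LR i)

/-- The vectors of the chains generated by `W`, each chain listed from its eigenvector on. -/
def chainVec (J : Module.End ℂ E) (W : ChainIndex LP LR → E) (p : ChainVecIndex LP LR) : E :=
  ((J - chainEigenvalue LP LR p.1 • 1) ^ (chainSize LP LR p.1 - 1 - p.2 : ℕ)) (W p.1)

/-- The vectors dual to those of the chains. -/
def chainDual (J : Module.End ℂ E) (W : ChainIndex LP LR → E) (p : ChainVecIndex LP LR) : E :=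
  chainSign LP LR p.1 • ((J - chainEigenvalue LP LR p.1 • 1) ^ (p.2 : ℕ)) (W p.1)

variable {W : ChainIndex LP LR → E}

lemma IsChainFamily.pairing (hB : RealSelfAdjoint B J) (hW : IsChainFamily B J W)
    (i j : ChainIndex LP LR) (a b : ℕ) :
    B (((J - chainEigenvalue LP LR i • 1) ^ a) (W i)) (((J - chainEigenvalue LP LR j • 1) ^ b) (W j))
      = if i = j ∧ a + b + 1 = chainSize LP LR i then chainSign LP LR i else 0 := by
  by_cases hij : i = j
  · subst hij
    rw [hB.pairing_chain (hW.chain i)]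
    simp
  · rw [hB.pairing_orth (hW.orth i j hij), if_neg fun h => hij h.1]

lemma IsChainFamily.dual_pairing (hB : RealSelfAdjoint B J) (hW : IsChainFamily B J W)
    (p q : ChainVecIndex LP LR) :
    B (chainDual J W p) (chainVec J W q) = if p = q then 1 else 0 := by
  rw [chainDual, chainVec, map_smul, LinearMap.smul_apply, hW.pairing hB]
  obtain ⟨i, a⟩ := p
  obtain ⟨j, b⟩ := q
  by_cases hij : i = j
  · subst hij
    have := a.2
    have := b.2
    by_cases hab : a = b
    · subst hab
      rw [if_pos ⟨rfl, by dsimp only; omega⟩, if_pos rfl, smul_eq_mul, chainSign_mul_self]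
    · rw [if_neg, if_neg, smul_zero]
      · simpa using hab
      · rintro ⟨-, h⟩
        dsimp only at h
        exact hab (Fin.ext (by omega))
  · rw [if_neg fun h => hij h.1, if_neg fun h => hij (congrArg Sigma.fst h), smul_zero]

lemma IsChainFamily.linearIndependent (hB : RealSelfAdjoint B J) (hW : IsChainFamily B J W) :
    LinearIndependent ℂ (chainVec J W) := by
  rw [Fintype.linearIndependent_iff]
  intro c hc p
  have := congrArg (B (chainDual J W p)) hc
  rw [map_sum] at this
  simpa [hW.dual_pairing hB] using this

/-- The total length of the chains. -/
def totalSize (LP : List (ℂ × ℕ)) (LR : List (ℝ × ℕ × ℤˣ)) : ℕ :=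
  2 * (LP.map Prod.snd).sum + (LR.map fun r => r.2.1).sum

lemma card_chainVecIndex : Fintype.card (ChainVecIndex LP LR) = totalSize LP LR := by
  rw [Fintype.card_sigma, totalSize, ← sum_chainSize]
  simp

lemma IsChainFamily.span_eq_top [FiniteDimensional ℂ E] (hB : RealSelfAdjoint B J)
    (hW : IsChainFamily B J W) (hE : finrank ℂ E = totalSize LP LR) :
    Submodule.span ℂ (Set.range (chainVec J W)) = ⊤ :=
  (hW.linearIndependent hB).span_eq_top_of_card_eq_finrank' (by rw [card_chainVecIndex, hE])

/-- The basis of the vectors of the chains. -/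
noncomputable def IsChainFamily.basis [FiniteDimensional ℂ E] (hB : RealSelfAdjoint B J)
    (hW : IsChainFamily B J W) (hE : finrank ℂ E = totalSize LP LR) :
    Basis (ChainVecIndex LP LR) ℂ E :=
  Basis.mk (hW.linearIndependent hB) (hW.span_eq_top hB hE).ge

lemma IsChainFamily.basis_apply [FiniteDimensional ℂ E] (hB : RealSelfAdjoint B J)
    (hW : IsChainFamily B J W) (hE : finrank ℂ E = totalSize LP LR) (p : ChainVecIndex LP LR) :
    hW.basis hB hE p = chainVec J W p := Basis.mk_apply _ _ _

lemma IsChainFamily.mem_of_forall [FiniteDimensional ℂ E] (hB : RealSelfAdjoint B J)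
    (hW : IsChainFamily B J W) (hE : finrank ℂ E = totalSize LP LR) {V : Submodule ℂ E}
    (hV : ∀ p, chainVec J W p ∈ V) (x : E) : x ∈ V := by
  have h : Submodule.span ℂ (Set.range (chainVec J W)) ≤ V := by
    rw [Submodule.span_le]
    rintro _ ⟨p, rfl⟩
    exact hV p
  rw [hW.span_eq_top hB hE] at h
  exact h trivial

/-- Place 0 of a chain holds the eigenvector and the last place the generator, so that `J` has the
shape of a Jordan block with ones above the diagonal. -/
lemma IsChainFamily.apply_chainVec (hW : IsChainFamily B J W) (p : ChainVecIndex LP LR) :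
    J (chainVec J W p) = chainEigenvalue LP LR p.1 • chainVec J W p +
      if h : (p.2 : ℕ) = 0 then 0 else chainVec J W ⟨p.1, ⟨p.2 - 1, by omega⟩⟩ := by
  obtain ⟨i, a⟩ := p
  have h1 : ∀ x, J x = chainEigenvalue LP LR i • x + (J - chainEigenvalue LP LR i • 1) x := by
    intro x; simp
  rw [h1]
  congr 1
  rw [chainVec, ← Module.End.mul_apply, ← pow_succ']
  have := a.2
  split_ifs with h
  · rw [show chainSize LP LR i - 1 - (a : ℕ) + 1 = chainSize LP LR i by dsimp only at *; omega]
    exact (hW.chain i).pow_eq_zero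
  · rw [chainVec]
    congr 2
    dsimp only at *
    omega

lemma chainVec_last (h : IsChainFamily B J W) (i : ChainIndex LP LR) :
    chainVec J W ⟨i, ⟨chainSize LP LR i - 1, Nat.sub_lt (h.chain i).pos one_pos⟩⟩ = W i := by
  simp [chainVec]

section Congruence

variable {E' : Type*} [AddCommGroup E'] [Module ℂ E'] [StarAddMonoid E'] [StarModule ℂ E']
variable {B' : LinearMap.BilinForm ℂ E'} {J' : Module.End ℂ E'} {W' : ChainIndex LP LR → E'}

/-- Spaces with chain families with the same labels are isomorphic. -/
theorem IsChainFamily.exists_equiv [FiniteDimensional ℂ E] [FiniteDimensional ℂ E']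
    (hB : RealSelfAdjoint B J) (hB' : RealSelfAdjoint B' J')
    (hW : IsChainFamily B J W) (hE : finrank ℂ E = totalSize LP LR)
    (hW' : IsChainFamily B' J' W') (hE' : finrank ℂ E' = totalSize LP LR) :
    ∃ P : E ≃ₗ[ℂ] E', (∀ x y, B' (P x) (P y) = B x y) ∧ (∀ x, P (J x) = J' (P x)) ∧
      (∀ x, P (star x) = star (P x)) ∧ ∀ p, P (chainVec J W p) = chainVec J' W' p := by
  -- Corresponding chain vectors are matched. The action of `J`, the pairings and the conjugation on
  -- them depend on the labels only, so it remains to extend each compatibility by linearity.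
  let P : E ≃ₗ[ℂ] E' := (hW.basis hB hE).equiv (hW'.basis hB' hE') (Equiv.refl _)
  have hP : ∀ p, P (chainVec J W p) = chainVec J' W' p := fun p => by
    rw [← hW.basis_apply hB hE, Basis.equiv_apply, hW'.basis_apply]
    rfl
  have hPJ : ∀ x, P (J x) = J' (P x) := by
    intro x
    refine hW.mem_of_forall hB hE
      (V := LinearMap.eqLocus ((P : E →ₗ[ℂ] E').comp J) (J'.comp (P : E →ₗ[ℂ] E'))) (fun p => ?_) x
    change P (J _) = J' (P _)
    rw [hP, hW.apply_chainVec, hW'.apply_chainVec, map_add, map_smul, hP]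
    split_ifs
    · rw [map_zero]
    · rw [hP]
  have hPW : ∀ i, P (W i) = W' i := fun i => by
    rw [← chainVec_last hW, hP, chainVec_last hW']
  have hPN : ∀ (z : ℂ) (j : ℕ) (x : E), P (((J - z • (1 : Module.End ℂ E)) ^ j : Module.End ℂ E) x) =
      ((J' - z • (1 : Module.End ℂ E')) ^ j : Module.End ℂ E') (P x) := by
    intro z j
    induction j with
    | zero => simp
    | succ j ih =>
      intro x
      rw [pow_succ, pow_succ, Module.End.mul_apply, Module.End.mul_apply, ih]
      simp [hPJ]
  refine ⟨P, ?_, hPJ, ?_, hP⟩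
  · intro x y
    have h1 : ∀ p q, B' (P (chainVec J W p)) (P (chainVec J W q)) =
        B (chainVec J W p) (chainVec J W q) := fun p q => by
      rw [hP, hP, chainVec, chainVec, chainVec, chainVec, hW.pairing hB, hW'.pairing hB']
    have h2 : ∀ p y, B' (P (chainVec J W p)) (P y) = B (chainVec J W p) y := fun p y =>
      hW.mem_of_forall hB hE (V := LinearMap.eqLocus
        ((B' (P (chainVec J W p))).comp (P : E →ₗ[ℂ] E')) (B (chainVec J W p))) (h1 p) y
    have h3 := hW.mem_of_forall hB hE (V := LinearMap.eqLocus
        ((B'.flip (P y)).comp (P : E →ₗ[ℂ] E')) (B.flip y)) (fun p => h2 p y) x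
    exact h3
  · intro x
    let V : Submodule ℂ E :=
      { carrier := {x | P (star x) = star (P x)}
        add_mem' := fun {a b} ha hb => by
          simp only [Set.mem_ofPred_eq] at *
          rw [star_add, map_add, ha, hb, map_add, star_add]
        zero_mem' := by simp
        smul_mem' := fun c a ha => by
          simp only [Set.mem_ofPred_eq] at *
          rw [star_smul, map_smul, ha, map_smul, star_smul] }
    refine hW.mem_of_forall hB hE (V := V) (fun p => ?_) x
    change P (star _) = star (P _)
    rw [hP, chainVec, chainVec, ← hB.star_sub_pow, ← hB'.star_sub_pow, hPN, hW.star_eq, hW'.star_eq, hPW]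

end Congruence

/-- If a real chain has odd length, there is an isometry of determinant `-1` that commutes with
`J`. -/
theorem IsChainFamily.exists_det_neg_one [FiniteDimensional ℂ E]
    (hB : RealSelfAdjoint B J) (hW : IsChainFamily B J W) (hE : finrank ℂ E = totalSize LP LR)
    {r : ℝ × ℕ × ℤˣ} (hr : r ∈ LR) (hodd : Odd r.2.1) :
    ∃ P : E ≃ₗ[ℂ] E, (∀ x y, B (P x) (P y) = B x y) ∧ (∀ x, P (J x) = J (P x)) ∧
      (∀ x, P (star x) = star (P x)) ∧ LinearMap.det (P : E →ₗ[ℂ] E) = -1 := by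
  classical
  obtain ⟨n, rfl⟩ := List.mem_iff_get.1 hr
  -- The isometry is `-1` on the chosen real chain and the identity on the others. A real chain is
  -- its own conjugate, so the new family is still conjugation-stable, and the determinant is `-1`
  -- to the length of that chain.
  let s : ChainIndex LP LR → ℂ := fun i => if i = .inr (.inr n) then -1 else 1
  have hs : ∀ i, s i * s i = 1 := fun i => by simp only [s]; split_ifs <;> simp
  have hbar : ∀ i, s (chainBar i) = s i := by
    rintro (i | i | i) <;> simp [s, chainBar]
  have hW' : IsChainFamily B J fun i => s i • W i := by
    refine ⟨fun i => ⟨(hW.chain i).pos, ?_, fun j hj => ?_⟩, fun i j hij p => ?_, fun i => ?_⟩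
    · rw [map_smul, (hW.chain i).pow_eq_zero, smul_zero]
    · simp only [map_smul, LinearMap.smul_apply, (hW.chain i).pairing j hj, smul_smul, hs,
        one_smul]
    · simp [hW.orth i j hij p]
    · rw [star_smul, hW.star_eq, hbar]
      congr 1
      simp only [s]; split_ifs <;> simp
  obtain ⟨P, h1, h2, h3, h4⟩ := hW.exists_equiv hB hB hE hW' hE
  refine ⟨P, h1, h2, h3, ?_⟩
  have h5 : LinearMap.toMatrix (hW.basis hB hE) (hW.basis hB hE) (P : E →ₗ[ℂ] E) =
      Matrix.diagonal fun p : ChainVecIndex LP LR => s p.1 := by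
    ext p q
    rw [LinearMap.toMatrix_apply, hW.basis_apply, LinearEquiv.coe_coe, h4, chainVec, map_smul,
      ← chainVec, ← hW.basis_apply hB hE, map_smul, Basis.repr_self]
    by_cases h : p = q
    · subst h; simp
    · simp [h]
  rw [← LinearMap.det_toMatrix (hW.basis hB hE), h5, Matrix.det_diagonal, Fintype.prod_sigma]
  simp only [Finset.prod_const, Finset.card_univ, Fintype.card_fin, s, ite_pow, one_pow]
  rw [Finset.prod_ite_eq' Finset.univ]
  simpa [chainSize] using hodd.neg_one_pow

end ChainFamilies

/-! ### The form `Σ` on `ℂ⁶` and the balance of signs -/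

section Standard

/-- The symmetric bilinear form on `ℂ⁶` with matrix `Σ`. -/
noncomputable def sigmaForm : LinearMap.BilinForm ℂ (Fin 6 → ℂ) :=
  LinearMap.mk₂ ℂ (fun x y => ∑ i, x i * y i.rev)
    (fun x y z => by simp [add_mul, Finset.sum_add_distrib])
    (fun c x y => by simp [Finset.mul_sum, mul_assoc])
    (fun x y z => by simp [mul_add, Finset.sum_add_distrib])
    (fun c x y => by simp [Finset.mul_sum, mul_left_comm])

lemma sigmaForm_apply (x y : Fin 6 → ℂ) : sigmaForm x y = ∑ i, x i * y i.rev := rfl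

lemma sigmaMatrix_apply (i j : Fin 6) : sigmaMatrix i j = if j = i.rev then 1 else 0 := by
  fin_cases i <;> fin_cases j <;> rfl

lemma sigmaMatrix_transpose : sigmaMatrix.transpose = sigmaMatrix := by
  ext i j
  fin_cases i <;> fin_cases j <;> rfl

lemma sigmaMatrix_mul_apply (A : Matrix (Fin 6) (Fin 6) ℝ) (i j : Fin 6) :
    (sigmaMatrix * A) i j = A i.rev j := by
  simp [Matrix.mul_apply, sigmaMatrix_apply]

lemma sigmaMatrix_mul_self : sigmaMatrix * sigmaMatrix = 1 := by
  ext i j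
  rw [sigmaMatrix_mul_apply, sigmaMatrix_apply, Fin.rev_rev, Matrix.one_apply]
  simp [eq_comm]

/-- The endomorphism of `ℂ⁶` with the real matrix `A`. -/
noncomputable def complexEnd (A : Matrix (Fin 6) (Fin 6) ℝ) : Module.End ℂ (Fin 6 → ℂ) :=
  Matrix.toLin' (A.map fun a => (a : ℂ))

lemma complexEnd_apply (A : Matrix (Fin 6) (Fin 6) ℝ) (x : Fin 6 → ℂ) (i : Fin 6) :
    complexEnd A x i = ∑ j, (A i j : ℂ) * x j := by
  simp [complexEnd, Matrix.toLin'_apply, Matrix.mulVec, dotProduct]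

/-- Since `Σ` is its own inverse, the form of `ΣAx` and `y` is the bilinear form of `A`;
self-adjointness is the symmetry of `A`. -/
lemma realSelfAdjoint_sigma {A : Matrix (Fin 6) (Fin 6) ℝ} (hA : A.transpose = A) :
    RealSelfAdjoint sigmaForm (complexEnd (sigmaMatrix * A)) where
  symm := fun x y => by
    rw [sigmaForm_apply, sigmaForm_apply, ← Equiv.sum_comp Fin.revPerm]
    simp [mul_comm]
  map_star := fun x y => by simp [sigmaForm_apply]
  selfAdj := fun x y => by
    simp only [sigmaForm_apply, complexEnd_apply, sigmaMatrix_mul_apply, Fin.rev_rev,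
      Finset.sum_mul, Finset.mul_sum]
    rw [Finset.sum_comm]
    refine Finset.sum_congr rfl fun i _ => ?_
    rw [← Equiv.sum_comp Fin.revPerm]
    refine Finset.sum_congr rfl fun j _ => ?_
    simp only [Fin.revPerm_apply, Fin.rev_rev]
    rw [show A j i = A i j from congrFun (congrFun hA i) j]
    ring
  star_apply := fun x => by
    ext i
    simp [complexEnd_apply, mul_comm]

lemma sigmaForm_nondegenerate (x : Fin 6 → ℂ) (h : ∀ y, sigmaForm x y = 0) : x = 0 := by
  ext i
  have := h (Pi.single i.rev 1)
  simpa [sigmaForm_apply, Pi.single_apply] using this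

variable {LP : List (ℂ × ℕ)} {LR : List (ℝ × ℕ × ℤˣ)} {W : ChainIndex LP LR → Fin 6 → ℂ}

/-- The first halves of the chains, with the middle vectors of the odd real chains of sign `s`. -/
def halfIndex (LP : List (ℂ × ℕ)) (LR : List (ℝ × ℕ × ℤˣ)) (s : ℤˣ) :
    (i : ChainIndex LP LR) → Finset (Fin (chainSize LP LR i))
  | .inl _ => Finset.univ
  | .inr (.inl _) => ∅
  | .inr (.inr n) => Finset.univ.filter fun a =>
      (a : ℕ) < (LR.get n).2.1 / 2 + if Odd (LR.get n).2.1 ∧ (LR.get n).2.2 = s then 1 else 0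

lemma card_halfIndex (s : ℤˣ) : ∑ i, (halfIndex LP LR s i).card = (LP.map Prod.snd).sum +
    (LR.map fun r => r.2.1 / 2 + if Odd r.2.1 ∧ r.2.2 = s then 1 else 0).sum := by
  rw [Fintype.sum_sum_type, Fintype.sum_sum_type]
  have h1 : ∑ i : Fin LP.length, (LP.get i).2 = (LP.map Prod.snd).sum := by
    rw [← List.sum_ofFn]
    congr 1
    conv_rhs => rw [← List.ofFn_get LP, List.map_ofFn]
    rfl
  have h2 : ∑ n : Fin LR.length,
      ((LR.get n).2.1 / 2 + if Odd (LR.get n).2.1 ∧ (LR.get n).2.2 = s then 1 else 0) =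
      (LR.map fun r => r.2.1 / 2 + if Odd r.2.1 ∧ r.2.2 = s then 1 else 0).sum := by
    rw [← List.sum_ofFn]
    congr 1
    conv_rhs => rw [← List.ofFn_get LR, List.map_ofFn]
    rfl
  rw [← h1, ← h2]
  congr 1
  · refine Finset.sum_congr rfl fun i _ => ?_
    exact Finset.card_fin _
  · rw [show ∑ i : Fin LP.length, (halfIndex LP LR s (.inr (.inl i))).card = 0 from
      Finset.sum_eq_zero fun i _ => rfl, zero_add]
    refine Finset.sum_congr rfl fun n _ => ?_
    change (Finset.univ.filter fun a : Fin (LR.get n).2.1 => (a : ℕ) < _).card = _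
    rw [Fin.card_filter_val_lt]
    refine min_eq_right ?_
    split_ifs with h
    · obtain ⟨m, hm⟩ := h.1
      omega
    · omega

/-- The hermitian form `H(x) = sigmaForm (star x) x` has signature (3,3). On the span of the
selected chain vectors `s * H` is non-negative, on the three-dimensional space `x = -s Σx` it is
negative definite, so the two meet only in 0. -/
lemma IsChainFamily.card_halfIndex_le {J : Module.End ℂ (Fin 6 → ℂ)}
    (hB : RealSelfAdjoint sigmaForm J) (hW : IsChainFamily sigmaForm J W) (s : ℤˣ) :
    ∑ i, (halfIndex LP LR s i).card ≤ 3 := by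
  classical
  set T : Finset (ChainVecIndex LP LR) := Finset.univ.sigma (halfIndex LP LR s) with hT
  rw [← Finset.card_sigma, ← hT]
  have hstar : ∀ p, star (chainVec J W p) =
      ((J - chainEigenvalue LP LR (chainBar p.1) • 1) ^ (chainSize LP LR p.1 - 1 - p.2 : ℕ))
        (W (chainBar p.1)) := fun p => by
    rw [chainVec, ← hB.star_sub_pow, hW.star_eq, ← chainEigenvalue_chainBar]
  -- A non-real chain pairs hermitially only with its conjugate, which is not selected. In a real
  -- chain the places `a` and `b` pair only if `a + b` is the length minus one, which within the
  -- selected half forces both to be the middle place.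
  have hgram : ∀ p ∈ T, ∀ q ∈ T, p ≠ q → sigmaForm (star (chainVec J W p)) (chainVec J W q) = 0 := by
    rintro ⟨i, a⟩ hp ⟨j, b⟩ hq hpq
    rw [hstar, chainVec, hW.pairing hB, if_neg]
    rintro ⟨hij, hab⟩
    simp only [hT, Finset.mem_sigma, Finset.mem_univ, true_and] at hp hq
    dsimp only at hij hab
    rw [chainSize_chainBar] at hab
    have ha := a.2
    have hb := b.2
    rcases i with i | i | i
    · obtain rfl : j = .inr (.inl i) := hij.symm
      simp [halfIndex] at hq
    · simp [halfIndex] at hp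
    · obtain rfl : j = .inr (.inr i) := hij.symm
      simp only [halfIndex, Finset.mem_filter, Finset.mem_univ, true_and] at hp hq
      refine hpq (Sigma.ext rfl (heq_of_eq (Fin.ext ?_)))
      replace ha : (a : ℕ) < (LR.get i).2.1 := ha
      replace hb : (b : ℕ) < (LR.get i).2.1 := hb
      replace hab : (LR.get i).2.1 - 1 - (a : ℕ) + ((LR.get i).2.1 - 1 - (b : ℕ)) + 1 =
        (LR.get i).2.1 := hab
      change (a : ℕ) = (b : ℕ)
      split_ifs at hp hq with hodd
      · obtain ⟨m, hm⟩ := hodd.1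
        change (a : ℕ) < _ at hp
        change (b : ℕ) < _ at hq
        omega
      · change (a : ℕ) < _ at hp
        omega
  have hdiag : ∀ p ∈ T, ∃ r : ℝ, 0 ≤ r ∧
      sigmaForm (star (chainVec J W p)) (chainVec J W p) = ((s : ℤ) : ℂ) * r := by
    rintro ⟨i, a⟩ hp
    simp only [hT, Finset.mem_sigma, Finset.mem_univ, true_and] at hp
    rw [hstar, chainVec, hW.pairing hB]
    split_ifs with h
    · obtain ⟨hij, hab⟩ := h
      dsimp only at hij hab
      have ha := a.2
      rcases i with i | i | i
      · cases hij
      · cases hij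
      · simp only [halfIndex, Finset.mem_filter, Finset.mem_univ, true_and] at hp
        replace ha : (a : ℕ) < (LR.get i).2.1 := ha
        replace hab : (LR.get i).2.1 - 1 - (a : ℕ) + ((LR.get i).2.1 - 1 - (a : ℕ)) + 1 =
          (LR.get i).2.1 := hab
        split_ifs at hp with hodd
        · refine ⟨1, zero_le_one, ?_⟩
          simp [chainSign, chainBar, ← hodd.2]
        · omega
    · exact ⟨0, le_rfl, by simp⟩
  choose! r hr0 hr using hdiag
  have hss : ((s : ℤ) : ℂ) * ((s : ℤ) : ℂ) = 1 := units_coe_mul_self s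
  -- The first three coordinates of `x + s Σx`. As `s * s = 1`, their vanishing means `x = -s Σx`,
  -- where `H(x)` is `-s` times the squared length of `x`.
  let φ : (T → ℂ) →ₗ[ℂ] (Fin 3 → ℂ) :=
    { toFun := fun c b => (∑ p, c p • chainVec J W p) (Fin.castLE (by omega) b) +
        ((s : ℤ) : ℂ) * (∑ p, c p • chainVec J W p) (Fin.castLE (by omega) b : Fin 6).rev
      map_add' := fun c d => by
        ext b
        simp only [Pi.add_apply, add_smul, Finset.sum_add_distrib]
        ring
      map_smul' := fun c d => by
        ext b
        simp only [Pi.smul_apply, smul_eq_mul, mul_smul, ← Finset.smul_sum, RingHom.id_apply]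
        ring }
  have hφ : Function.Injective φ := by
    rw [← LinearMap.ker_eq_bot, LinearMap.ker_eq_bot']
    intro c hc
    set x := ∑ p, c p • chainVec J W p with hx
    have hxb : ∀ b : Fin 6, x b = -(((s : ℤ) : ℂ) * x b.rev) := by
      have h0 := congrFun hc 0
      have h1 := congrFun hc 1
      have h2 := congrFun hc 2
      change x 0 + ((s : ℤ) : ℂ) * x 5 = 0 at h0
      change x 1 + ((s : ℤ) : ℂ) * x 4 = 0 at h1
      change x 2 + ((s : ℤ) : ℂ) * x 3 = 0 at h2
      intro b
      fin_cases b
      · change x 0 = -(((s : ℤ) : ℂ) * x 5); linear_combination h0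
      · change x 1 = -(((s : ℤ) : ℂ) * x 4); linear_combination h1
      · change x 2 = -(((s : ℤ) : ℂ) * x 3); linear_combination h2
      · change x 3 = -(((s : ℤ) : ℂ) * x 2)
        linear_combination ((s : ℤ) : ℂ) * h2 - x 3 * hss
      · change x 4 = -(((s : ℤ) : ℂ) * x 1)
        linear_combination ((s : ℤ) : ℂ) * h1 - x 4 * hss
      · change x 5 = -(((s : ℤ) : ℂ) * x 0)
        linear_combination ((s : ℤ) : ℂ) * h0 - x 5 * hss
    have hH1 : sigmaForm (star x) x = -(((s : ℤ) : ℂ) * ∑ i, (Complex.normSq (x i) : ℂ)) := by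
      rw [sigmaForm_apply, Finset.mul_sum, ← Finset.sum_neg_distrib]
      refine Finset.sum_congr rfl fun i _ => ?_
      rw [hxb i.rev, Fin.rev_rev, Complex.normSq_eq_conj_mul_self]
      simp only [Pi.star_apply, RCLike.star_def]
      ring
    have hH2 : sigmaForm (star x) x =
        ((s : ℤ) : ℂ) * ∑ p : T, ((Complex.normSq (c p) * r p : ℝ) : ℂ) := by
      rw [hx, star_sum, LinearMap.map_sum₂, Finset.mul_sum]
      refine Finset.sum_congr rfl fun p _ => ?_
      rw [map_sum, Finset.sum_eq_single p]
      · simp only [star_smul, map_smul, LinearMap.smul_apply, smul_eq_mul]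
        rw [hr p p.2]
        push_cast
        rw [Complex.normSq_eq_conj_mul_self]
        simp only [RCLike.star_def]
        ring
      · intro q _ hqp
        simp only [star_smul, map_smul, LinearMap.smul_apply]
        rw [hgram p p.2 q q.2 fun h => hqp (Subtype.ext h.symm)]
        simp
      · simp
    have hsum : ∑ i, Complex.normSq (x i) + ∑ p : T, Complex.normSq (c p) * r p = 0 := by
      have : ((∑ i, Complex.normSq (x i) + ∑ p : T, Complex.normSq (c p) * r p : ℝ) : ℂ) = 0 := by
        push_cast
        rw [hH1] at hH2
        push_cast at hH2
        linear_combination (-(s : ℤ) : ℂ) * hH2 - (∑ i, (Complex.normSq (x i) : ℂ) +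
          ∑ p : T, (Complex.normSq (c p) : ℂ) * r p) * hss
      exact_mod_cast this
    have h1 : 0 ≤ ∑ i, Complex.normSq (x i) := Finset.sum_nonneg fun i _ => Complex.normSq_nonneg _
    have h2 : 0 ≤ ∑ p : T, Complex.normSq (c p) * r p :=
      Finset.sum_nonneg fun p _ => mul_nonneg (Complex.normSq_nonneg _) (hr0 p p.2)
    have h3 : ∑ i, Complex.normSq (x i) = 0 := by linarith
    have hx0 : x = 0 := by
      ext i
      exact Complex.normSq_eq_zero.1
        ((Finset.sum_eq_zero_iff_of_nonneg fun i _ => Complex.normSq_nonneg _).1 h3 i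
          (Finset.mem_univ i))
    have hli : LinearIndependent ℂ fun p : T => chainVec J W p :=
      (hW.linearIndependent hB).comp _ Subtype.val_injective
    ext p
    exact Fintype.linearIndependent_iff.1 hli c hx0 p
  have := LinearMap.finrank_le_finrank_of_injective hφ
  simpa using this

/-- The selections for the two signs have together as many elements as the space has dimensions,
six, and each has at most three. Hence both have three, and their difference is the sum of the signs
of the odd real chains. -/
lemma IsChainFamily.balanced {J : Module.End ℂ (Fin 6 → ℂ)}
    (hB : RealSelfAdjoint sigmaForm J) (hW : IsChainFamily sigmaForm J W)
    (h6 : totalSize LP LR = 6) :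
    (LR.map fun r => if Odd r.2.1 then (r.2.2 : ℤ) else 0).sum = 0 := by
  have h1 := hW.card_halfIndex_le hB 1
  have h2 := hW.card_halfIndex_le hB (-1)
  rw [card_halfIndex] at h1 h2
  rw [totalSize] at h6
  have h3 : ∀ L : List (ℝ × ℕ × ℤˣ),
      (L.map fun r => r.2.1 / 2 + if Odd r.2.1 ∧ r.2.2 = 1 then 1 else 0).sum +
      (L.map fun r => r.2.1 / 2 + if Odd r.2.1 ∧ r.2.2 = -1 then 1 else 0).sum =
      (L.map fun r => r.2.1).sum ∧
      (((L.map fun r => r.2.1 / 2 + if Odd r.2.1 ∧ r.2.2 = 1 then 1 else 0).sum : ℕ) : ℤ) -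
      ((L.map fun r => r.2.1 / 2 + if Odd r.2.1 ∧ r.2.2 = -1 then 1 else 0).sum : ℕ) =
      (L.map fun r => if Odd r.2.1 then (r.2.2 : ℤ) else 0).sum := by
    intro L
    induction L with
    | nil => exact ⟨rfl, rfl⟩
    | cons r L ih =>
      simp only [List.map_cons, List.sum_cons]
      have hne : (-1 : ℤˣ) ≠ 1 := by decide
      have hodd : Odd r.2.1 ↔ r.2.1 % 2 = 1 := Nat.odd_iff
      rcases Int.units_eq_one_or r.2.2 with he | he <;> by_cases ho : Odd r.2.1 <;>
        simp only [he, ho, hne, hne.symm, and_true, and_false, if_true, if_false, Units.val_one,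
          Units.val_neg] <;> rw [hodd] at ho <;> omega
  obtain ⟨h3, h4⟩ := h3 LR
  rw [← h4]
  omega

end Standard

/-! ### Invariance of the real labels, by the law of inertia -/

section SignUniqueness

set_option linter.unusedSectionVars false

variable {E : Type*} [AddCommGroup E] [Module ℂ E] [StarAddMonoid E] [StarModule ℂ E]
variable {B : LinearMap.BilinForm ℂ E} {J : Module.End ℂ E}
variable {LP : List (ℂ × ℕ)} {LR : List (ℝ × ℕ × ℤˣ)} {W : ChainIndex LP LR → E}

lemma IsChainFamily.sum_dual_smul [FiniteDimensional ℂ E] (hB : RealSelfAdjoint B J)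
    (hW : IsChainFamily B J W) (hE : finrank ℂ E = totalSize LP LR) (x : E) :
    ∑ p, B (chainDual J W p) x • chainVec J W p = x := by
  let V : Submodule ℂ E := LinearMap.eqLocus
    (∑ p, (LinearMap.toSpanSingleton ℂ E (chainVec J W p)).comp (B (chainDual J W p))) LinearMap.id
  have : x ∈ V := hW.mem_of_forall hB hE (fun q => by
    simp [V, hW.dual_pairing hB]) x
  simpa [V] using this

lemma eigen_sub_pow {z l : ℂ} {u : E} (hu : J u = l • u) (j : ℕ) :
    ((J - z • 1) ^ j) u = (l - z) ^ j • u := by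
  induction j with
  | zero => simp
  | succ j ih =>
    rw [pow_succ', Module.End.mul_apply, ih, map_smul]
    simp [hu, ← sub_smul, smul_smul, pow_succ]

/-- The hermitian form `B (star x) (N ^ (k - 1) x)`, `N = J - t`, on the kernel of `N ^ k`, in terms
of the real chains of length `k` and eigenvalue `t`. -/
lemma IsChainFamily.hermitian_formula [FiniteDimensional ℂ E] (hB : RealSelfAdjoint B J)
    (hW : IsChainFamily B J W) (hE : finrank ℂ E = totalSize LP LR)
    (him : ∀ p ∈ LP, 0 < p.1.im) {t : ℝ} {k : ℕ} {x : E}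
    (hx : ((J - (t : ℂ) • 1) ^ (k + 1)) x = 0) :
    B (star x) (((J - (t : ℂ) • 1) ^ k) x) = ∑ n : Fin LR.length,
      if (LR.get n).1 = t ∧ (LR.get n).2.1 = k + 1 then (((LR.get n).2.2 : ℤ) : ℂ) *
        Complex.normSq (B x (((J - (t : ℂ) • 1) ^ k) (W (.inr (.inr n))))) else 0 := by
  classical
  set N : Module.End ℂ E := J - (t : ℂ) • 1 with hN
  -- `u` is zero or an eigenvector for `t`, so its coordinates vanish except at place 0 of the
  -- chains with eigenvalue `t`.
  set u := (N ^ k) x with hu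
  have hJu : J u = (t : ℂ) • u := by
    have : N u = 0 := by rw [hu, ← Module.End.mul_apply, ← pow_succ', hx]
    rw [hN] at this
    simpa [sub_eq_zero] using this
  have hxs : ∀ m, k < m → (N ^ m) (star x) = 0 := fun m hm => by
    have h1 := hB.star_sub_pow (t : ℂ) m x
    rw [show star (t : ℂ) = t from Complex.conj_ofReal t] at h1
    rw [h1, show m = (m - (k + 1)) + (k + 1) by omega, pow_add, Module.End.mul_apply, hx]
    simp
  have hdual : ∀ i (a : ℕ), B (((J - chainEigenvalue LP LR i • 1) ^ a) (W i)) u =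
      ((t : ℂ) - chainEigenvalue LP LR i) ^ a * B (W i) u := fun i a => by
    rw [hB.sub_pow_selfAdj, eigen_sub_pow hJu, map_smul, smul_eq_mul]
  have hdual0 : ∀ i, chainEigenvalue LP LR i ≠ t → B (W i) u = 0 := fun i hi => by
    have h1 := hdual i (chainSize LP LR i)
    rw [(hW.chain i).pow_eq_zero] at h1
    simp only [map_zero, LinearMap.zero_apply] at h1
    exact (mul_eq_zero.1 h1.symm).resolve_left (pow_ne_zero _ (sub_ne_zero.2 hi.symm))
  -- Only chains of length exactly `k + 1` contribute: on shorter ones `N ^ k` kills the generator,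
  -- and the eigenvector of a longer one is a power of `N` high enough to kill `star x` when moved
  -- across `B`.
  have hterm : ∀ i, ∑ a, B (chainDual J W ⟨i, a⟩) u * B (star x) (chainVec J W ⟨i, a⟩) =
      if chainEigenvalue LP LR i = t ∧ chainSize LP LR i = k + 1 then
        chainSign LP LR i * (B x ((N ^ k) (W i)) * B (star x) ((N ^ k) (W i))) else 0 := by
    intro i
    by_cases hi : chainEigenvalue LP LR i = t
    · have hpos := (hW.chain i).pos
      rw [Finset.sum_eq_single ⟨0, hpos⟩]
      · simp only [chainDual, chainVec, pow_zero, Module.End.one_apply, map_smul,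
          LinearMap.smul_apply, smul_eq_mul, hi, true_and, Nat.sub_zero]
        have h1 : B (W i) u = B x ((N ^ k) (W i)) := by
          rw [hB.symm, hu, hN, hB.sub_pow_selfAdj]
        rw [h1]
        have h2 := (hW.chain i).pow_eq_zero
        rw [hi] at h2
        split_ifs with hk
        · rw [hk, Nat.add_sub_cancel, mul_assoc]
        · rcases lt_or_gt_of_ne hk with hk | hk
          · rw [show k = (k - chainSize LP LR i) + chainSize LP LR i by omega, pow_add,
              Module.End.mul_apply, hN, h2]
            simp
          · have h3 := hB.sub_pow_selfAdj (t : ℂ) (chainSize LP LR i - 1) (star x) (W i)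
            rw [← h3, ← hN, hxs _ (by omega)]
            simp
      · intro a _ ha
        have ha0 : (a : ℕ) ≠ 0 := fun h => ha (Fin.ext h)
        simp only [chainDual]
        rw [map_smul, LinearMap.smul_apply, hdual, hi, sub_self, zero_pow ha0]
        simp
      · simp
    · rw [if_neg fun h => hi h.1]
      refine Finset.sum_eq_zero fun a _ => ?_
      simp [chainDual, hdual, hdual0 i hi]
  conv_lhs => rw [← hW.sum_dual_smul hB hE u]
  rw [map_sum, Fintype.sum_sigma]
  simp only [map_smul, smul_eq_mul, hterm]
  rw [Fintype.sum_sum_type, Fintype.sum_sum_type]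
  have hne : ∀ i : Fin LP.length, (LP.get i).1.im ≠ 0 := fun i => (him _ (List.get_mem _ _)).ne'
  rw [Finset.sum_eq_zero, Finset.sum_eq_zero, zero_add, zero_add]
  · refine Finset.sum_congr rfl fun n _ => ?_
    have h1 : B (star x) ((N ^ k) (W (.inr (.inr n)))) =
        star (B x ((N ^ k) (W (.inr (.inr n))))) := by
      rw [← hB.map_star]
      congr 1
      have h1 := hB.star_sub_pow (t : ℂ) k (W (.inr (.inr n)))
      rw [show star (t : ℂ) = t from Complex.conj_ofReal t, hW.star_eq] at h1
      exact h1
    have h2 : (chainEigenvalue LP LR (.inr (.inr n)) = (t : ℂ)) ↔ (LR.get n).1 = t :=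
      Complex.ofReal_inj
    rw [h1, RCLike.star_def, Complex.mul_conj]
    exact if_congr (and_congr h2 Iff.rfl) rfl rfl
  · intro i _
    refine if_neg fun h => hne i ?_
    have := congrArg Complex.im h.1
    simpa [chainEigenvalue] using this
  · intro i _
    refine if_neg fun h => hne i ?_
    have := congrArg Complex.im h.1
    simpa [chainEigenvalue] using this

lemma List.count_eq_card_filter {α : Type*} [DecidableEq α] [i : BEq α] [LawfulBEq α] (l : List α)
    (a : α) : l.count a = Fintype.card {n : Fin l.length // l.get n = a} := by
  obtain rfl : i = instBEqOfDecidableEq := lawful_beq_subsingleton _ _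
  have h : (Finset.univ.val.map l.get : Multiset α) = (l : Multiset α) := by
    simp
  rw [← Multiset.coe_count, ← h, Multiset.count_map, Fintype.card_subtype]
  simp only [Finset.card, Finset.filter_val]
  congr 2
  ext
  simp [eq_comm]

-- Sylvester's argument. With `r = (t, k + 1, e)`, the form `e * B (star x) (N ^ k x)` is positive
-- definite on the span of the generators of `W` with label `r`. In terms of `W'` the same form is a
-- sum of squares with signs, whose positive terms belong to the chains of `W'` with label `r`. A
-- vector on which those terms vanish is therefore zero.
open Classical in
lemma IsChainFamily.count_le [FiniteDimensional ℂ E] (hB : RealSelfAdjoint B J)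
    (hW : IsChainFamily B J W)
    {LP' : List (ℂ × ℕ)} {LR' : List (ℝ × ℕ × ℤˣ)} {W' : ChainIndex LP' LR' → E}
    (hW' : IsChainFamily B J W') (hE' : finrank ℂ E = totalSize LP' LR')
    (him' : ∀ p ∈ LP', 0 < p.1.im) (r : ℝ × ℕ × ℤˣ) : LR.count r ≤ LR'.count r := by
  obtain ⟨t, k, e⟩ := r
  rw [List.count_eq_card_filter, List.count_eq_card_filter]
  rcases isEmpty_or_nonempty {n : Fin LR.length // LR.get n = (t, k, e)} with hemp | ⟨⟨n₀, hn₀⟩⟩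
  · rw [Fintype.card_eq_zero]; exact Nat.zero_le _
  obtain ⟨k, rfl⟩ : ∃ k', k = k' + 1 := by
    have := (hW.chain (.inr (.inr n₀))).pos
    change 0 < (LR.get n₀).2.1 at this
    rw [hn₀] at this
    exact Nat.exists_eq_succ_of_ne_zero this.ne'
  set α := {n : Fin LR.length // LR.get n = (t, k + 1, e)}
  set β := {n : Fin LR'.length // LR'.get n = (t, k + 1, e)}
  set N : Module.End ℂ E := J - (t : ℂ) • 1 with hN
  let w : α → E := fun a => W (.inr (.inr a.1))
  let X : (α → ℂ) →ₗ[ℂ] E := Fintype.linearCombination ℂ w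
  -- The coordinates that enter the terms of sign `e` for `W'`. Injectivity of `φ` is the inequality
  -- of the counts.
  let φ : (α → ℂ) →ₗ[ℂ] (β → ℂ) :=
    LinearMap.pi fun b => (B ((N ^ k) (W' (.inr (.inr b.1))))).comp X
  have hee : ((e : ℤ) : ℂ) * ((e : ℤ) : ℂ) = 1 := units_coe_mul_self e
  have hchain : ∀ a : α, IsJordanChain B J t (k + 1) ((e : ℤ) : ℂ) (w a) := fun a => by
    have h1 := hW.chain (.inr (.inr a.1))
    change IsJordanChain B J ((LR.get a.1).1 : ℂ) (LR.get a.1).2.1 (((LR.get a.1).2.2 : ℤ) : ℂ) _ at h1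
    rwa [a.2] at h1
  have hws : ∀ a, star (w a) = w a := fun a => hW.star_eq _
  have hww : ∀ a b, B (w a) ((N ^ k) (w b)) = if a = b then ((e : ℤ) : ℂ) else 0 := fun a b => by
    by_cases hab : a = b
    · subst hab
      rw [(hchain a).pairing k (Nat.lt_succ_self k), if_pos rfl, if_pos rfl]
    · have h1 := hB.pairing_orth (hW.orth (.inr (.inr a.1)) (.inr (.inr b.1))
        fun h => hab (Subtype.ext (by simpa using h))) t t 0 k
      rw [if_neg hab]
      exact h1
  have hφ : Function.Injective φ := by
    rw [← LinearMap.ker_eq_bot, LinearMap.ker_eq_bot']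
    intro c hc
    set x := X c with hx
    have hx' : x = ∑ a, c a • w a := by simp [hx, X, Fintype.linearCombination_apply]
    have hxk : (N ^ (k + 1)) x = 0 := by
      rw [hx', map_sum]
      exact Finset.sum_eq_zero fun a _ => by rw [map_smul, (hchain a).pow_eq_zero, smul_zero]
    have h1 := hW'.hermitian_formula hB hE' him' hxk
    have h2 : B (star x) ((N ^ k) x) = ((e : ℤ) : ℂ) * ∑ a, (Complex.normSq (c a) : ℂ) := by
      rw [hx', star_sum, LinearMap.map_sum₂, Finset.mul_sum]
      refine Finset.sum_congr rfl fun a _ => ?_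
      simp only [star_smul, hws, map_sum, map_smul, LinearMap.smul_apply, smul_eq_mul, hww]
      rw [Finset.sum_eq_single a (fun b _ hb => by rw [if_neg hb.symm]; simp) (by simp), if_pos rfl,
        Complex.normSq_eq_conj_mul_self, RCLike.star_def]
      ring
    let Q : Fin LR'.length → ℝ := fun n => if (LR'.get n).1 = t ∧ (LR'.get n).2.1 = k + 1 then
      Complex.normSq (B x ((N ^ k) (W' (.inr (.inr n))))) else 0
    -- In the kernel of `φ` only terms with sign `-e` survive.
    have h3 : ∑ n : Fin LR'.length, (if (LR'.get n).1 = t ∧ (LR'.get n).2.1 = k + 1 then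
        (((LR'.get n).2.2 : ℤ) : ℂ) *
        Complex.normSq (B x ((N ^ k) (W' (.inr (.inr n))))) else 0) =
        -(((e : ℤ) : ℂ) * ∑ n, (Q n : ℂ)) := by
      rw [Finset.mul_sum, ← Finset.sum_neg_distrib]
      refine Finset.sum_congr rfl fun n _ => ?_
      simp only [Q]
      split_ifs with hn
      · by_cases hne : (LR'.get n).2.2 = e
        · have h4 := congrFun hc ⟨n, Prod.ext hn.1 (Prod.ext hn.2 hne)⟩
          have h5 : B x ((N ^ k) (W' (.inr (.inr n)))) = 0 := by
            rw [hB.symm]; exact h4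
          rw [h5]
          simp
        · have h4 : (LR'.get n).2.2 = -e := by
            rcases Int.units_eq_one_or e with he | he <;>
              rcases Int.units_eq_one_or (LR'.get n).2.2 with he' | he' <;> rw [he, he'] at hne ⊢ <;>
              simp at hne ⊢
          rw [h4]
          push_cast
          ring
      · simp
    have h4 : ∑ a, Complex.normSq (c a) + ∑ n, Q n = 0 := by
      have h5 : ((e : ℤ) : ℂ) * ∑ a, (Complex.normSq (c a) : ℂ) =
          -(((e : ℤ) : ℂ) * ∑ n, (Q n : ℂ)) := by
        rw [← h2, ← h3]; exact h1
      have h6 : ((∑ a, Complex.normSq (c a) + ∑ n, Q n : ℝ) : ℂ) = 0 := by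
        rw [Complex.ofReal_add, Complex.ofReal_sum, Complex.ofReal_sum]
        linear_combination ((e : ℤ) : ℂ) * h5 -
          (∑ a, (Complex.normSq (c a) : ℂ) + ∑ n, (Q n : ℂ)) * hee
      exact_mod_cast h6
    have h5 : 0 ≤ ∑ n, Q n := Finset.sum_nonneg fun n _ => by
      simp only [Q]; split_ifs <;> [exact Complex.normSq_nonneg _; exact le_rfl]
    have h6 : 0 ≤ ∑ a, Complex.normSq (c a) := Finset.sum_nonneg fun a _ => Complex.normSq_nonneg _
    ext a
    exact Complex.normSq_eq_zero.1 ((Finset.sum_eq_zero_iff_of_nonneg fun a _ =>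
      Complex.normSq_nonneg _).1 (by linarith) a (Finset.mem_univ a))
  have := LinearMap.finrank_le_finrank_of_injective hφ
  rwa [Module.finrank_fintype_fun_eq_card, Module.finrank_fintype_fun_eq_card] at this

/-- The labels of the real chains are determined by `B` and `J`. -/
theorem IsChainFamily.real_perm [FiniteDimensional ℂ E] (hB : RealSelfAdjoint B J)
    (hW : IsChainFamily B J W) (hE : finrank ℂ E = totalSize LP LR) (him : ∀ p ∈ LP, 0 < p.1.im)
    {LP' : List (ℂ × ℕ)} {LR' : List (ℝ × ℕ × ℤˣ)} {W' : ChainIndex LP' LR' → E}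
    (hW' : IsChainFamily B J W') (hE' : finrank ℂ E = totalSize LP' LR')
    (him' : ∀ p ∈ LP', 0 < p.1.im) : LR.Perm LR' := by
  classical
  rw [List.perm_iff_count]
  exact fun r => le_antisymm (hW.count_le hB hW' hE' him' r) (hW'.count_le hB hW hE him r)

end SignUniqueness

/-! ### Uniqueness of the Jordan blocks -/

section JordanUniqueness

variable {E : Type*} [AddCommGroup E] [Module ℂ E] {J : Module.End ℂ E}
variable {I : Type*} {k : I → ℕ} {z : I → ℂ}

/-- The basis `b` brings `J` to Jordan form with blocks of size `k i` and eigenvalue `z i`. -/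
def IsJordanBasis (J : Module.End ℂ E) (z : I → ℂ) (b : Basis (Σ i, Fin (k i)) ℂ E) : Prop :=
  ∀ p, J (b p) = z p.1 • b p +
    if h : (p.2 : ℕ) = 0 then 0 else b ⟨p.1, ⟨p.2 - 1, by omega⟩⟩

/-- The coordinate at the place `a` of the block `i`, zero outside the block. -/
noncomputable def blockCoord (b : Basis (Σ i, Fin (k i)) ℂ E) (i : I) (a : ℕ) : E →ₗ[ℂ] ℂ :=
  if h : a < k i then b.coord ⟨i, ⟨a, h⟩⟩ else 0

lemma blockCoord_self (b : Basis (Σ i, Fin (k i)) ℂ E) [DecidableEq I] (i : I) (a : ℕ)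
    (p : Σ i, Fin (k i)) : blockCoord b i a (b p) = if p.1 = i ∧ (p.2 : ℕ) = a then 1 else 0 := by
  obtain ⟨j, c⟩ := p
  rw [blockCoord]
  split_ifs with h1 h2 h2
  · obtain ⟨rfl, rfl⟩ := h2
    simp
  · simp only [Basis.coord_apply, Basis.repr_self]
    rw [Finsupp.single_apply, if_neg]
    intro h
    refine h2 ?_
    cases h
    exact ⟨rfl, rfl⟩
  · obtain ⟨rfl, rfl⟩ := h2
    exact absurd c.2 h1
  · rfl

variable {b : Basis (Σ i, Fin (k i)) ℂ E}

lemma IsJordanBasis.blockCoord_apply (hb : IsJordanBasis J z b) (i : I) (a : ℕ) (x : E) :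
    blockCoord b i a (J x) = z i * blockCoord b i a x + blockCoord b i (a + 1) x := by
  classical
  have h : (blockCoord b i a).comp J = z i • blockCoord b i a + blockCoord b i (a + 1) := by
    refine b.ext fun p => ?_
    simp only [LinearMap.comp_apply, LinearMap.add_apply, LinearMap.smul_apply, hb p, map_add,
      map_smul, smul_eq_mul]
    obtain ⟨j, c⟩ := p
    dsimp only
    congr 1
    · rw [blockCoord_self]
      split_ifs with h
      · rw [show z j = z i from congrArg z h.1]
      · simp
    · split_ifs with h
      · rw [map_zero, blockCoord_self, if_neg]
        rintro ⟨-, h1⟩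
        dsimp only at h1
        omega
      · rw [blockCoord_self, blockCoord_self]
        refine if_congr (and_congr Iff.rfl ?_) rfl rfl
        dsimp only
        omega
  exact LinearMap.congr_fun h x

lemma IsJordanBasis.blockCoord_pow (hb : IsJordanBasis J z b) {i : I} (j a : ℕ) (x : E) :
    blockCoord b i a (((J - z i • 1) ^ j) x) = blockCoord b i (a + j) x := by
  induction j generalizing a with
  | zero => rfl
  | succ j ih =>
    rw [pow_succ', Module.End.mul_apply, LinearMap.sub_apply, map_sub, hb.blockCoord_apply]
    simp only [LinearMap.smul_apply, Module.End.one_apply, map_smul, smul_eq_mul, ih,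
      add_sub_cancel_left]
    ring_nf

lemma IsJordanBasis.pow_apply (hb : IsJordanBasis J z b) (i : I) (j a : ℕ) (h : a + j < k i) :
    ((J - z i • 1) ^ j) (b ⟨i, ⟨a + j, h⟩⟩) = b ⟨i, ⟨a, by omega⟩⟩ := by
  induction j generalizing a with
  | zero => rfl
  | succ j ih =>
    have h1 : (J - z i • 1) (b ⟨i, ⟨a + (j + 1), h⟩⟩) = b ⟨i, ⟨a + j, by omega⟩⟩ := by
      rw [LinearMap.sub_apply, hb]
      simp only [LinearMap.smul_apply, Module.End.one_apply, add_sub_cancel_left]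
      rw [dif_neg (by omega)]
      rfl
    rw [pow_succ, Module.End.mul_apply, h1, ih]

/-- The number of Jordan blocks with eigenvalue `l` of size more than `j`. -/
lemma IsJordanBasis.finrank_eq [Fintype I] [DecidableEq I] [FiniteDimensional ℂ E]
    (hb : IsJordanBasis J z b) (l : ℂ) (j : ℕ) :
    finrank ℂ ↥(LinearMap.ker (J - l • 1) ⊓ LinearMap.range ((J - l • 1) ^ j)) =
      Fintype.card {i // z i = l ∧ j < k i} := by
  set R := LinearMap.ker (J - l • 1) ⊓ LinearMap.range ((J - l • 1) ^ j)
  apply le_antisymm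
  · let φ : R →ₗ[ℂ] ({i // z i = l ∧ j < k i} → ℂ) :=
      LinearMap.pi fun i => (blockCoord b i.1 0).comp R.subtype
    have hφ : Function.Injective φ := by
      rw [← LinearMap.ker_eq_bot, LinearMap.ker_eq_bot']
      rintro ⟨x, hx1, v, rfl⟩ h
      set x := ((J - l • 1) ^ j) v with hxv
      have hJx : J x = l • x := by
        have : (J - l • 1) x = 0 := hx1
        simpa [sub_eq_zero] using this
      -- Along a block the coordinates of an eigenvector form a geometric progression, so they are
      -- determined by the coordinate at place 0.
      have hrec : ∀ i a, blockCoord b i (a + 1) x = (l - z i) * blockCoord b i a x := fun i a => by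
        have h1 := hb.blockCoord_apply i a x
        rw [hJx, map_smul, smul_eq_mul] at h1
        linear_combination -h1
      have hpow : ∀ i a, blockCoord b i a x = (l - z i) ^ a * blockCoord b i 0 x := fun i a => by
        induction a with
        | zero => simp
        | succ a ih => rw [hrec, ih]; ring
      -- Blocks longer than `j` are covered by the hypothesis. In a shorter block for `l`, an image
      -- under the `j`-th power has no coordinate at place 0. For another eigenvalue the progression
      -- would have to run on beyond the end of the block.
      have h0 : ∀ i, blockCoord b i 0 x = 0 := by
        intro i
        by_cases hz : z i = l
        · by_cases hj : j < k i
          · exact congrFun h ⟨i, hz, hj⟩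
          · subst hz
            rw [hxv, hb.blockCoord_pow, blockCoord, dif_neg (by omega)]
            rfl
        · have h1 := hpow i (k i)
          rw [blockCoord, dif_neg (lt_irrefl _)] at h1
          exact (mul_eq_zero.1 h1.symm).resolve_left (pow_ne_zero _ (sub_ne_zero.2 (Ne.symm hz)))
      have hx0 : x = 0 := by
        refine b.ext_elem fun p => ?_
        have h1 := hpow p.1 p.2
        rw [h0, mul_zero, blockCoord, dif_pos p.2.2] at h1
        rw [map_zero]
        exact h1
      exact Subtype.ext hx0
    have := LinearMap.finrank_le_finrank_of_injective hφ
    rwa [Module.finrank_fintype_fun_eq_card] at this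
  -- Lower bound: the eigenvector of each block longer than `j` is the image of place `j` under the
  -- `j`-th power.
  · have hpos : ∀ i : {i // z i = l ∧ j < k i}, 0 < k i.1 := fun i => by have := i.2.2; omega
    let w : {i // z i = l ∧ j < k i} → R := fun i => ⟨b ⟨i.1, ⟨0, hpos i⟩⟩, by
      obtain ⟨i, rfl, hi⟩ := i
      refine ⟨?_, b ⟨i, ⟨j, hi⟩⟩, ?_⟩
      · rw [SetLike.mem_coe, LinearMap.mem_ker, LinearMap.sub_apply, hb]
        simp
      · have := hb.pow_apply i j 0 (by omega)
        simp only [zero_add] at this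
        exact this⟩
    have hw : LinearIndependent ℂ w := by
      refine LinearIndependent.of_comp R.subtype ?_
      refine b.linearIndependent.comp (fun i : {i // z i = l ∧ j < k i} => ⟨i.1, ⟨0, hpos i⟩⟩) ?_
      intro i i' h
      exact Subtype.ext (congrArg Sigma.fst h)
    exact hw.fintype_card_le_finrank

/-- Consecutive counts of blocks of size more than `j` differ by the number of blocks of size
exactly `j + 1`, so the multiset of blocks can be recovered from the ranks. -/
lemma card_lt_eq_count_add {I : Type*} [Fintype I] (z : I → ℂ) (k : I → ℕ) (l : ℂ) (j : ℕ)
    [DecidableEq (ℂ × ℕ)] [DecidablePred fun i => z i = l ∧ j < k i]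
    [DecidablePred fun i => z i = l ∧ j + 1 < k i] :
    Fintype.card {i // z i = l ∧ j < k i} =
      Multiset.count (l, j + 1) (Finset.univ.val.map fun i => (z i, k i)) +
      Fintype.card {i // z i = l ∧ j + 1 < k i} := by
  classical
  rw [Multiset.count_map, Fintype.card_subtype, Fintype.card_subtype]
  change _ = (Finset.univ.filter fun i => (l, j + 1) = (z i, k i)).card + _
  rw [← Finset.card_union_of_disjoint]
  · congr 1
    ext i
    simp only [Finset.mem_filter, Finset.mem_univ, true_and, Finset.mem_union, Prod.mk.injEq]
    grind
  · rw [Finset.disjoint_filter]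
    intro i _ h1 h2
    simp only [Prod.mk.injEq] at h1
    omega

/-- Two Jordan bases have the same blocks. -/
theorem IsJordanBasis.map_eq [Fintype I] [DecidableEq I] [FiniteDimensional ℂ E]
    (hb : IsJordanBasis J z b) {I' : Type*} [Fintype I'] [DecidableEq I'] {k' : I' → ℕ}
    {z' : I' → ℂ} {b' : Basis (Σ i, Fin (k' i)) ℂ E} (hb' : IsJordanBasis J z' b')
    (hk : ∀ i, 0 < k i) (hk' : ∀ i, 0 < k' i) :
    (Finset.univ.val.map fun i => (z i, k i)) = Finset.univ.val.map fun i => (z' i, k' i) := by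
  classical
  have key : ∀ l j, Fintype.card {i // z i = l ∧ j < k i} = Fintype.card {i // z' i = l ∧ j < k' i} :=
    fun l j => by rw [← hb.finrank_eq, ← hb'.finrank_eq]
  refine Multiset.ext.2 fun p => ?_
  obtain ⟨l, j⟩ := p
  rcases j with _ | j
  · rw [Multiset.count_eq_zero_of_notMem, Multiset.count_eq_zero_of_notMem]
    · simp only [Multiset.mem_map, not_exists, not_and]
      rintro i - h
      exact (hk' i).ne' (congrArg Prod.snd h)
    · simp only [Multiset.mem_map, not_exists, not_and]
      rintro i - h
      exact (hk i).ne' (congrArg Prod.snd h)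
  · have h1 := card_lt_eq_count_add z k l j
    have h2 := card_lt_eq_count_add z' k' l j
    rw [key, key] at h1
    omega

end JordanUniqueness

/-! ### Segré types: existence, invariance and uniqueness -/

section Segre

/-- Read column by column, the matrix equation that defines a Segré type becomes the relations of a
Jordan basis, and conversely. -/
lemma mul_reindex_blockDiagonal_apply {I : Type*} [Fintype I] [DecidableEq I] {k : I → ℕ}
    (z : I → ℂ) (e : (Σ i, Fin (k i)) ≃ Fin 6) (S : Matrix (Fin 6) (Fin 6) ℂ)
    (r : Fin 6) (p : Σ i, Fin (k i)) :
    (S * Matrix.reindex e e (Matrix.blockDiagonal' fun i => jordanBlock (k i) (z i))) r (e p) =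
      z p.1 * S r (e p) +
        if h : (p.2 : ℕ) = 0 then 0 else S r (e ⟨p.1, ⟨p.2 - 1, by omega⟩⟩) := by
  obtain ⟨i, a⟩ := p
  rw [Matrix.mul_apply, ← Equiv.sum_comp e, Fintype.sum_sigma, Finset.sum_eq_single i]
  · simp only [Matrix.reindex_apply, Matrix.submatrix_apply, Equiv.symm_apply_apply,
      Matrix.blockDiagonal'_apply_eq, jordanBlock, Matrix.of_apply]
    have h1 : ∀ c : Fin (k i), (S r (e ⟨i, c⟩) * if c = a then z i else if (c : ℕ) + 1 = a then 1
        else 0) = (if c = a then z i * S r (e ⟨i, a⟩) else 0) +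
          if (c : ℕ) + 1 = a then S r (e ⟨i, c⟩) else 0 := by
      intro c
      by_cases hc : c = a
      · subst hc
        simp [mul_comm]
      · simp [hc]
    rw [Finset.sum_congr rfl fun c _ => h1 c, Finset.sum_add_distrib]
    congr 1
    · simp
    · split_ifs with h
      · exact Finset.sum_eq_zero fun c _ => if_neg (by omega)
      · rw [Finset.sum_eq_single ⟨(a : ℕ) - 1, by omega⟩]
        · rw [if_pos]
          dsimp only
          omega
        · intro c _ hc
          refine if_neg fun h' => hc (Fin.ext ?_)
          dsimp only
          omega
        · simp
  · intro j _ hj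
    refine Finset.sum_eq_zero fun c _ => ?_
    rw [Matrix.reindex_apply, Matrix.submatrix_apply, Equiv.symm_apply_apply,
      Equiv.symm_apply_apply, Matrix.blockDiagonal'_apply_ne _ _ _ hj, mul_zero]
  · simp

/-- A chain family puts the matrix into Jordan form. -/
lemma IsChainFamily.exists_jordan_form {LP : List (ℂ × ℕ)} {LR : List (ℝ × ℕ × ℤˣ)}
    {B : LinearMap.BilinForm ℂ (Fin 6 → ℂ)} {M : Matrix (Fin 6) (Fin 6) ℝ}
    (hB : RealSelfAdjoint B (complexEnd M)) {W : ChainIndex LP LR → Fin 6 → ℂ}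
    (hW : IsChainFamily B (complexEnd M) W) (h6 : totalSize LP LR = 6) :
    ∃ (e : ChainVecIndex LP LR ≃ Fin 6) (S : Matrix (Fin 6) (Fin 6) ℂ), IsUnit S.det ∧
      M.map (fun a => (a : ℂ)) * S = S * Matrix.reindex e e (Matrix.blockDiagonal' fun i =>
        jordanBlock (chainSize LP LR i) (chainEigenvalue LP LR i)) := by
  let e : ChainVecIndex LP LR ≃ Fin 6 := Fintype.equivFinOfCardEq (by rw [card_chainVecIndex, h6])
  let S : Matrix (Fin 6) (Fin 6) ℂ := Matrix.of fun r c => chainVec (complexEnd M) W (e.symm c) r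
  refine ⟨e, S, ?_, ?_⟩
  · rw [← Matrix.isUnit_iff_isUnit_det, ← Matrix.linearIndependent_cols_iff_isUnit]
    exact (hW.linearIndependent hB).comp _ e.symm.injective
  · ext r c
    obtain ⟨p, rfl⟩ := e.surjective c
    refine Eq.trans ?_ (mul_reindex_blockDiagonal_apply (k := chainSize LP LR)
      (chainEigenvalue LP LR) e S r p).symm
    have h1 := congrFun (hW.apply_chainVec p) r
    rw [complexEnd_apply] at h1
    rw [Matrix.mul_apply]
    simp only [S, Matrix.of_apply, Equiv.symm_apply_apply, Matrix.map_apply]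
    rw [h1, Pi.add_apply, Pi.smul_apply, smul_eq_mul]
    split_ifs <;> simp

/-- A chain family exhibits the Segré type. -/
theorem IsChainFamily.hasSegreType {LP : List (ℂ × ℕ)} {LR : List (ℝ × ℕ × ℤˣ)}
    {B : LinearMap.BilinForm ℂ (Fin 6 → ℂ)} {M : Matrix (Fin 6) (Fin 6) ℝ}
    (hB : RealSelfAdjoint B (complexEnd M)) {W : ChainIndex LP LR → Fin 6 → ℂ}
    (hW : IsChainFamily B (complexEnd M) W) (h6 : totalSize LP LR = 6)
    (him : ∀ p ∈ LP, 0 < p.1.im) :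
    HasSegreType M ⟨(LP.map Prod.snd : List ℕ), (LR.map fun r => r.2.1 : List ℕ)⟩ := by
  refine ⟨LP.length, LR.length, fun i => (LP.get i).2, fun i => (LR.get i).2.1,
    fun i => (LP.get i).1, fun i => (LR.get i).1, ?_, ?_, ?_, ?_⟩
  · have h : (Finset.univ.val.map LP.get : Multiset _) = (LP : Multiset _) := by simp
    rw [← Multiset.map_coe, ← h, Multiset.map_map]
    rfl
  · change _ = ((LR.map fun r => r.2.1 : List ℕ) : Multiset ℕ)
    have h : (Finset.univ.val.map LR.get : Multiset _) = (LR : Multiset _) := by simp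
    rw [← Multiset.map_coe, ← h, Multiset.map_map]
    rfl
  · exact fun i => (him _ (List.get_mem _ _)).ne'
  exact hW.exists_jordan_form hB h6

lemma HasSegreType.of_similar {A A' Q : Matrix (Fin 6) (Fin 6) ℝ} {s : SegreSymbol}
    (h : HasSegreType A s) (hQ : IsUnit Q.det) (hAQ : A * Q = Q * A') : HasSegreType A' s := by
  obtain ⟨m, n, c, r, z, x, h1, h2, h3, e, S, hS, hAS⟩ := h
  refine ⟨m, n, c, r, z, x, h1, h2, h3, e, (Q⁻¹).map (fun a => (a : ℂ)) * S, ?_, ?_⟩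
  · rw [Matrix.det_mul]
    refine IsUnit.mul ?_ hS
    have h4 : ((Q⁻¹).map fun a => (a : ℂ)).det = ((Q⁻¹.det : ℝ) : ℂ) :=
      (RingHom.map_det Complex.ofRealHom Q⁻¹).symm
    rw [h4, Matrix.det_nonsing_inv]
    have h5 : IsUnit (Ring.inverse Q.det) := by rwa [isUnit_ringInverse]
    exact h5.map Complex.ofRealHom
  · have h4 : A' * Q⁻¹ = Q⁻¹ * A := by
      calc A' * Q⁻¹ = Q⁻¹ * (Q * A') * Q⁻¹ := by
            rw [← Matrix.mul_assoc, Matrix.nonsing_inv_mul _ hQ, Matrix.one_mul]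
        _ = Q⁻¹ * A * (Q * Q⁻¹) := by rw [← hAQ]; simp only [Matrix.mul_assoc]
        _ = _ := by rw [Matrix.mul_nonsing_inv _ hQ, Matrix.mul_one]
    have h5 : A'.map (fun a => (a : ℂ)) * (Q⁻¹).map (fun a => (a : ℂ)) =
        (Q⁻¹).map (fun a => (a : ℂ)) * A.map (fun a => (a : ℂ)) := by
      have := congrArg (fun X : Matrix (Fin 6) (Fin 6) ℝ => X.map Complex.ofRealHom) h4
      rw [Matrix.map_mul, Matrix.map_mul] at this
      exact this
    rw [← Matrix.mul_assoc, h5, Matrix.mul_assoc, hAS, Matrix.mul_assoc]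

/-- Scaling by `t` also multiplies the ones above the diagonal. Dividing place `a` of each block by
`t ^ a` restores them. A negative `t` exchanges the half planes, which the definition allows, since
it only asks for non-real eigenvalues. -/
lemma HasSegreType.smul {A : Matrix (Fin 6) (Fin 6) ℝ} {s : SegreSymbol}
    (h : HasSegreType A s) {t : ℝ} (ht : t ≠ 0) : HasSegreType (t • A) s := by
  obtain ⟨m, n, c, r, z, x, h1, h2, h3, e, S, hS, hAS⟩ := h
  have ht' : (t : ℂ) ≠ 0 := Complex.ofReal_ne_zero.2 ht
  let d : Fin 6 → ℂ := fun j => ((t : ℂ) ^ ((e.symm j).2 : ℕ))⁻¹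
  have hd : ∀ p, d (e p) = ((t : ℂ) ^ (p.2 : ℕ))⁻¹ := fun p => by
    simp only [d]
    rw [Equiv.symm_apply_apply]
  let D : Matrix (Fin 6) (Fin 6) ℂ := Matrix.diagonal d
  refine ⟨m, n, c, r, fun i => t * z i, fun i => t * x i, h1, h2, fun i => ?_, e, S * D, ?_, ?_⟩
  · rw [Complex.im_ofReal_mul]
    exact mul_ne_zero ht (h3 i)
  · rw [Matrix.det_mul]
    refine hS.mul ?_
    rw [Matrix.det_diagonal, isUnit_iff_ne_zero]
    exact Finset.prod_ne_zero_iff.2 fun j _ => inv_ne_zero (pow_ne_zero _ ht')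
  · have hA : (t • A).map (fun a => (a : ℂ)) = (t : ℂ) • A.map (fun a => (a : ℂ)) := by
      ext i j; simp
    rw [hA, Matrix.smul_mul, ← Matrix.mul_assoc, hAS]
    ext i j
    obtain ⟨⟨q, a⟩, rfl⟩ := e.surjective j
    have hzt : (Sum.elim (fun i => (t : ℂ) * z i) (Sum.elim
        (fun j => (starRingEnd ℂ) ((t : ℂ) * z j)) (fun j => (((t * x j : ℝ)) : ℂ)))) q =
        t * (Sum.elim z (Sum.elim (fun j => (starRingEnd ℂ) (z j)) (fun j => (x j : ℂ)))) q := by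
      rcases q with q | q | q <;> simp
    rw [Matrix.smul_apply, Matrix.mul_diagonal, mul_reindex_blockDiagonal_apply,
      mul_reindex_blockDiagonal_apply, hzt]
    simp only [Matrix.mul_diagonal, hd, smul_eq_mul, D]
    split_ifs with h
    · ring
    · obtain ⟨a, ha⟩ := a
      rcases a with _ | a
      · simp at h
      · simp only [Nat.add_sub_cancel]
        rw [pow_succ]
        field_simp

lemma HasSegreType.exists_jordanBasis {A : Matrix (Fin 6) (Fin 6) ℝ} {s : SegreSymbol}
    (h : HasSegreType A s) : ∃ (m n : ℕ) (c : Fin m → ℕ) (r : Fin n → ℕ) (z : Fin m → ℂ)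
      (x : Fin n → ℝ),
    Multiset.map c Finset.univ.val = s.pairs ∧ Multiset.map r Finset.univ.val = s.reals ∧
    (∀ i, (z i).im ≠ 0) ∧
    ∃ b : Basis (Σ i : Fin m ⊕ Fin m ⊕ Fin n, Fin (Sum.elim c (Sum.elim c r) i)) ℂ (Fin 6 → ℂ),
      IsJordanBasis (complexEnd A)
        (Sum.elim z (Sum.elim (fun j => (starRingEnd ℂ) (z j)) (fun j => (x j : ℂ)))) b := by
  obtain ⟨m, n, c, r, z, x, h1, h2, h3, e, S, hS, hAS⟩ := h
  have hli : LinearIndependent ℂ S.col := by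
    rw [Matrix.linearIndependent_cols_iff_isUnit, Matrix.isUnit_iff_isUnit_det]
    exact hS
  let b := (basisOfLinearIndependentOfCardEqFinrank hli (by simp)).reindex e.symm
  have hbp : ∀ p, b p = S.col (e p) := fun p => by simp [b]
  refine ⟨m, n, c, r, z, x, h1, h2, h3, b, fun p => ?_⟩
  ext i
  have h4 := congrFun (congrFun hAS i) (e p)
  rw [mul_reindex_blockDiagonal_apply, Matrix.mul_apply] at h4
  rw [complexEnd_apply, hbp]
  simp only [Matrix.map_apply] at h4
  refine Eq.trans h4 ?_
  rw [Pi.add_apply]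
  congr 1
  split_ifs
  · rfl
  · rw [hbp]; rfl

/-- The Segré type of a matrix is unique. -/
theorem HasSegreType.unique {A : Matrix (Fin 6) (Fin 6) ℝ} {s s' : SegreSymbol}
    (h : HasSegreType A s) (h' : HasSegreType A s') (hs : 0 ∉ s.pairs) (hs0 : 0 ∉ s.reals)
    (hs' : 0 ∉ s'.pairs) (hs0' : 0 ∉ s'.reals) : s = s' := by
  classical
  obtain ⟨m, n, c, r, z, x, h1, h2, h3, b, hb⟩ := h.exists_jordanBasis
  obtain ⟨m', n', c', r', z', x', h1', h2', h3', b', hb'⟩ := h'.exists_jordanBasis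
  -- Blocks of size 0 would be invisible in a Jordan basis, hence the exclusion of 0 from the
  -- symbols.
  have hpos : ∀ {m n : ℕ} {c : Fin m → ℕ} {r : Fin n → ℕ} {s : SegreSymbol},
      Multiset.map c Finset.univ.val = s.pairs → Multiset.map r Finset.univ.val = s.reals →
      0 ∉ s.pairs → 0 ∉ s.reals → ∀ i : Fin m ⊕ Fin m ⊕ Fin n, 0 < Sum.elim c (Sum.elim c r) i := by
    intro m n c r s h1 h2 hs hs0
    have hc : ∀ i, 0 < c i := fun i => Nat.pos_of_ne_zero fun h0 => hs (by
      rw [← h1, ← h0]; exact Multiset.mem_map_of_mem _ (Finset.mem_univ i))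
    have hr : ∀ i, 0 < r i := fun i => Nat.pos_of_ne_zero fun h0 => hs0 (by
      rw [← h2, ← h0]; exact Multiset.mem_map_of_mem _ (Finset.mem_univ i))
    rintro (i | i | i)
    · exact hc i
    · exact hc i
    · exact hr i
  have key := hb.map_eq hb' (hpos h1 h2 hs hs0) (hpos h1' h2' hs' hs0')
  -- The blocks with real eigenvalue give `reals`; those with non-real eigenvalue give `pairs`
  -- twice, and multiplicities can be halved.
  have hsplit : ∀ {m n : ℕ} {c : Fin m → ℕ} {r : Fin n → ℕ} {z : Fin m → ℂ} {x : Fin n → ℝ}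
      {s : SegreSymbol}, Multiset.map c Finset.univ.val = s.pairs →
      Multiset.map r Finset.univ.val = s.reals → (∀ i, (z i).im ≠ 0) →
      ((Finset.univ.val.map fun i : Fin m ⊕ Fin m ⊕ Fin n =>
        ((Sum.elim z (Sum.elim (fun j => (starRingEnd ℂ) (z j)) (fun j => (x j : ℂ))) i,
          Sum.elim c (Sum.elim c r) i) : ℂ × ℕ)).filter fun p => p.1.im = 0).map Prod.snd = s.reals ∧
      ((Finset.univ.val.map fun i : Fin m ⊕ Fin m ⊕ Fin n =>
        ((Sum.elim z (Sum.elim (fun j => (starRingEnd ℂ) (z j)) (fun j => (x j : ℂ))) i,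
          Sum.elim c (Sum.elim c r) i) : ℂ × ℕ)).filter fun p => p.1.im ≠ 0).map Prod.snd =
        s.pairs + s.pairs := by
    intro m n c r z x s h1 h2 h3
    have huniv : (Finset.univ.val : Multiset (Fin m ⊕ Fin m ⊕ Fin n)) =
        Multiset.map Sum.inl Finset.univ.val + (Multiset.map (fun i => Sum.inr (Sum.inl i))
          Finset.univ.val + Multiset.map (fun i => Sum.inr (Sum.inr i)) Finset.univ.val) := by
      rw [← Finset.univ_disjSum_univ, ← Finset.univ_disjSum_univ]
      simp only [Finset.disjSum, Multiset.disjSum, Multiset.map_add, Multiset.map_map]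
      rfl
    rw [huniv]
    simp only [Multiset.map_add, Multiset.map_map, Multiset.filter_add, Function.comp_def,
      Sum.elim_inl, Sum.elim_inr]
    rw [← h1, ← h2]
    constructor
    · rw [Multiset.filter_eq_nil.2, Multiset.filter_eq_nil.2, Multiset.filter_eq_self.2]
      · simp only [Multiset.map_map]
        rfl
      all_goals
        simp only [Multiset.mem_map]
        rintro _ ⟨i, -, rfl⟩
        simp [h3]
    · rw [Multiset.filter_eq_self.2, Multiset.filter_eq_self.2, Multiset.filter_eq_nil.2]
      · rw [Multiset.map_zero, add_zero]
        simp only [Multiset.map_map]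
        rfl
      all_goals
        simp only [Multiset.mem_map]
        rintro _ ⟨i, -, rfl⟩
        simp [h3]
  obtain ⟨hr, hp⟩ := hsplit (x := x) h1 h2 h3
  obtain ⟨hr', hp'⟩ := hsplit (x := x') h1' h2' h3'
  rw [key] at hr hp
  have e1 : s.reals = s'.reals := hr.symm.trans hr'
  have e2 : s.pairs + s.pairs = s'.pairs + s'.pairs := hp.symm.trans hp'
  have e3 : s.pairs = s'.pairs := by
    ext a
    have := congrArg (Multiset.count a) e2
    rw [Multiset.count_add, Multiset.count_add] at this
    omega
  cases s; cases s'
  simp only at e1 e3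
  rw [e1, e3]

end Segre

/-! ### Coordinate subspaces and explicit chains in `ℂ⁶` -/

section NormalForms

/-- The standard basis of `ℂ⁶`. -/
noncomputable def stdVec (i : Fin 6) : Fin 6 → ℂ := Pi.single i 1

lemma star_stdVec (i : Fin 6) : star (stdVec i) = stdVec i := by
  ext j
  rcases eq_or_ne j i with rfl | h <;> simp [stdVec, *]

lemma sigmaForm_stdVec (i j : Fin 6) : sigmaForm (stdVec i) (stdVec j) = if j = i.rev then 1 else 0 := by
  simp only [sigmaForm_apply, stdVec]
  rw [Finset.sum_eq_single i]
  · rw [Pi.single_eq_same, Pi.single_apply, one_mul]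
    simp only [eq_comm]
  · intro k _ hk
    rw [Pi.single_eq_of_ne hk, zero_mul]
  · simp

lemma complexEnd_stdVec (A : Matrix (Fin 6) (Fin 6) ℝ) (j : Fin 6) :
    complexEnd (sigmaMatrix * A) (stdVec j) = (A 5 j : ℂ) • stdVec 0 + (A 4 j : ℂ) • stdVec 1 +
      (A 3 j : ℂ) • stdVec 2 + (A 2 j : ℂ) • stdVec 3 + (A 1 j : ℂ) • stdVec 4 +
      (A 0 j : ℂ) • stdVec 5 := by
  ext i
  rw [complexEnd_apply, Finset.sum_eq_single j]
  · rw [sigmaMatrix_mul_apply]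
    fin_cases i <;> simp [stdVec]
  · intro k _ hk
    rw [stdVec, Pi.single_eq_of_ne hk, mul_zero]
  · simp

/-- The subspace of vectors supported in `T`. -/
def coordSpace (T : Finset (Fin 6)) : Submodule ℂ (Fin 6 → ℂ) where
  carrier := {x | ∀ i, i ∉ T → x i = 0}
  add_mem' := fun ha hb i hi => by simp [ha i hi, hb i hi]
  zero_mem' := fun i _ => rfl
  smul_mem' := fun c x hx i hi => by simp [hx i hi]

lemma stdVec_mem {T : Finset (Fin 6)} {i : Fin 6} (hi : i ∈ T) : stdVec i ∈ coordSpace T := by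
  intro j hj
  exact Pi.single_eq_of_ne (fun h => hj (by rw [h]; exact hi)) _

lemma star_mem_coordSpace {T : Finset (Fin 6)} {x : Fin 6 → ℂ} (hx : x ∈ coordSpace T) :
    star x ∈ coordSpace T := fun i hi => by simp [hx i hi]

lemma complexEnd_mem_coordSpace {A : Matrix (Fin 6) (Fin 6) ℝ} {T : Finset (Fin 6)}
    (hA : ∀ i, i.rev ∉ T → ∀ j ∈ T, A i j = 0) {x : Fin 6 → ℂ} (hx : x ∈ coordSpace T) :
    complexEnd (sigmaMatrix * A) x ∈ coordSpace T := by
  intro i hi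
  rw [complexEnd_apply]
  refine Finset.sum_eq_zero fun j _ => ?_
  rw [sigmaMatrix_mul_apply]
  by_cases hj : j ∈ T
  · rw [hA i.rev (by rwa [Fin.rev_rev]) j hj]; simp
  · rw [hx j hj]; simp

lemma sigmaForm_coordSpace {T T' : Finset (Fin 6)} (h : ∀ i ∈ T, i.rev ∉ T') :
    ∀ x ∈ coordSpace T, ∀ y ∈ coordSpace T', sigmaForm x y = 0 := by
  intro x hx y hy
  rw [sigmaForm_apply]
  refine Finset.sum_eq_zero fun i _ => ?_
  by_cases hi : i ∈ T
  · rw [hy _ (h i hi), mul_zero]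
  · rw [hx i hi, zero_mul]

/-- Direct sums of normal forms along complementary coordinate subspaces. -/
lemma HasLabels.append_coord {A : Matrix (Fin 6) (Fin 6) ℝ} (hA : A.transpose = A)
    {T T' : Finset (Fin 6)} (hT : ∀ i ∈ T, i.rev ∉ T')
    (hAT : ∀ i, i.rev ∉ T' → ∀ j ∈ T', A i j = 0)
    {LP LP' : List (ℂ × ℕ)} {LR LR' : List (ℝ × ℕ × ℤˣ)}
    (h : HasLabels sigmaForm (complexEnd (sigmaMatrix * A)) (coordSpace T) LP LR)
    (h' : HasLabels sigmaForm (complexEnd (sigmaMatrix * A)) (coordSpace T') LP' LR') :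
    HasLabels sigmaForm (complexEnd (sigmaMatrix * A)) (coordSpace (T ∪ T')) (LP ++ LP')
      (LR ++ LR') := by
  refine (HasLabels.append (realSelfAdjoint_sigma hA) h h'
    (fun x hx => complexEnd_mem_coordSpace hAT hx) (fun x hx => star_mem_coordSpace hx)
    (sigmaForm_coordSpace hT)).mono (sup_le ?_ ?_)
  · exact fun x hx i hi => hx i fun h => hi (Finset.mem_union_left _ h)
  · exact fun x hx i hi => hx i fun h => hi (Finset.mem_union_right _ h)

section Pieces

variable {J : Module.End ℂ (Fin 6 → ℂ)} {U : Submodule ℂ (Fin 6 → ℂ)}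

/-- Lets a chain be given by an explicit list of vectors: the step relation identifies `v j` with
`(J - z) ^ j` applied to `v 0`, so no powers need computing. -/
lemma isJordanChain_of_seq {z : ℂ} {k : ℕ} {ε : ℂ} (v : ℕ → Fin 6 → ℂ) (hk : 0 < k)
    (hstep : ∀ j < k, J (v j) = z • v j + v (j + 1)) (hv : v k = 0)
    (hp : ∀ j < k, sigmaForm (v 0) (v j) = if j + 1 = k then ε else 0) :
    IsJordanChain sigmaForm J z k ε (v 0) := by
  have h : ∀ j ≤ k, ((J - z • 1) ^ j) (v 0) = v j := by
    intro j
    induction j with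
    | zero => intro _; rfl
    | succ j ih =>
      intro hj
      rw [pow_succ', Module.End.mul_apply, ih (by omega), LinearMap.sub_apply, hstep j (by omega)]
      simp
  exact ⟨hk, by rw [h k le_rfl, hv], fun j hj => by rw [h j hj.le, hp j hj]⟩

lemma hasLabels_pair {z : ℂ} {k : ℕ} {w : Fin 6 → ℂ} (hw : w ∈ U) (hz : 0 < z.im)
    (h : IsJordanChain sigmaForm J z k 1 w) : HasLabels sigmaForm J U [(z, k)] [] :=
  ⟨[((z, k), w)], [], ⟨by simpa using ⟨hw, hz, h⟩, by simp, by simp, by simp, by simp⟩, rfl, rfl⟩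

lemma hasLabels_real {t : ℝ} {k : ℕ} {e : ℤˣ} {w : Fin 6 → ℂ} (hw : w ∈ U) (hs : star w = w)
    (h : IsJordanChain sigmaForm J t k ((e : ℤ) : ℂ) w) :
    HasLabels sigmaForm J U [] [(t, k, e)] :=
  ⟨[], [((t, k, e), w)], ⟨by simp, by simpa using ⟨hw, hs, h⟩, by simp, by simp, by simp⟩, rfl, rfl⟩

lemma hasLabels_real_real {t t' : ℝ} {k k' : ℕ} {e e' : ℤˣ} {w w' : Fin 6 → ℂ} (hw : w ∈ U)
    (hs : star w = w) (h : IsJordanChain sigmaForm J t k ((e : ℤ) : ℂ) w)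
    (hw' : w' ∈ U) (hs' : star w' = w') (h' : IsJordanChain sigmaForm J t' k' ((e' : ℤ) : ℂ) w')
    (ho : IsOrth sigmaForm J w w') :
    HasLabels sigmaForm J U [] [(t, k, e), (t', k', e')] :=
  ⟨[], [((t, k, e), w), ((t', k', e'), w')],
    ⟨by simp, by simpa using ⟨⟨hw, hs, h⟩, hw', hs', h'⟩, by simp, by simpa using ho, by simp⟩,
    rfl, rfl⟩

lemma isOrth_of_seq (hB : RealSelfAdjoint sigmaForm J) {z : ℂ} {k : ℕ} {x : Fin 6 → ℂ}
    (v : ℕ → Fin 6 → ℂ) (hstep : ∀ j < k, J (v j) = z • v j + v (j + 1)) (hv : v k = 0)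
    (hx : ∀ j < k, sigmaForm (v j) x = 0) : IsOrth sigmaForm J (v 0) x := by
  have h : ∀ j ≤ k, ((J - z • 1) ^ j) (v 0) = v j := by
    intro j
    induction j with
    | zero => intro _; rfl
    | succ j ih =>
      intro hj
      rw [pow_succ', Module.End.mul_apply, ih (by omega), LinearMap.sub_apply, hstep j (by omega)]
      simp
  intro p
  rcases Nat.eq_zero_or_pos k with rfl | hk
  · rw [hv]; simp
  let V : Submodule ℂ (Fin 6 → ℂ) :=
    { carrier := {y | ∀ j < k, sigmaForm (v j) y = 0}
      add_mem' := fun ha hb i hi => by rw [map_add, ha i hi, hb i hi, add_zero]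
      zero_mem' := fun i _ => map_zero _
      smul_mem' := fun c y hy i hi => by rw [map_smul, hy i hi, smul_zero] }
  have hV : ∀ y ∈ V, J y ∈ V := fun y hy i hi => by
    rw [← hB.selfAdj, hstep i hi, map_add, map_smul, LinearMap.add_apply, LinearMap.smul_apply,
      hy i hi, smul_zero, zero_add]
    rcases Nat.lt_or_ge (i + 1) k with h1 | h1
    · exact hy _ h1
    · rw [show i + 1 = k by omega, hv]; simp
  exact aeval_mem hV p (x := x) hx 0 hk

end Pieces

end NormalForms

/-! ### The building blocks of the normal forms -/

section NormalForms
section Pieces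

variable {J : Module.End ℂ (Fin 6 → ℂ)} {U : Submodule ℂ (Fin 6 → ℂ)}

lemma ne_rev : ∀ i : Fin 6, i ≠ i.rev := by decide

/-- A square root of `-I / 2`, which normalises the chains of non-real eigenvalues. -/
noncomputable def pairScale : ℂ := (1 - Complex.I) / 2

lemma pairScale_sq : 2 * Complex.I * (pairScale * pairScale) = 1 := by
  unfold pairScale
  linear_combination (-1 + Complex.I / 2) * Complex.I_sq

/-- `stdVec i + I • stdVec i.rev` is an eigenvector for `s + t I`, and its square under `Σ` is `2
I`; this is what `pairScale` normalises. -/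
lemma hasLabels_plane_pair {i : Fin 6} {s t : ℝ} (ht : 0 < t) (hi : stdVec i ∈ U)
    (hi' : stdVec i.rev ∈ U)
    (he : J (stdVec i) = (s : ℂ) • stdVec i - (t : ℂ) • stdVec i.rev)
    (hf : J (stdVec i.rev) = (t : ℂ) • stdVec i + (s : ℂ) • stdVec i.rev) :
    HasLabels sigmaForm J U [(s + t * Complex.I, 1)] [] := by
  have h1 : i ≠ i.rev := ne_rev i
  refine hasLabels_pair (w := pairScale • (stdVec i + Complex.I • stdVec i.rev))
    (U.smul_mem _ (U.add_mem hi (U.smul_mem _ hi'))) (by simpa using ht)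
    (isJordanChain_of_seq (fun j => if j = 0 then pairScale • (stdVec i + Complex.I • stdVec i.rev)
      else 0) one_pos ?_ rfl ?_)
  · intro j hj
    obtain rfl : j = 0 := by omega
    simp only [map_smul, map_add, he, hf, if_true]
    simp only [zero_add, one_ne_zero, if_false]
    match_scalars <;> ring_nf <;> simp
  · intro j hj
    obtain rfl : j = 0 := by omega
    simp only [map_smul, map_add, LinearMap.smul_apply, LinearMap.add_apply, if_true,
      sigmaForm_stdVec, Fin.rev_rev, h1, h1.symm, smul_eq_mul, if_false]
    linear_combination pairScale_sq

lemma hasLabels_plane_jordan {i : Fin 6} {l : ℝ} {ε : ℤˣ} (hi : stdVec i ∈ U)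
    (he : J (stdVec i) = (l : ℂ) • stdVec i + ((ε : ℤ) : ℂ) • stdVec i.rev)
    (hf : J (stdVec i.rev) = (l : ℂ) • stdVec i.rev) :
    HasLabels sigmaForm J U [] [(l, 2, ε)] := by
  have h1 : i ≠ i.rev := ne_rev i
  refine hasLabels_real hi (star_stdVec i)
    (isJordanChain_of_seq (fun j => if j = 0 then stdVec i else if j = 1 then
      ((ε : ℤ) : ℂ) • stdVec i.rev else 0) two_pos ?_ rfl ?_)
  · intro j hj
    interval_cases j
    · simp [he]
    · change J (((ε : ℤ) : ℂ) • stdVec i.rev) = (l : ℂ) • (((ε : ℤ) : ℂ) • stdVec i.rev) + 0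
      rw [map_smul, hf, smul_comm, add_zero]
  · intro j hj
    interval_cases j <;> simp [sigmaForm_stdVec, h1]

/-- The normalising factor of `stdVec i ± stdVec j`. -/
noncomputable def invSqrtTwo : ℂ := ((1 / √2 : ℝ) : ℂ)

lemma invSqrtTwo_mul_self : invSqrtTwo * invSqrtTwo = 1 / 2 := by
  rw [invSqrtTwo, ← Complex.ofReal_mul]
  rw [div_mul_div_comm, one_mul, Real.mul_self_sqrt (by norm_num)]
  simp

lemma star_invSqrtTwo : star invSqrtTwo = invSqrtTwo := Complex.conj_ofReal _

/-- The eigenvectors are the sum and the difference of the two basis vectors, divided by `√2`. Their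
squares are `1` and `-1`, so real eigenvalues of size-one blocks arise here with opposite signs. -/
lemma hasLabels_plane_split (hB : RealSelfAdjoint sigmaForm J) {i : Fin 6} {p q : ℝ}
    (hi : stdVec i ∈ U) (hi' : stdVec i.rev ∈ U)
    (he : J (stdVec i) = (q : ℂ) • stdVec i + (p : ℂ) • stdVec i.rev)
    (hf : J (stdVec i.rev) = (p : ℂ) • stdVec i + (q : ℂ) • stdVec i.rev) :
    HasLabels sigmaForm J U [] [(q + p, 1, 1), (q - p, 1, -1)] := by
  have h1 : i ≠ i.rev := ne_rev i
  have hc : ∀ (r : ℝ) (e : ℂ) (w : Fin 6 → ℂ), J w = (r : ℂ) • w → sigmaForm w w = e →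
      IsJordanChain sigmaForm J (r : ℂ) 1 e w := by
    intro r e w hw hp
    refine isJordanChain_of_seq (fun j => if j = 0 then w else 0) one_pos ?_ rfl ?_
    · intro j hj
      obtain rfl : j = 0 := by omega
      simp [hw]
    · intro j hj
      obtain rfl : j = 0 := by omega
      simp [hp]
  have hu : J (invSqrtTwo • (stdVec i + stdVec i.rev)) =
      ((q + p : ℝ) : ℂ) • (invSqrtTwo • (stdVec i + stdVec i.rev)) := by
    simp only [map_smul, map_add, he, hf]
    push_cast; module
  have hv : J (invSqrtTwo • (stdVec i - stdVec i.rev)) =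
      ((q - p : ℝ) : ℂ) • (invSqrtTwo • (stdVec i - stdVec i.rev)) := by
    simp only [map_smul, map_sub, he, hf]
    push_cast; module
  refine hasLabels_real_real (w := invSqrtTwo • (stdVec i + stdVec i.rev))
    (w' := invSqrtTwo • (stdVec i - stdVec i.rev)) (U.smul_mem _ (U.add_mem hi hi')) ?_
    (hc _ _ _ hu ?_) (U.smul_mem _ (U.sub_mem hi hi')) ?_ (hc _ _ _ hv ?_) ?_
  · rw [star_smul, star_add, star_stdVec, star_stdVec, star_invSqrtTwo]
  · simp only [map_smul, map_add, LinearMap.smul_apply, LinearMap.add_apply,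
      sigmaForm_stdVec, Fin.rev_rev, h1, h1.symm, smul_eq_mul, if_false, if_true]
    push_cast
    linear_combination 2 * invSqrtTwo_mul_self
  · rw [star_smul, star_sub, star_stdVec, star_stdVec, star_invSqrtTwo]
  · simp only [map_smul, map_sub, LinearMap.smul_apply, LinearMap.sub_apply,
      sigmaForm_stdVec, Fin.rev_rev, h1, h1.symm, smul_eq_mul, if_false, if_true]
    push_cast
    linear_combination -2 * invSqrtTwo_mul_self
  · refine isOrth_of_seq hB (z := ((q + p : ℝ) : ℂ)) (k := 1) (fun j => if j = 0 then
      invSqrtTwo • (stdVec i + stdVec i.rev) else 0) ?_ rfl ?_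
    · intro j hj
      obtain rfl : j = 0 := by omega
      simpa using hu
    · intro j hj
      obtain rfl : j = 0 := by omega
      simp [sigmaForm_stdVec, h1, h1.symm]

lemma unit_mul_self_complex (ε : ℤˣ) : ((ε : ℤ) : ℂ) * ((ε : ℤ) : ℂ) = 1 := by
  rcases Int.units_eq_one_or ε with rfl | rfl <;> simp

/-- Two planes that rotate alike, the second mapped to the first: the chain runs from `stdVec 4 + I
• stdVec 5` to `stdVec 0 + I • stdVec 1`. The next lemma prolongs it by a third plane. -/
lemma hasLabels_quad_pair {s t : ℝ} (ht : 0 < t) (h4 : stdVec 4 ∈ U) (h5 : stdVec 5 ∈ U)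
    (e0 : J (stdVec 0) = (s : ℂ) • stdVec 0 - (t : ℂ) • stdVec 1)
    (e1 : J (stdVec 1) = (t : ℂ) • stdVec 0 + (s : ℂ) • stdVec 1)
    (e4 : J (stdVec 4) = (s : ℂ) • stdVec 4 - (t : ℂ) • stdVec 5 + stdVec 0)
    (e5 : J (stdVec 5) = (t : ℂ) • stdVec 4 + (s : ℂ) • stdVec 5 + stdVec 1) :
    HasLabels sigmaForm J U [(s + t * Complex.I, 2)] [] := by
  refine hasLabels_pair (w := pairScale • (stdVec 4 + Complex.I • stdVec 5))
    (U.smul_mem _ (U.add_mem h4 (U.smul_mem _ h5))) (by simpa using ht)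
    (isJordanChain_of_seq (fun j => if j = 0 then pairScale • (stdVec 4 + Complex.I • stdVec 5)
      else if j = 1 then pairScale • (stdVec 0 + Complex.I • stdVec 1) else 0) two_pos ?_ rfl ?_)
  · intro j hj
    interval_cases j <;> simp only [map_smul, map_add, e0, e1, e4, e5, if_true, zero_add,
      one_ne_zero, if_false, Nat.reduceAdd, OfNat.ofNat_ne_zero, OfNat.ofNat_ne_one]
    all_goals match_scalars <;> ring_nf <;> simp
  · intro j hj
    interval_cases j <;> simp [sigmaForm_stdVec]
    linear_combination pairScale_sq

lemma hasLabels_hex_pair {s t : ℝ} (ht : 0 < t) (h4 : stdVec 4 ∈ U) (h5 : stdVec 5 ∈ U)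
    (e0 : J (stdVec 0) = (s : ℂ) • stdVec 0 - (t : ℂ) • stdVec 1)
    (e1 : J (stdVec 1) = (t : ℂ) • stdVec 0 + (s : ℂ) • stdVec 1)
    (e2 : J (stdVec 2) = (s : ℂ) • stdVec 2 - (t : ℂ) • stdVec 3 + stdVec 0)
    (e3 : J (stdVec 3) = (t : ℂ) • stdVec 2 + (s : ℂ) • stdVec 3 + stdVec 1)
    (e4 : J (stdVec 4) = (s : ℂ) • stdVec 4 - (t : ℂ) • stdVec 5 + stdVec 2)
    (e5 : J (stdVec 5) = (t : ℂ) • stdVec 4 + (s : ℂ) • stdVec 5 + stdVec 3) :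
    HasLabels sigmaForm J U [(s + t * Complex.I, 3)] [] := by
  refine hasLabels_pair (w := pairScale • (stdVec 4 + Complex.I • stdVec 5))
    (U.smul_mem _ (U.add_mem h4 (U.smul_mem _ h5))) (by simpa using ht)
    (isJordanChain_of_seq (fun j => if j = 0 then pairScale • (stdVec 4 + Complex.I • stdVec 5)
      else if j = 1 then pairScale • (stdVec 2 + Complex.I • stdVec 3)
      else if j = 2 then pairScale • (stdVec 0 + Complex.I • stdVec 1) else 0) three_pos ?_ rfl ?_)
  · intro j hj
    interval_cases j <;> simp only [map_smul, map_add, e0, e1, e2, e3, e4, e5, if_true, zero_add,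
      one_ne_zero, if_false, Nat.reduceAdd, OfNat.ofNat_ne_zero, OfNat.ofNat_ne_one,
      Nat.reduceEqDiff]
    all_goals match_scalars <;> ring_nf <;> simp
  · intro j hj
    interval_cases j <;> simp [sigmaForm_stdVec]
    linear_combination pairScale_sq

/-- The chain starts at `stdVec 5` and descends through the basis; it picks up `ε` when passing from
`stdVec 3` to `stdVec 2` and keeps it, so the top pairing is `ε`. -/
lemma hasLabels_six {l : ℝ} {ε : ℤˣ} (h5 : stdVec 5 ∈ U)
    (e0 : J (stdVec 0) = (l : ℂ) • stdVec 0)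
    (e1 : J (stdVec 1) = (l : ℂ) • stdVec 1 + stdVec 0)
    (e2 : J (stdVec 2) = (l : ℂ) • stdVec 2 + stdVec 1)
    (e3 : J (stdVec 3) = (l : ℂ) • stdVec 3 + ((ε : ℤ) : ℂ) • stdVec 2)
    (e4 : J (stdVec 4) = (l : ℂ) • stdVec 4 + stdVec 3)
    (e5 : J (stdVec 5) = (l : ℂ) • stdVec 5 + stdVec 4) :
    HasLabels sigmaForm J U [] [(l, 6, ε)] := by
  refine hasLabels_real h5 (star_stdVec 5)
    (isJordanChain_of_seq (fun j => if j = 0 then stdVec 5 else if j = 1 then stdVec 4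
      else if j = 2 then stdVec 3 else if j = 3 then ((ε : ℤ) : ℂ) • stdVec 2
      else if j = 4 then ((ε : ℤ) : ℂ) • stdVec 1
      else if j = 5 then ((ε : ℤ) : ℂ) • stdVec 0 else 0) (by norm_num) ?_ rfl ?_)
  · intro j hj
    interval_cases j <;> simp only [map_smul, map_add, e0, e1, e2, e3, e4, e5, if_true, zero_add,
      one_ne_zero, if_false, Nat.reduceAdd, OfNat.ofNat_ne_zero, OfNat.ofNat_ne_one,
      Nat.reduceEqDiff]
    all_goals module
  · intro j hj
    interval_cases j <;> simp [sigmaForm_stdVec]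

lemma hasLabels_four {l : ℝ} {ε : ℤˣ} (h5 : stdVec 5 ∈ U)
    (e0 : J (stdVec 0) = (l : ℂ) • stdVec 0)
    (e1 : J (stdVec 1) = (l : ℂ) • stdVec 1 + stdVec 0)
    (e4 : J (stdVec 4) = (l : ℂ) • stdVec 4 + ((ε : ℤ) : ℂ) • stdVec 1)
    (e5 : J (stdVec 5) = (l : ℂ) • stdVec 5 + stdVec 4) :
    HasLabels sigmaForm J U [] [(l, 4, ε)] := by
  refine hasLabels_real h5 (star_stdVec 5)
    (isJordanChain_of_seq (fun j => if j = 0 then stdVec 5 else if j = 1 then stdVec 4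
      else if j = 2 then ((ε : ℤ) : ℂ) • stdVec 1
      else if j = 3 then ((ε : ℤ) : ℂ) • stdVec 0 else 0) (by norm_num) ?_ rfl ?_)
  · intro j hj
    interval_cases j <;> simp only [map_smul, map_add, e0, e1, e4, e5, if_true, zero_add,
      one_ne_zero, if_false, Nat.reduceAdd, OfNat.ofNat_ne_zero, OfNat.ofNat_ne_one,
      Nat.reduceEqDiff]
    all_goals module
  · intro j hj
    interval_cases j <;> simp [sigmaForm_stdVec]

/-- In the plane of `j` and `j.rev` the vectors `stdVec j ± ε • stdVec j.rev` have squares of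
opposite sign. With the sign `+` it is the middle of the chain of length 3 from `stdVec i` to `ε •
stdVec i.rev`; with `-` it is the remaining eigenvector, which therefore has sign `-ε`. The two
choices of `(i, j)` serve XXI, XXII and XXIII. -/
lemma hasLabels_three_one (hB : RealSelfAdjoint sigmaForm J) {l m : ℝ} {ε : ℤˣ} {i j : Fin 6}
    (hij : i = 1 ∧ j = 2 ∨ i = 2 ∧ j = 1)
    (hi : stdVec i ∈ U) (hj : stdVec j ∈ U) (hj' : stdVec j.rev ∈ U)
    (ei : J (stdVec i) = (l : ℂ) • stdVec i + invSqrtTwo • stdVec j +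
      (((ε : ℤ) : ℂ) * invSqrtTwo) • stdVec j.rev)
    (ei' : J (stdVec i.rev) = (l : ℂ) • stdVec i.rev)
    (ej : J (stdVec j) = ((l + m) / 2 : ℂ) • stdVec j +
      (((ε : ℤ) : ℂ) / 2 * (l - m)) • stdVec j.rev + (((ε : ℤ) : ℂ) * invSqrtTwo) • stdVec i.rev)
    (ej' : J (stdVec j.rev) = ((l + m) / 2 : ℂ) • stdVec j.rev +
      (((ε : ℤ) : ℂ) / 2 * (l - m)) • stdVec j + invSqrtTwo • stdVec i.rev) :
    HasLabels sigmaForm J U [] [(l, 3, ε), (m, 1, -ε)] := by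
  have he := unit_mul_self_complex ε
  set e : ℂ := ((ε : ℤ) : ℂ) with hed
  have hse : star e = e := by simp [hed]
  have hstep : ∀ k < 3, J (if k = 0 then stdVec i else if k = 1 then
      invSqrtTwo • (stdVec j + e • stdVec j.rev) else if k = 2 then e • stdVec i.rev else 0) =
      (l : ℂ) • (if k = 0 then stdVec i else if k = 1 then
      invSqrtTwo • (stdVec j + e • stdVec j.rev) else if k = 2 then e • stdVec i.rev else 0) +
      (if k + 1 = 0 then stdVec i else if k + 1 = 1 then
      invSqrtTwo • (stdVec j + e • stdVec j.rev) else if k + 1 = 2 then e • stdVec i.rev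
        else 0) := by
    intro k hk
    interval_cases k <;> simp only [map_smul, map_add, ei, ei', ej, ej', if_true, zero_add,
      one_ne_zero, if_false, Nat.reduceAdd, OfNat.ofNat_ne_zero, OfNat.ofNat_ne_one,
      Nat.reduceEqDiff]
    · module
    · match_scalars
      · linear_combination invSqrtTwo * (l - m) / 2 * he
      · ring
      · linear_combination 2 * e * invSqrtTwo_mul_self
    · module
  refine hasLabels_real_real (w := stdVec i) (w' := invSqrtTwo • (stdVec j - e • stdVec j.rev))
    hi (star_stdVec i) ?_ (U.smul_mem _ (U.sub_mem hj (U.smul_mem _ hj'))) ?_ ?_ ?_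
  · refine isJordanChain_of_seq (fun k => if k = 0 then stdVec i else if k = 1 then
      invSqrtTwo • (stdVec j + e • stdVec j.rev) else if k = 2 then e • stdVec i.rev else 0)
      three_pos hstep rfl ?_
    intro k hk
    rcases hij with ⟨rfl, rfl⟩ | ⟨rfl, rfl⟩ <;> interval_cases k <;> simp [sigmaForm_stdVec, hed]
  · rw [star_smul, star_sub, star_smul, star_stdVec, star_stdVec, star_invSqrtTwo, hse]
  · refine isJordanChain_of_seq (fun k => if k = 0 then
      invSqrtTwo • (stdVec j - e • stdVec j.rev) else 0) one_pos ?_ rfl ?_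
    · intro k hk
      obtain rfl : k = 0 := by omega
      simp only [map_smul, map_sub, ej, ej', if_true, zero_add, one_ne_zero, if_false]
      match_scalars
      · linear_combination -invSqrtTwo * (l - m) / 2 * he
      · ring
      · ring
    · intro k hk
      obtain rfl : k = 0 := by omega
      rcases hij with ⟨rfl, rfl⟩ | ⟨rfl, rfl⟩ <;> simp [sigmaForm_stdVec] <;>
        linear_combination -2 * e * invSqrtTwo_mul_self
  · refine isOrth_of_seq hB (z := (l : ℂ)) (k := 3) (fun k => if k = 0 then stdVec i else if k = 1
      then invSqrtTwo • (stdVec j + e • stdVec j.rev) else if k = 2 then e • stdVec i.rev else 0)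
      hstep rfl ?_
    intro k hk
    rcases hij with ⟨rfl, rfl⟩ | ⟨rfl, rfl⟩ <;> interval_cases k <;> simp [sigmaForm_stdVec]

/-- The pattern of 3 + 1, with the long chain prolonged at both ends: `stdVec 5`, `stdVec 4`, a
multiple of `stdVec 2 + ε • stdVec 3`, then multiples of `stdVec 1` and `stdVec 0`. -/
lemma hasLabels_five_one (hB : RealSelfAdjoint sigmaForm J) {l m : ℝ} {ε : ℤˣ}
    (hU : ∀ i, stdVec i ∈ U)
    (e0 : J (stdVec 0) = (l : ℂ) • stdVec 0)
    (e1 : J (stdVec 1) = (l : ℂ) • stdVec 1 + stdVec 0)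
    (e2 : J (stdVec 2) = ((l + m) / 2 : ℂ) • stdVec 2 +
      (((ε : ℤ) : ℂ) / 2 * (l - m)) • stdVec 3 + invSqrtTwo • stdVec 1)
    (e3 : J (stdVec 3) = ((l + m) / 2 : ℂ) • stdVec 3 +
      (((ε : ℤ) : ℂ) / 2 * (l - m)) • stdVec 2 + (((ε : ℤ) : ℂ) * invSqrtTwo) • stdVec 1)
    (e4 : J (stdVec 4) = (l : ℂ) • stdVec 4 + invSqrtTwo • stdVec 3 +
      (((ε : ℤ) : ℂ) * invSqrtTwo) • stdVec 2)
    (e5 : J (stdVec 5) = (l : ℂ) • stdVec 5 + stdVec 4) :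
    HasLabels sigmaForm J U [] [(l, 5, ε), (m, 1, -ε)] := by
  have he := unit_mul_self_complex ε
  set e : ℂ := ((ε : ℤ) : ℂ) with hed
  have hse : star e = e := by simp [hed]
  let v : ℕ → Fin 6 → ℂ := fun k => if k = 0 then stdVec 5 else if k = 1 then stdVec 4 else
    if k = 2 then (e * invSqrtTwo) • (stdVec 2 + e • stdVec 3) else if k = 3 then e • stdVec 1 else
    if k = 4 then e • stdVec 0 else 0
  have hstep : ∀ k < 5, J (v k) = (l : ℂ) • v k + v (k + 1) := by
    intro k hk
    interval_cases k <;> simp only [v, map_smul, map_add, e0, e1, e2, e3, e4, e5, if_true, zero_add,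
      one_ne_zero, if_false, Nat.reduceAdd, OfNat.ofNat_ne_zero, OfNat.ofNat_ne_one,
      Nat.reduceEqDiff]
    · match_scalars
      · ring
      · linear_combination -invSqrtTwo * he
      · ring
    · match_scalars
      · linear_combination e * invSqrtTwo * (l - m) / 2 * he
      · ring
      · linear_combination e * (1 + e * e) * invSqrtTwo_mul_self + e / 2 * he
    · module
    · module
  refine hasLabels_real_real (w := stdVec 5) (w' := invSqrtTwo • (stdVec 2 - e • stdVec 3))
    (hU 5) (star_stdVec 5) (isJordanChain_of_seq v (by norm_num) hstep rfl ?_)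
    (U.smul_mem _ (U.sub_mem (hU 2) (U.smul_mem _ (hU 3)))) ?_ ?_
    (isOrth_of_seq hB v hstep rfl ?_)
  · intro k hk
    interval_cases k <;> simp [v, sigmaForm_stdVec, hed]
  · rw [star_smul, star_sub, star_smul, star_stdVec, star_stdVec, star_invSqrtTwo, hse]
  · refine isJordanChain_of_seq (fun k => if k = 0 then
      invSqrtTwo • (stdVec 2 - e • stdVec 3) else 0) one_pos ?_ rfl ?_
    · intro k hk
      obtain rfl : k = 0 := by omega
      simp only [map_smul, map_sub, e2, e3, if_true, zero_add, one_ne_zero, if_false]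
      match_scalars
      · linear_combination -invSqrtTwo * (l - m) / 2 * he
      · ring
      · linear_combination -invSqrtTwo * invSqrtTwo * he
    · intro k hk
      obtain rfl : k = 0 := by omega
      simp [sigmaForm_stdVec]
      linear_combination -2 * e * invSqrtTwo_mul_self
  · intro k hk
    interval_cases k <;> simp [v, sigmaForm_stdVec]

/-- The chains start at `stdVec 5` and `stdVec 3`. Their middle vectors are the normalised sum and
difference of `stdVec 1` and `stdVec 4`, whose squares `1` and `-1` are the two signs. -/
lemma hasLabels_three_three (hB : RealSelfAdjoint sigmaForm J) {l m : ℝ}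
    (hU : ∀ i, stdVec i ∈ U)
    (e0 : J (stdVec 0) = (l : ℂ) • stdVec 0)
    (e1 : J (stdVec 1) = ((l + m) / 2 : ℂ) • stdVec 1 + ((l - m) / 2 : ℂ) • stdVec 4 +
      invSqrtTwo • stdVec 0 - invSqrtTwo • stdVec 2)
    (e2 : J (stdVec 2) = (m : ℂ) • stdVec 2)
    (e3 : J (stdVec 3) = (m : ℂ) • stdVec 3 + invSqrtTwo • stdVec 1 - invSqrtTwo • stdVec 4)
    (e4 : J (stdVec 4) = ((l + m) / 2 : ℂ) • stdVec 4 + ((l - m) / 2 : ℂ) • stdVec 1 +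
      invSqrtTwo • stdVec 0 + invSqrtTwo • stdVec 2)
    (e5 : J (stdVec 5) = (l : ℂ) • stdVec 5 + invSqrtTwo • stdVec 1 + invSqrtTwo • stdVec 4) :
    HasLabels sigmaForm J U [] [(l, 3, 1), (m, 3, -1)] := by
  let v : ℕ → Fin 6 → ℂ := fun k => if k = 0 then stdVec 5 else
    if k = 1 then invSqrtTwo • (stdVec 1 + stdVec 4) else if k = 2 then stdVec 0 else 0
  let w : ℕ → Fin 6 → ℂ := fun k => if k = 0 then stdVec 3 else
    if k = 1 then invSqrtTwo • (stdVec 1 - stdVec 4) else if k = 2 then - stdVec 2 else 0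
  have hstep : ∀ k < 3, J (v k) = (l : ℂ) • v k + v (k + 1) := by
    intro k hk
    interval_cases k <;> simp only [v, map_smul, map_add, map_neg, e0, e1, e2, e3, e4, e5, if_true,
      zero_add, one_ne_zero, if_false, Nat.reduceAdd, OfNat.ofNat_ne_zero, OfNat.ofNat_ne_one,
      Nat.reduceEqDiff]
    · module
    · match_scalars
      · ring
      · ring
      · linear_combination 2 * invSqrtTwo_mul_self
      · ring
    · module
  have hstep' : ∀ k < 3, J (w k) = (m : ℂ) • w k + w (k + 1) := by
    intro k hk
    interval_cases k <;> simp only [w, map_smul, map_sub, map_neg, e0, e1, e2, e3, e4, e5, if_true,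
      zero_add, one_ne_zero, if_false, Nat.reduceAdd, OfNat.ofNat_ne_zero, OfNat.ofNat_ne_one,
      Nat.reduceEqDiff]
    · module
    · match_scalars
      · ring
      · ring
      · ring
      · linear_combination -2 * invSqrtTwo_mul_self
    · module
  refine hasLabels_real_real (w := stdVec 5) (w' := stdVec 3)
    (hU 5) (star_stdVec 5) (isJordanChain_of_seq v (by norm_num) hstep rfl ?_)
    (hU 3) (star_stdVec 3) (isJordanChain_of_seq w (by norm_num) hstep' rfl ?_)
    (isOrth_of_seq hB v hstep rfl ?_)
  · intro k hk
    interval_cases k <;> simp [v, sigmaForm_stdVec]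
  · intro k hk
    interval_cases k <;> simp [w, sigmaForm_stdVec]
  · intro k hk
    interval_cases k <;> simp [v, sigmaForm_stdVec]

end Pieces
end NormalForms

/-! ### Shapes and eigenvalues of the normal forms, and the count of families -/

namespace Metaclass

instance : Fintype Metaclass where
  elems := {I, II, III, IV, V, VI, VII, VIII, IX, X, XI, XII, XIII, XIV, XV, XVI, XVII, XVIII,
    XIX, XX, XXI, XXII, XXIII}
  complete := by intro m; cases m <;> decide

instance : (m : Metaclass) → DecidablePred m.SignsSorted
  | XIII => fun (ε : Fin 3 → ℤˣ) =>
    inferInstanceAs (Decidable ((ε 0 = -1 → ε 1 = -1) ∧ (ε 1 = -1 → ε 2 = -1)))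
  | XIV => fun (ε : Fin 2 → ℤˣ) => inferInstanceAs (Decidable (ε 0 = -1 → ε 1 = -1))
  | XV => fun (ε : Fin 2 → ℤˣ) => inferInstanceAs (Decidable (ε 0 = -1 → ε 1 = -1))
  | I | II | III | IV | V | VI | VII | VIII | IX | X | XI | XII | XVI | XVII | XVIII | XIX | XX
  | XXI | XXII | XXIII => fun _ => instDecidableTrue

/-- The sizes of the Jordan blocks of the normal form with the eigenvalues `σ i ± τ i I`. -/
def pairSize : (m : Metaclass) → Fin m.numPairs → ℕ
  | I => ![1, 1, 1] | II => ![2, 1] | III => ![3] | IV => ![1, 1] | V => ![2] | VI => ![1]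
  | X => ![1] | XII => ![2] | XIV => ![1] | XVI => ![1, 1] | XVII => ![1] | XXII => ![1]
  | VII | VIII | IX | XI | XIII | XV | XVIII | XIX | XX | XXI | XXIII => ![]

/-- The sizes and signs of the real Jordan blocks of the normal form. -/
def realShape : (m : Metaclass) → (Fin m.numSigns → ℤˣ) → Fin m.numReals → ℕ × ℤˣ
  | I | II | III => fun _ => ![]
  | IV | V => fun _ => ![(1, 1), (1, -1)]
  | VI => fun _ => ![(1, 1), (1, -1), (1, 1), (1, -1)]
  | VII => fun _ => ![(1, 1), (1, -1), (1, 1), (1, -1), (1, 1), (1, -1)]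
  | VIII => fun (ε : Fin 1 → ℤˣ) => ![(6, ε 0)]
  | IX => fun (ε : Fin 2 → ℤˣ) => ![(4, ε 1), (2, ε 0)]
  | X => fun (ε : Fin 1 → ℤˣ) => ![(4, ε 0)]
  | XI => fun (ε : Fin 1 → ℤˣ) => ![(4, ε 0), (1, 1), (1, -1)]
  | XII => fun (ε : Fin 1 → ℤˣ) => ![(2, ε 0)]
  | XIII => fun (ε : Fin 3 → ℤˣ) => ![(2, ε 0), (2, ε 1), (2, ε 2)]
  | XIV => fun (ε : Fin 2 → ℤˣ) => ![(2, ε 0), (2, ε 1)]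
  | XV => fun (ε : Fin 2 → ℤˣ) => ![(2, ε 0), (2, ε 1), (1, 1), (1, -1)]
  | XVI => fun (ε : Fin 1 → ℤˣ) => ![(2, ε 0)]
  | XVII => fun (ε : Fin 1 → ℤˣ) => ![(2, ε 0), (1, 1), (1, -1)]
  | XVIII => fun (ε : Fin 1 → ℤˣ) => ![(2, ε 0), (1, 1), (1, -1), (1, 1), (1, -1)]
  | XIX => fun (ε : Fin 1 → ℤˣ) => ![(5, ε 0), (1, -ε 0)]
  | XX => fun _ => ![(3, 1), (3, -1)]
  | XXI => fun (ε : Fin 2 → ℤˣ) => ![(2, ε 1), (3, ε 0), (1, -ε 0)]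
  | XXII => fun (ε : Fin 1 → ℤˣ) => ![(3, ε 0), (1, -ε 0)]
  | XXIII => fun (ε : Fin 1 → ℤˣ) => ![(3, ε 0), (1, -ε 0), (1, 1), (1, -1)]

/-- The real eigenvalues of the normal form. -/
def realEigenvalue : (m : Metaclass) → (Fin m.numReals → ℝ) → Fin m.numReals → ℝ
  | I | II | III => fun _ => ![]
  | IV | V => fun (l : Fin 2 → ℝ) => ![l 1 + l 0, l 1 - l 0]
  | VI => fun (l : Fin 4 → ℝ) => ![l 1 + l 0, l 1 - l 0, l 3 + l 2, l 3 - l 2]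
  | VII => fun (l : Fin 6 → ℝ) =>
    ![l 1 + l 0, l 1 - l 0, l 3 + l 2, l 3 - l 2, l 5 + l 4, l 5 - l 4]
  | VIII | X | XII | XVI => fun (l : Fin 1 → ℝ) => ![l 0]
  | IX | XIV | XIX | XX | XXII => fun (l : Fin 2 → ℝ) => ![l 0, l 1]
  | XI => fun (l : Fin 3 → ℝ) => ![l 0, l 1 + l 2, l 1 - l 2]
  | XIII => fun (l : Fin 3 → ℝ) => ![l 0, l 1, l 2]
  | XV => fun (l : Fin 4 → ℝ) => ![l 0, l 1, l 3 + l 2, l 3 - l 2]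
  | XVII => fun (l : Fin 3 → ℝ) => ![l 0, l 2 + l 1, l 2 - l 1]
  | XVIII => fun (l : Fin 5 → ℝ) => ![l 0, l 4 + l 3, l 4 - l 3, l 2 + l 1, l 2 - l 1]
  | XXI => fun (l : Fin 3 → ℝ) => ![l 1, l 0, l 2]
  | XXIII => fun (l : Fin 4 → ℝ) => ![l 0, l 1, l 3 + l 2, l 3 - l 2]

/-- The scalars `λ` of the normal form with given real eigenvalues. -/
noncomputable def scalarsOfEigenvalue : (m : Metaclass) → (Fin m.numReals → ℝ) → Fin m.numReals → ℝ
  | I | II | III => fun _ => ![]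
  | IV | V => fun (x : Fin 2 → ℝ) => ![(x 0 - x 1) / 2, (x 0 + x 1) / 2]
  | VI => fun (x : Fin 4 → ℝ) =>
    ![(x 0 - x 1) / 2, (x 0 + x 1) / 2, (x 2 - x 3) / 2, (x 2 + x 3) / 2]
  | VII => fun (x : Fin 6 → ℝ) =>
    ![(x 0 - x 1) / 2, (x 0 + x 1) / 2, (x 2 - x 3) / 2, (x 2 + x 3) / 2,
      (x 4 - x 5) / 2, (x 4 + x 5) / 2]
  | VIII | X | XII | XVI => fun (x : Fin 1 → ℝ) => ![x 0]
  | IX | XIV | XIX | XX | XXII => fun (x : Fin 2 → ℝ) => ![x 0, x 1]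
  | XI => fun (x : Fin 3 → ℝ) => ![x 0, (x 1 + x 2) / 2, (x 1 - x 2) / 2]
  | XIII => fun (x : Fin 3 → ℝ) => ![x 0, x 1, x 2]
  | XV => fun (x : Fin 4 → ℝ) => ![x 0, x 1, (x 2 - x 3) / 2, (x 2 + x 3) / 2]
  | XVII => fun (x : Fin 3 → ℝ) => ![x 0, (x 1 - x 2) / 2, (x 1 + x 2) / 2]
  | XVIII => fun (x : Fin 5 → ℝ) =>
    ![x 0, (x 3 - x 4) / 2, (x 3 + x 4) / 2, (x 1 - x 2) / 2, (x 1 + x 2) / 2]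
  | XXI => fun (x : Fin 3 → ℝ) => ![x 1, x 0, x 2]
  | XXIII => fun (x : Fin 4 → ℝ) => ![x 0, x 1, (x 2 - x 3) / 2, (x 2 + x 3) / 2]

lemma realEigenvalue_scalarsOfEigenvalue (m : Metaclass) : ∀ x : Fin m.numReals → ℝ,
    m.realEigenvalue (m.scalarsOfEigenvalue x) = x := by
  cases m
  case I | II | III => exact fun x => funext fun i => i.elim0
  case VIII | X | XII | XVI =>
    intro (x : Fin 1 → ℝ); refine funext fun (i : Fin 1) => ?_
    fin_cases i; simp [realEigenvalue, scalarsOfEigenvalue]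
  case IV | V | IX | XIV | XIX | XX | XXII =>
    intro (x : Fin 2 → ℝ); refine funext fun (i : Fin 2) => ?_
    fin_cases i <;> simp [realEigenvalue, scalarsOfEigenvalue] <;> ring
  case XI | XIII | XVII | XXI =>
    intro (x : Fin 3 → ℝ); refine funext fun (i : Fin 3) => ?_
    fin_cases i <;> simp [realEigenvalue, scalarsOfEigenvalue] <;> ring
  case VI | XV | XXIII =>
    intro (x : Fin 4 → ℝ); refine funext fun (i : Fin 4) => ?_
    fin_cases i <;> simp [realEigenvalue, scalarsOfEigenvalue] <;> ring
  case XVIII =>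
    intro (x : Fin 5 → ℝ); refine funext fun (i : Fin 5) => ?_
    fin_cases i <;> simp [realEigenvalue, scalarsOfEigenvalue] <;> ring
  case VII =>
    intro (x : Fin 6 → ℝ); refine funext fun (i : Fin 6) => ?_
    fin_cases i <;> simp [realEigenvalue, scalarsOfEigenvalue] <;> ring

lemma realEigenvalue_smul (m : Metaclass) (t : ℝ) : ∀ (l : Fin m.numReals → ℝ) (i : Fin m.numReals),
    m.realEigenvalue (fun j => t * l j) i = t * m.realEigenvalue l i := by
  cases m
  case I | II | III => exact fun _ i => i.elim0
  case VIII | X | XII | XVI =>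
    intro (x : Fin 1 → ℝ) (i : Fin 1)
    fin_cases i; simp [realEigenvalue]
  case IV | V | IX | XIV | XIX | XX | XXII =>
    intro (x : Fin 2 → ℝ) (i : Fin 2)
    fin_cases i <;> simp [realEigenvalue] <;> ring
  case XI | XIII | XVII | XXI =>
    intro (x : Fin 3 → ℝ) (i : Fin 3)
    fin_cases i <;> simp [realEigenvalue] <;> ring
  case VI | XV | XXIII =>
    intro (x : Fin 4 → ℝ) (i : Fin 4)
    fin_cases i <;> simp [realEigenvalue] <;> ring
  case XVIII =>
    intro (x : Fin 5 → ℝ) (i : Fin 5)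
    fin_cases i <;> simp [realEigenvalue] <;> ring
  case VII =>
    intro (x : Fin 6 → ℝ) (i : Fin 6)
    fin_cases i <;> simp [realEigenvalue] <;> ring

/-- The labels of the non-real Jordan blocks of the normal form. -/
noncomputable def pairLabels (m : Metaclass) (σ τ : Fin m.numPairs → ℝ) : List (ℂ × ℕ) :=
  List.ofFn fun i => ((σ i + τ i * Complex.I : ℂ), m.pairSize i)

/-- The labels of the real Jordan blocks of the normal form. -/
noncomputable def realLabels (m : Metaclass) (ε : Fin m.numSigns → ℤˣ)
    (l : Fin m.numReals → ℝ) : List (ℝ × ℕ × ℤˣ) :=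
  List.ofFn fun i => (m.realEigenvalue l i, m.realShape ε i)

lemma coe_ofFn_pairSize (m : Metaclass) : (List.ofFn m.pairSize : Multiset ℕ) = m.segre.pairs := by
  cases m <;> rfl

lemma coe_ofFn_realShape (m : Metaclass) (ε : Fin m.numSigns → ℤˣ) :
    ((List.ofFn (m.realShape ε)).map Prod.fst : Multiset ℕ) = m.segre.reals := by
  cases m
  case XXI => exact (by decide : ((([2, 3, 1] : List ℕ) : Multiset ℕ)) = {3, 2, 1})
  all_goals rfl

lemma segre_injective : Function.Injective segre := by
  intro m m'
  revert m m'
  decide +kernel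

lemma card_eq : Nat.card Metaclass = 23 := by
  rw [Nat.card_eq_fintype_card]; rfl

end Metaclass

namespace NormalFamily

lemma card_eq : Nat.card NormalFamily = 46 := by
  rw [Nat.card_eq_fintype_card]
  decide +kernel

/-- A finite check over pairs of families. In XIII, XIV and XV it relies on the sorting of the
signs, without which permuted signs would give equal shapes. -/
lemma eq_of_perm : ∀ f f' : NormalFamily,
    (List.ofFn f.1.1.pairSize).Perm (List.ofFn f'.1.1.pairSize) →
    (List.ofFn (f.1.1.realShape f.1.2)).Perm (List.ofFn (f'.1.1.realShape f'.1.2)) → f = f' := by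
  decide +kernel

end NormalFamily

/-! ### Enumeration of the shapes allowed by the signature -/

section Shapes

/-- All lists of elements of the list with total weight `n`, up to order. -/
def weightedLists {α : Type*} (wt : α → ℕ) : List α → ℕ → List (List α)
  | [], n => if n = 0 then [[]] else []
  | a :: as, n => (List.range (n + 1)).flatMap fun c =>
      if c * wt a ≤ n then (weightedLists wt as (n - c * wt a)).map (List.replicate c a ++ ·) else []

/-- Up to order a list consists of the copies of the first candidate followed by a list in the other
candidates, which is how the enumeration recurses. Positive weights bound the number of copies by
`n`. -/
lemma exists_perm_mem_weightedLists {α : Type*} [DecidableEq α] (wt : α → ℕ) (as : List α) :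
    ∀ (n : ℕ) (l : List α), (∀ a ∈ l, a ∈ as ∧ 0 < wt a) → (l.map wt).sum = n →
      ∃ l' ∈ weightedLists wt as n, l.Perm l' := by
  induction as with
  | nil =>
    intro n l hl hn
    obtain rfl : l = [] := List.eq_nil_iff_forall_not_mem.2 fun a ha => by simpa using (hl a ha).1
    exact ⟨[], by simp [weightedLists, ← hn], .refl _⟩
  | cons a as ih =>
    intro n l hl hn
    have hp : (l.filter (· = a) ++ l.filter (fun x => !decide (x = a))).Perm l :=
      List.filter_append_perm _ l
    have hr : l.filter (· = a) = List.replicate (l.count a) a := by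
      rw [List.count_eq_length_filter]
      refine List.eq_replicate_iff.2 ⟨by congr 1, fun b hb => by simpa using (List.mem_filter.1 hb).2⟩
    rw [hr] at hp
    have hs : l.count a * wt a + ((l.filter (fun x => !decide (x = a))).map wt).sum = n := by
      rw [← hn, ← (hp.map wt).sum_eq]
      simp
    obtain ⟨l', hl', hpl⟩ := ih (n - l.count a * wt a) (l.filter (fun x => !decide (x = a)))
      (fun b hb => by
        have h1 := List.mem_filter.1 hb
        have h2 := hl b h1.1
        exact ⟨(List.mem_cons.1 h2.1).resolve_left (by simpa using h1.2), h2.2⟩) (by omega)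
    refine ⟨List.replicate (l.count a) a ++ l', ?_, hp.symm.trans (hpl.append_left _)⟩
    rw [weightedLists, List.mem_flatMap]
    have hc : l.count a ≤ n := by
      rcases Nat.eq_zero_or_pos (l.count a) with h | h
      · omega
      · exact (Nat.le_mul_of_pos_right _ (hl a (List.count_pos_iff.1 h)).2).trans
          ((Nat.le_add_right _ _).trans_eq hs)
    refine ⟨l.count a, by simpa using Nat.lt_succ_of_le hc, ?_⟩
    rw [if_pos (by omega), List.mem_map]
    exact ⟨l', hl', rfl⟩

/-- The finite heart of the classification. Here `p` is the total size of the chains in the upper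
half plane; their conjugates double it, which leaves `6 - 2 * p` for the real blocks. -/
lemma exists_family_of_mem : ∀ p ∈ List.range 4,
    ∀ P ∈ weightedLists id [1, 2, 3] p,
    ∀ R ∈ weightedLists Prod.fst ([1, 2, 3, 4, 5, 6].flatMap fun k => [(k, (1 : ℤˣ)), (k, -1)])
      (6 - 2 * p),
    (R.map fun r => if Odd r.1 then (r.2 : ℤ) else 0).sum = 0 →
    ∃ f : NormalFamily, P.Perm (List.ofFn f.1.1.pairSize) ∧
      R.Perm (List.ofFn (f.1.1.realShape f.1.2)) := by
  decide +kernel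

/-- The shapes that the signature of `Σ` allows are those of the normal forms. -/
lemma exists_family (P : List ℕ) (R : List (ℕ × ℤˣ)) (hP : ∀ k ∈ P, 0 < k)
    (hR : ∀ r ∈ R, 0 < r.1) (h6 : 2 * P.sum + (R.map Prod.fst).sum = 6)
    (hb : (R.map fun r => if Odd r.1 then (r.2 : ℤ) else 0).sum = 0) :
    ∃ f : NormalFamily, P.Perm (List.ofFn f.1.1.pairSize) ∧
      R.Perm (List.ofFn (f.1.1.realShape f.1.2)) := by
  obtain ⟨P', hP', hPP⟩ := exists_perm_mem_weightedLists id [1, 2, 3] P.sum P (fun k hk => by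
    have h1 := hP k hk
    have h2 := List.single_le_sum (fun _ _ => Nat.zero_le _) k hk
    have : k = 1 ∨ k = 2 ∨ k = 3 := by omega
    simpa [h1] using this) (by simp)
  obtain ⟨R', hR', hRR⟩ := exists_perm_mem_weightedLists Prod.fst
    ([1, 2, 3, 4, 5, 6].flatMap fun k => [(k, (1 : ℤˣ)), (k, -1)]) (6 - 2 * P.sum) R
    (fun r hr => by
      have h1 := hR r hr
      have h2 := List.single_le_sum (l := R.map Prod.fst) (fun _ _ => Nat.zero_le _) r.1
        (List.mem_map_of_mem hr)
      refine ⟨?_, h1⟩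
      obtain ⟨k, e⟩ := r
      simp only at h1 h2
      have : k ≤ 6 := by omega
      rcases Int.units_eq_one_or e with rfl | rfl <;> interval_cases k <;> decide) (by omega)
  obtain ⟨f, h1, h2⟩ := exists_family_of_mem P.sum (List.mem_range.2 (by omega)) P' hP' R' hR'
    ((hRR.map fun r : ℕ × ℤˣ => if Odd r.1 then (r.2 : ℤ) else 0).sum_eq.symm.trans hb)
  exact ⟨f, hPP.trans h1, hRR.trans h2⟩

end Shapes

/-! ### The chains of the 23 normal forms -/

namespace Metaclass

lemma normalForm_transpose (m : Metaclass) (ε : Fin m.numSigns → ℤˣ)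
    (σ τ : Fin m.numPairs → ℝ) (l : Fin m.numReals → ℝ) :
    (m.normalForm ε σ τ l).transpose = m.normalForm ε σ τ l := by
  ext i j
  cases m <;> fin_cases i <;> fin_cases j <;> rfl

/-- The normal form has the expected eigenvalues, block sizes and signs. -/
theorem hasLabels_normalForm (m : Metaclass) (ε : Fin m.numSigns → ℤˣ) (σ τ : Fin m.numPairs → ℝ)
    (hτ : ∀ i, 0 < τ i) (l : Fin m.numReals → ℝ) :
    HasLabels sigmaForm (complexEnd (sigmaMatrix * m.normalForm ε σ τ l)) ⊤
      (m.pairLabels σ τ) (m.realLabels ε l) := by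
  have hA := normalForm_transpose m ε σ τ l
  have hB := realSelfAdjoint_sigma hA
  -- Each normal form is an orthogonal sum along coordinate subspaces that contain `i.rev` together
  -- with `i`. The summands are listed so that their labels appear in the order of `pairLabels` and
  -- `realLabels`.
  cases m
  case I =>
    have h1 := hasLabels_plane_pair (J := complexEnd (sigmaMatrix * normalForm I ε σ τ l))
      (U := coordSpace {0, 5}) (i := 0) (s := (σ (0 : Fin 3))) (hτ (0 : Fin 3))
      (stdVec_mem (by decide)) (stdVec_mem (by decide))
      (by rw [complexEnd_stdVec]; simp [normalForm]; module)
      (by rw [complexEnd_stdVec]; simp [normalForm])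
    have h2 := hasLabels_plane_pair (J := complexEnd (sigmaMatrix * normalForm I ε σ τ l))
      (U := coordSpace {2, 3}) (i := 2) (s := (σ (1 : Fin 3))) (hτ (1 : Fin 3))
      (stdVec_mem (by decide)) (stdVec_mem (by decide))
      (by rw [complexEnd_stdVec]; simp [normalForm]; module)
      (by rw [complexEnd_stdVec]; simp [normalForm])
    have h3 := hasLabels_plane_pair (J := complexEnd (sigmaMatrix * normalForm I ε σ τ l))
      (U := coordSpace {1, 4}) (i := 1) (s := (σ (2 : Fin 3))) (hτ (2 : Fin 3))
      (stdVec_mem (by decide)) (stdVec_mem (by decide))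
      (by rw [complexEnd_stdVec]; simp [normalForm]; module)
      (by rw [complexEnd_stdVec]; simp [normalForm])
    exact ((h1.append_coord hA (by decide) (by simp [Fin.forall_fin_succ, normalForm]) h2).append_coord hA (by decide) (by simp [Fin.forall_fin_succ, normalForm]) h3).mono le_top
  case II =>
    have h1 := hasLabels_quad_pair (J := complexEnd (sigmaMatrix * normalForm II ε σ τ l))
      (U := coordSpace {0, 1, 4, 5}) (s := (σ (0 : Fin 2))) (hτ (0 : Fin 2)) (stdVec_mem (by decide)) (stdVec_mem (by decide))
      (by rw [complexEnd_stdVec]; simp [normalForm]; module)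
      (by rw [complexEnd_stdVec]; simp [normalForm])
      (by rw [complexEnd_stdVec]; simp [normalForm]; module)
      (by rw [complexEnd_stdVec]; simp [normalForm]; module)
    have h2 := hasLabels_plane_pair (J := complexEnd (sigmaMatrix * normalForm II ε σ τ l))
      (U := coordSpace {2, 3}) (i := 2) (s := (σ (1 : Fin 2))) (hτ (1 : Fin 2))
      (stdVec_mem (by decide)) (stdVec_mem (by decide))
      (by rw [complexEnd_stdVec]; simp [normalForm]; module)
      (by rw [complexEnd_stdVec]; simp [normalForm])
    exact (h1.append_coord hA (by decide) (by simp [Fin.forall_fin_succ, normalForm]) h2).mono le_top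
  case III =>
    have h1 := hasLabels_hex_pair (J := complexEnd (sigmaMatrix * normalForm III ε σ τ l))
      (U := ⊤) (s := (σ (0 : Fin 1))) (hτ (0 : Fin 1)) trivial trivial
      (by rw [complexEnd_stdVec]; simp [normalForm]; module)
      (by rw [complexEnd_stdVec]; simp [normalForm])
      (by rw [complexEnd_stdVec]; simp [normalForm]; module)
      (by rw [complexEnd_stdVec]; simp [normalForm]; module)
      (by rw [complexEnd_stdVec]; simp [normalForm]; module)
      (by rw [complexEnd_stdVec]; simp [normalForm]; module)
    exact h1
  case IV =>
    have h1 := hasLabels_plane_pair (J := complexEnd (sigmaMatrix * normalForm IV ε σ τ l))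
      (U := coordSpace {0, 5}) (i := 0) (s := (σ (0 : Fin 2))) (hτ (0 : Fin 2))
      (stdVec_mem (by decide)) (stdVec_mem (by decide))
      (by rw [complexEnd_stdVec]; simp [normalForm]; module)
      (by rw [complexEnd_stdVec]; simp [normalForm])
    have h2 := hasLabels_plane_pair (J := complexEnd (sigmaMatrix * normalForm IV ε σ τ l))
      (U := coordSpace {1, 4}) (i := 1) (s := (σ (1 : Fin 2))) (hτ (1 : Fin 2))
      (stdVec_mem (by decide)) (stdVec_mem (by decide))
      (by rw [complexEnd_stdVec]; simp [normalForm]; module)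
      (by rw [complexEnd_stdVec]; simp [normalForm])
    have h3 := hasLabels_plane_split
      (U := coordSpace {2, 3}) (i := 2) (p := (l (0 : Fin 2))) (q := (l (1 : Fin 2))) hB
      (stdVec_mem (by decide)) (stdVec_mem (by decide))
      (by rw [complexEnd_stdVec]; simp [normalForm])
      (by rw [complexEnd_stdVec]; simp [normalForm])
    exact ((h1.append_coord hA (by decide) (by simp [Fin.forall_fin_succ, normalForm]) h2).append_coord hA (by decide) (by simp [Fin.forall_fin_succ, normalForm]) h3).mono le_top
  case V =>
    have h1 := hasLabels_quad_pair (J := complexEnd (sigmaMatrix * normalForm V ε σ τ l))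
      (U := coordSpace {0, 1, 4, 5}) (s := (σ (0 : Fin 1))) (hτ (0 : Fin 1)) (stdVec_mem (by decide)) (stdVec_mem (by decide))
      (by rw [complexEnd_stdVec]; simp [normalForm]; module)
      (by rw [complexEnd_stdVec]; simp [normalForm])
      (by rw [complexEnd_stdVec]; simp [normalForm]; module)
      (by rw [complexEnd_stdVec]; simp [normalForm]; module)
    have h2 := hasLabels_plane_split
      (U := coordSpace {2, 3}) (i := 2) (p := (l (0 : Fin 2))) (q := (l (1 : Fin 2))) hB
      (stdVec_mem (by decide)) (stdVec_mem (by decide))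
      (by rw [complexEnd_stdVec]; simp [normalForm])
      (by rw [complexEnd_stdVec]; simp [normalForm])
    exact (h1.append_coord hA (by decide) (by simp [Fin.forall_fin_succ, normalForm]) h2).mono le_top
  case VI =>
    have h1 := hasLabels_plane_pair (J := complexEnd (sigmaMatrix * normalForm VI ε σ τ l))
      (U := coordSpace {0, 5}) (i := 0) (s := (σ (0 : Fin 1))) (hτ (0 : Fin 1))
      (stdVec_mem (by decide)) (stdVec_mem (by decide))
      (by rw [complexEnd_stdVec]; simp [normalForm]; module)
      (by rw [complexEnd_stdVec]; simp [normalForm])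
    have h2 := hasLabels_plane_split
      (U := coordSpace {2, 3}) (i := 2) (p := (l (0 : Fin 4))) (q := (l (1 : Fin 4))) hB
      (stdVec_mem (by decide)) (stdVec_mem (by decide))
      (by rw [complexEnd_stdVec]; simp [normalForm])
      (by rw [complexEnd_stdVec]; simp [normalForm])
    have h3 := hasLabels_plane_split
      (U := coordSpace {1, 4}) (i := 1) (p := (l (2 : Fin 4))) (q := (l (3 : Fin 4))) hB
      (stdVec_mem (by decide)) (stdVec_mem (by decide))
      (by rw [complexEnd_stdVec]; simp [normalForm])
      (by rw [complexEnd_stdVec]; simp [normalForm])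
    exact ((h1.append_coord hA (by decide) (by simp [Fin.forall_fin_succ, normalForm]) h2).append_coord hA (by decide) (by simp [Fin.forall_fin_succ, normalForm]) h3).mono le_top
  case VII =>
    have h1 := hasLabels_plane_split
      (U := coordSpace {2, 3}) (i := 2) (p := (l (0 : Fin 6))) (q := (l (1 : Fin 6))) hB
      (stdVec_mem (by decide)) (stdVec_mem (by decide))
      (by rw [complexEnd_stdVec]; simp [normalForm])
      (by rw [complexEnd_stdVec]; simp [normalForm])
    have h2 := hasLabels_plane_split
      (U := coordSpace {1, 4}) (i := 1) (p := (l (2 : Fin 6))) (q := (l (3 : Fin 6))) hB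
      (stdVec_mem (by decide)) (stdVec_mem (by decide))
      (by rw [complexEnd_stdVec]; simp [normalForm])
      (by rw [complexEnd_stdVec]; simp [normalForm])
    have h3 := hasLabels_plane_split
      (U := coordSpace {0, 5}) (i := 0) (p := (l (4 : Fin 6))) (q := (l (5 : Fin 6))) hB
      (stdVec_mem (by decide)) (stdVec_mem (by decide))
      (by rw [complexEnd_stdVec]; simp [normalForm])
      (by rw [complexEnd_stdVec]; simp [normalForm])
    exact ((h1.append_coord hA (by decide) (by simp [Fin.forall_fin_succ, normalForm]) h2).append_coord hA (by decide) (by simp [Fin.forall_fin_succ, normalForm]) h3).mono le_top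
  case VIII =>
    have h1 := hasLabels_six (J := complexEnd (sigmaMatrix * normalForm VIII ε σ τ l))
      (U := ⊤) (l := (l (0 : Fin 1))) (ε := (ε (0 : Fin 1))) trivial
      (by rw [complexEnd_stdVec]; simp [normalForm])
      (by rw [complexEnd_stdVec]; simp [normalForm]; module)
      (by rw [complexEnd_stdVec]; simp [normalForm]; module)
      (by rw [complexEnd_stdVec]; simp [normalForm]; module)
      (by rw [complexEnd_stdVec]; simp [normalForm]; module)
      (by rw [complexEnd_stdVec]; simp [normalForm]; module)
    exact h1
  case IX =>
    have h1 := hasLabels_four (J := complexEnd (sigmaMatrix * normalForm IX ε σ τ l))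
      (U := coordSpace {0, 1, 4, 5}) (l := (l (0 : Fin 2))) (ε := (ε (1 : Fin 2))) (stdVec_mem (by decide))
      (by rw [complexEnd_stdVec]; simp [normalForm])
      (by rw [complexEnd_stdVec]; simp [normalForm]; module)
      (by rw [complexEnd_stdVec]; simp [normalForm]; module)
      (by rw [complexEnd_stdVec]; simp [normalForm]; module)
    have h2 := hasLabels_plane_jordan (J := complexEnd (sigmaMatrix * normalForm IX ε σ τ l))
      (U := coordSpace {2, 3}) (i := 3) (l := (l (1 : Fin 2))) (ε := (ε (0 : Fin 2)))
      (stdVec_mem (by decide))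
      (by rw [complexEnd_stdVec]; simp [normalForm]; module)
      (by rw [complexEnd_stdVec]; simp [normalForm])
    exact (h1.append_coord hA (by decide) (by simp [Fin.forall_fin_succ, normalForm]) h2).mono le_top
  case X =>
    have h1 := hasLabels_plane_pair (J := complexEnd (sigmaMatrix * normalForm X ε σ τ l))
      (U := coordSpace {2, 3}) (i := 2) (s := (σ (0 : Fin 1))) (hτ (0 : Fin 1))
      (stdVec_mem (by decide)) (stdVec_mem (by decide))
      (by rw [complexEnd_stdVec]; simp [normalForm]; module)
      (by rw [complexEnd_stdVec]; simp [normalForm])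
    have h2 := hasLabels_four (J := complexEnd (sigmaMatrix * normalForm X ε σ τ l))
      (U := coordSpace {0, 1, 4, 5}) (l := (l (0 : Fin 1))) (ε := (ε (0 : Fin 1))) (stdVec_mem (by decide))
      (by rw [complexEnd_stdVec]; simp [normalForm])
      (by rw [complexEnd_stdVec]; simp [normalForm]; module)
      (by rw [complexEnd_stdVec]; simp [normalForm]; module)
      (by rw [complexEnd_stdVec]; simp [normalForm]; module)
    exact (h1.append_coord hA (by decide) (by simp [Fin.forall_fin_succ, normalForm]) h2).mono le_top
  case XI =>
    have h1 := hasLabels_four (J := complexEnd (sigmaMatrix * normalForm XI ε σ τ l))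
      (U := coordSpace {0, 1, 4, 5}) (l := (l (0 : Fin 3))) (ε := (ε (0 : Fin 1))) (stdVec_mem (by decide))
      (by rw [complexEnd_stdVec]; simp [normalForm])
      (by rw [complexEnd_stdVec]; simp [normalForm]; module)
      (by rw [complexEnd_stdVec]; simp [normalForm]; module)
      (by rw [complexEnd_stdVec]; simp [normalForm]; module)
    have h2 := hasLabels_plane_split
      (U := coordSpace {2, 3}) (i := 2) (p := (l (2 : Fin 3))) (q := (l (1 : Fin 3))) hB
      (stdVec_mem (by decide)) (stdVec_mem (by decide))
      (by rw [complexEnd_stdVec]; simp [normalForm])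
      (by rw [complexEnd_stdVec]; simp [normalForm])
    exact (h1.append_coord hA (by decide) (by simp [Fin.forall_fin_succ, normalForm]) h2).mono le_top
  case XII =>
    have h1 := hasLabels_quad_pair (J := complexEnd (sigmaMatrix * normalForm XII ε σ τ l))
      (U := coordSpace {0, 1, 4, 5}) (s := (σ (0 : Fin 1))) (hτ (0 : Fin 1)) (stdVec_mem (by decide)) (stdVec_mem (by decide))
      (by rw [complexEnd_stdVec]; simp [normalForm]; module)
      (by rw [complexEnd_stdVec]; simp [normalForm])
      (by rw [complexEnd_stdVec]; simp [normalForm]; module)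
      (by rw [complexEnd_stdVec]; simp [normalForm]; module)
    have h2 := hasLabels_plane_jordan (J := complexEnd (sigmaMatrix * normalForm XII ε σ τ l))
      (U := coordSpace {2, 3}) (i := 3) (l := (l (0 : Fin 1))) (ε := (ε (0 : Fin 1)))
      (stdVec_mem (by decide))
      (by rw [complexEnd_stdVec]; simp [normalForm]; module)
      (by rw [complexEnd_stdVec]; simp [normalForm])
    exact (h1.append_coord hA (by decide) (by simp [Fin.forall_fin_succ, normalForm]) h2).mono le_top
  case XIII =>
    have h1 := hasLabels_plane_jordan (J := complexEnd (sigmaMatrix * normalForm XIII ε σ τ l))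
      (U := coordSpace {0, 5}) (i := 5) (l := (l (0 : Fin 3))) (ε := (ε (0 : Fin 3)))
      (stdVec_mem (by decide))
      (by rw [complexEnd_stdVec]; simp [normalForm]; module)
      (by rw [complexEnd_stdVec]; simp [normalForm])
    -- In the plane `{1, 4}` the sign stands at the diagonal place 1, so the chain starts at the
    -- vector of lower index; in the other two planes of this form it starts at the higher one.
    have h2 := hasLabels_plane_jordan (J := complexEnd (sigmaMatrix * normalForm XIII ε σ τ l))
      (U := coordSpace {1, 4}) (i := 1) (l := (l (1 : Fin 3))) (ε := (ε (1 : Fin 3)))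
      (stdVec_mem (by decide))
      (by rw [complexEnd_stdVec]; simp [normalForm])
      (by rw [complexEnd_stdVec]; simp [normalForm])
    have h3 := hasLabels_plane_jordan (J := complexEnd (sigmaMatrix * normalForm XIII ε σ τ l))
      (U := coordSpace {2, 3}) (i := 3) (l := (l (2 : Fin 3))) (ε := (ε (2 : Fin 3)))
      (stdVec_mem (by decide))
      (by rw [complexEnd_stdVec]; simp [normalForm]; module)
      (by rw [complexEnd_stdVec]; simp [normalForm])
    exact ((h1.append_coord hA (by decide) (by simp [Fin.forall_fin_succ, normalForm]) h2).append_coord hA (by decide) (by simp [Fin.forall_fin_succ, normalForm]) h3).mono le_top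
  case XIV =>
    have h1 := hasLabels_plane_jordan (J := complexEnd (sigmaMatrix * normalForm XIV ε σ τ l))
      (U := coordSpace {0, 5}) (i := 5) (l := (l (0 : Fin 2))) (ε := (ε (0 : Fin 2)))
      (stdVec_mem (by decide))
      (by rw [complexEnd_stdVec]; simp [normalForm]; module)
      (by rw [complexEnd_stdVec]; simp [normalForm])
    have h2 := hasLabels_plane_jordan (J := complexEnd (sigmaMatrix * normalForm XIV ε σ τ l))
      (U := coordSpace {1, 4}) (i := 1) (l := (l (1 : Fin 2))) (ε := (ε (1 : Fin 2)))
      (stdVec_mem (by decide))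
      (by rw [complexEnd_stdVec]; simp [normalForm])
      (by rw [complexEnd_stdVec]; simp [normalForm])
    have h3 := hasLabels_plane_pair (J := complexEnd (sigmaMatrix * normalForm XIV ε σ τ l))
      (U := coordSpace {2, 3}) (i := 2) (s := (σ (0 : Fin 1))) (hτ (0 : Fin 1))
      (stdVec_mem (by decide)) (stdVec_mem (by decide))
      (by rw [complexEnd_stdVec]; simp [normalForm]; module)
      (by rw [complexEnd_stdVec]; simp [normalForm])
    exact ((h1.append_coord hA (by decide) (by simp [Fin.forall_fin_succ, normalForm]) h2).append_coord hA (by decide) (by simp [Fin.forall_fin_succ, normalForm]) h3).mono le_top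
  case XV =>
    have h1 := hasLabels_plane_jordan (J := complexEnd (sigmaMatrix * normalForm XV ε σ τ l))
      (U := coordSpace {0, 5}) (i := 5) (l := (l (0 : Fin 4))) (ε := (ε (0 : Fin 2)))
      (stdVec_mem (by decide))
      (by rw [complexEnd_stdVec]; simp [normalForm]; module)
      (by rw [complexEnd_stdVec]; simp [normalForm])
    have h2 := hasLabels_plane_jordan (J := complexEnd (sigmaMatrix * normalForm XV ε σ τ l))
      (U := coordSpace {1, 4}) (i := 1) (l := (l (1 : Fin 4))) (ε := (ε (1 : Fin 2)))
      (stdVec_mem (by decide))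
      (by rw [complexEnd_stdVec]; simp [normalForm])
      (by rw [complexEnd_stdVec]; simp [normalForm])
    have h3 := hasLabels_plane_split
      (U := coordSpace {2, 3}) (i := 2) (p := (l (2 : Fin 4))) (q := (l (3 : Fin 4))) hB
      (stdVec_mem (by decide)) (stdVec_mem (by decide))
      (by rw [complexEnd_stdVec]; simp [normalForm])
      (by rw [complexEnd_stdVec]; simp [normalForm])
    exact ((h1.append_coord hA (by decide) (by simp [Fin.forall_fin_succ, normalForm]) h2).append_coord hA (by decide) (by simp [Fin.forall_fin_succ, normalForm]) h3).mono le_top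
  case XVI =>
    have h1 := hasLabels_plane_pair (J := complexEnd (sigmaMatrix * normalForm XVI ε σ τ l))
      (U := coordSpace {2, 3}) (i := 2) (s := (σ (0 : Fin 2))) (hτ (0 : Fin 2))
      (stdVec_mem (by decide)) (stdVec_mem (by decide))
      (by rw [complexEnd_stdVec]; simp [normalForm]; module)
      (by rw [complexEnd_stdVec]; simp [normalForm])
    have h2 := hasLabels_plane_pair (J := complexEnd (sigmaMatrix * normalForm XVI ε σ τ l))
      (U := coordSpace {1, 4}) (i := 1) (s := (σ (1 : Fin 2))) (hτ (1 : Fin 2))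
      (stdVec_mem (by decide)) (stdVec_mem (by decide))
      (by rw [complexEnd_stdVec]; simp [normalForm]; module)
      (by rw [complexEnd_stdVec]; simp [normalForm])
    have h3 := hasLabels_plane_jordan (J := complexEnd (sigmaMatrix * normalForm XVI ε σ τ l))
      (U := coordSpace {0, 5}) (i := 5) (l := (l (0 : Fin 1))) (ε := (ε (0 : Fin 1)))
      (stdVec_mem (by decide))
      (by rw [complexEnd_stdVec]; simp [normalForm]; module)
      (by rw [complexEnd_stdVec]; simp [normalForm])
    exact ((h1.append_coord hA (by decide) (by simp [Fin.forall_fin_succ, normalForm]) h2).append_coord hA (by decide) (by simp [Fin.forall_fin_succ, normalForm]) h3).mono le_top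
  case XVII =>
    have h1 := hasLabels_plane_jordan (J := complexEnd (sigmaMatrix * normalForm XVII ε σ τ l))
      (U := coordSpace {0, 5}) (i := 5) (l := (l (0 : Fin 3))) (ε := (ε (0 : Fin 1)))
      (stdVec_mem (by decide))
      (by rw [complexEnd_stdVec]; simp [normalForm]; module)
      (by rw [complexEnd_stdVec]; simp [normalForm])
    have h2 := hasLabels_plane_pair (J := complexEnd (sigmaMatrix * normalForm XVII ε σ τ l))
      (U := coordSpace {1, 4}) (i := 1) (s := (σ (0 : Fin 1))) (hτ (0 : Fin 1))
      (stdVec_mem (by decide)) (stdVec_mem (by decide))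
      (by rw [complexEnd_stdVec]; simp [normalForm]; module)
      (by rw [complexEnd_stdVec]; simp [normalForm])
    have h3 := hasLabels_plane_split
      (U := coordSpace {2, 3}) (i := 2) (p := (l (1 : Fin 3))) (q := (l (2 : Fin 3))) hB
      (stdVec_mem (by decide)) (stdVec_mem (by decide))
      (by rw [complexEnd_stdVec]; simp [normalForm])
      (by rw [complexEnd_stdVec]; simp [normalForm])
    exact ((h1.append_coord hA (by decide) (by simp [Fin.forall_fin_succ, normalForm]) h2).append_coord hA (by decide) (by simp [Fin.forall_fin_succ, normalForm]) h3).mono le_top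
  case XVIII =>
    have h1 := hasLabels_plane_jordan (J := complexEnd (sigmaMatrix * normalForm XVIII ε σ τ l))
      (U := coordSpace {0, 5}) (i := 5) (l := (l (0 : Fin 5))) (ε := (ε (0 : Fin 1)))
      (stdVec_mem (by decide))
      (by rw [complexEnd_stdVec]; simp [normalForm]; module)
      (by rw [complexEnd_stdVec]; simp [normalForm])
    have h2 := hasLabels_plane_split
      (U := coordSpace {1, 4}) (i := 1) (p := (l (3 : Fin 5))) (q := (l (4 : Fin 5))) hB
      (stdVec_mem (by decide)) (stdVec_mem (by decide))
      (by rw [complexEnd_stdVec]; simp [normalForm])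
      (by rw [complexEnd_stdVec]; simp [normalForm])
    have h3 := hasLabels_plane_split
      (U := coordSpace {2, 3}) (i := 2) (p := (l (1 : Fin 5))) (q := (l (2 : Fin 5))) hB
      (stdVec_mem (by decide)) (stdVec_mem (by decide))
      (by rw [complexEnd_stdVec]; simp [normalForm])
      (by rw [complexEnd_stdVec]; simp [normalForm])
    exact ((h1.append_coord hA (by decide) (by simp [Fin.forall_fin_succ, normalForm]) h2).append_coord hA (by decide) (by simp [Fin.forall_fin_succ, normalForm]) h3).mono le_top
  case XIX =>
    have h1 := hasLabels_five_one
      (U := ⊤) (l := (l (0 : Fin 2))) (m := (l (1 : Fin 2))) (ε := (ε (0 : Fin 1))) hB (fun _ => trivial)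
      (by rw [complexEnd_stdVec]; simp [normalForm])
      (by rw [complexEnd_stdVec]; simp [normalForm]; module)
      (by rw [complexEnd_stdVec]; simp [normalForm, invSqrtTwo]; module)
      (by rw [complexEnd_stdVec]; simp [normalForm, invSqrtTwo]; module)
      (by rw [complexEnd_stdVec]; simp [normalForm, invSqrtTwo]; module)
      (by rw [complexEnd_stdVec]; simp [normalForm]; module)
    exact h1
  case XX =>
    have h1 := hasLabels_three_three
      (U := ⊤) (l := (l (0 : Fin 2))) (m := (l (1 : Fin 2))) hB (fun _ => trivial)
      (by rw [complexEnd_stdVec]; simp [normalForm])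
      (by rw [complexEnd_stdVec]; simp [normalForm, invSqrtTwo]; module)
      (by rw [complexEnd_stdVec]; simp [normalForm])
      (by rw [complexEnd_stdVec]; simp [normalForm, invSqrtTwo]; module)
      (by rw [complexEnd_stdVec]; simp [normalForm, invSqrtTwo]; module)
      (by rw [complexEnd_stdVec]; simp [normalForm, invSqrtTwo]; module)
    exact h1
  case XXI =>
    have h1 := hasLabels_plane_jordan (J := complexEnd (sigmaMatrix * normalForm XXI ε σ τ l))
      (U := coordSpace {0, 5}) (i := 0) (l := (l (1 : Fin 3))) (ε := (ε (1 : Fin 2)))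
      (stdVec_mem (by decide))
      (by rw [complexEnd_stdVec]; simp [normalForm])
      (by rw [complexEnd_stdVec]; simp [normalForm])
    have h2 := hasLabels_three_one
      (U := coordSpace {1, 2, 3, 4}) (i := 1) (j := 2) (l := (l (0 : Fin 3))) (m := (l (2 : Fin 3)))
      (ε := (ε (0 : Fin 2))) hB (Or.inl ⟨rfl, rfl⟩) (stdVec_mem (by decide)) (stdVec_mem (by decide))
      (stdVec_mem (by decide))
      (by rw [complexEnd_stdVec]; simp [normalForm, invSqrtTwo]; module)
      (by rw [complexEnd_stdVec]; simp [normalForm])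
      (by rw [complexEnd_stdVec]; simp [normalForm, invSqrtTwo]; module)
      (by rw [complexEnd_stdVec]; simp [normalForm, invSqrtTwo]; module)
    exact (h1.append_coord hA (by decide) (by simp [Fin.forall_fin_succ, normalForm]) h2).mono le_top
  case XXII =>
    have h1 := hasLabels_plane_pair (J := complexEnd (sigmaMatrix * normalForm XXII ε σ τ l))
      (U := coordSpace {0, 5}) (i := 0) (s := (σ (0 : Fin 1))) (hτ (0 : Fin 1))
      (stdVec_mem (by decide)) (stdVec_mem (by decide))
      (by rw [complexEnd_stdVec]; simp [normalForm]; module)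
      (by rw [complexEnd_stdVec]; simp [normalForm])
    have h2 := hasLabels_three_one
      (U := coordSpace {1, 2, 3, 4}) (i := 1) (j := 2) (l := (l (0 : Fin 2))) (m := (l (1 : Fin 2)))
      (ε := (ε (0 : Fin 1))) hB (Or.inl ⟨rfl, rfl⟩) (stdVec_mem (by decide)) (stdVec_mem (by decide))
      (stdVec_mem (by decide))
      (by rw [complexEnd_stdVec]; simp [normalForm, invSqrtTwo]; module)
      (by rw [complexEnd_stdVec]; simp [normalForm])
      (by rw [complexEnd_stdVec]; simp [normalForm, invSqrtTwo]; module)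
      (by rw [complexEnd_stdVec]; simp [normalForm, invSqrtTwo]; module)
    exact (h1.append_coord hA (by decide) (by simp [Fin.forall_fin_succ, normalForm]) h2).mono le_top
  case XXIII =>
    have h1 := hasLabels_three_one
      (U := coordSpace {1, 2, 3, 4}) (i := 2) (j := 1) (l := (l (0 : Fin 4))) (m := (l (1 : Fin 4)))
      (ε := (ε (0 : Fin 1))) hB (Or.inr ⟨rfl, rfl⟩) (stdVec_mem (by decide)) (stdVec_mem (by decide))
      (stdVec_mem (by decide))
      (by rw [complexEnd_stdVec]; simp [normalForm, invSqrtTwo]; module)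
      (by rw [complexEnd_stdVec]; simp [normalForm])
      (by rw [complexEnd_stdVec]; simp [normalForm, invSqrtTwo]; module)
      (by rw [complexEnd_stdVec]; simp [normalForm, invSqrtTwo]; module)
    have h2 := hasLabels_plane_split
      (U := coordSpace {0, 5}) (i := 0) (p := (l (2 : Fin 4))) (q := (l (3 : Fin 4))) hB
      (stdVec_mem (by decide)) (stdVec_mem (by decide))
      (by rw [complexEnd_stdVec]; simp [normalForm])
      (by rw [complexEnd_stdVec]; simp [normalForm])
    exact (h1.append_coord hA (by decide) (by simp [Fin.forall_fin_succ, normalForm]) h2).mono le_top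

end Metaclass

/-! ### The action of 4×4 matrices on bivectors -/

section Wedge

/-- The action of a `4 × 4` matrix on bivectors, in Petrov notation. -/
def wedge2 (g : Matrix (Fin 4) (Fin 4) ℝ) : Matrix (Fin 6) (Fin 6) ℝ :=
  Matrix.of fun A B => g (petrovPair A).1 (petrovPair B).1 * g (petrovPair A).2 (petrovPair B).2 -
    g (petrovPair A).2 (petrovPair B).1 * g (petrovPair A).1 (petrovPair B).2

/-- Functoriality of `Λ²`, or the Cauchy–Binet formula for 2×2 minors. -/
lemma wedge2_mul (g h : Matrix (Fin 4) (Fin 4) ℝ) : wedge2 (g * h) = wedge2 g * wedge2 h := by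
  ext A B
  simp only [wedge2, Matrix.of_apply, Matrix.mul_apply, Fin.sum_univ_six, Fin.sum_univ_four,
    petrovPair]
  generalize (Matrix.vecCons _ _ A : Fin 4 × Fin 4) = a
  generalize (Matrix.vecCons _ _ B : Fin 4 × Fin 4) = b
  simp
  ring

lemma wedge2_one : wedge2 1 = 1 := by
  ext A B
  fin_cases A <;> fin_cases B <;> simp [wedge2, petrovPair, Matrix.one_apply]

lemma wedge2_smul (t : ℝ) (g : Matrix (Fin 4) (Fin 4) ℝ) : wedge2 (t • g) = t ^ 2 • wedge2 g := by
  ext A B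
  simp only [wedge2, Matrix.of_apply, Matrix.smul_apply, smul_eq_mul]
  ring

-- `Σ` is the wedge product `Λ² × Λ² → Λ⁴` in coordinates, and `g` acts on `Λ⁴` by its determinant;
-- in matrix terms this is Laplace expansion by complementary 2×2 minors.
set_option maxHeartbeats 2000000 in
lemma wedge2_sigma (g : Matrix (Fin 4) (Fin 4) ℝ) :
    (wedge2 g).transpose * sigmaMatrix * wedge2 g = g.det • sigmaMatrix := by
  ext A B
  rw [Matrix.mul_assoc, Matrix.mul_apply]
  simp only [sigmaMatrix_mul_apply, Matrix.transpose_apply, Fin.sum_univ_six, Matrix.smul_apply,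
    smul_eq_mul]
  rw [Matrix.det_succ_row_zero]
  simp only [Matrix.det_fin_three, Fin.sum_univ_four]
  fin_cases A <;> fin_cases B <;> 
    simp [wedge2, petrovPair, sigmaMatrix, Matrix.submatrix, Fin.succAbove] <;> ring

lemma wedge2_mul_inv {k : Matrix (Fin 4) (Fin 4) ℝ} (hk : k.det ≠ 0) :
    wedge2 k * wedge2 k⁻¹ = 1 := by
  rw [← wedge2_mul, Matrix.mul_nonsing_inv _ (isUnit_iff_ne_zero.2 hk), wedge2_one]

lemma wedge2_inv_mul {k : Matrix (Fin 4) (Fin 4) ℝ} (hk : k.det ≠ 0) :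
    wedge2 k⁻¹ * wedge2 k = 1 := by
  rw [← wedge2_mul, Matrix.nonsing_inv_mul _ (isUnit_iff_ne_zero.2 hk), wedge2_one]

lemma det_sigmaMatrix_ne_zero : sigmaMatrix.det ≠ 0 := by
  have h := congrArg Matrix.det sigmaMatrix_mul_self
  rw [Matrix.det_mul, Matrix.det_one] at h
  exact left_ne_zero_of_mul_eq_one h

lemma det_sq_of_sigma {P : Matrix (Fin 6) (Fin 6) ℝ} {c : ℝ}
    (h : P.transpose * sigmaMatrix * P = c • sigmaMatrix) : P.det ^ 2 = c ^ 6 := by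
  have h := congrArg Matrix.det h
  rw [Matrix.det_mul, Matrix.det_mul, Matrix.det_transpose, Matrix.det_smul, Fintype.card_fin] at h
  exact mul_right_cancel₀ det_sigmaMatrix_ne_zero (by linear_combination h)

/-- `wedge2_sigma` determines the determinant only up to sign. The sign follows from `det (wedge2 M)
= (det M) ^ 3`, which is multiplicative and so need only be checked on diagonal matrices and
transvections. -/
lemma det_wedge2_of_det_eq_one {g : Matrix (Fin 4) (Fin 4) ℝ} (hg : g.det = 1) :
    (wedge2 g).det = 1 := by
  have key : ∀ M : Matrix (Fin 4) (Fin 4) ℝ, M.det ≠ 0 → (wedge2 M).det = M.det ^ 3 := by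
    intro M hM
    refine Matrix.diagonal_transvection_induction_of_det_ne_zero
      (fun M => (wedge2 M).det = M.det ^ 3) M hM ?_ ?_ ?_
    · intro D _
      have : wedge2 (Matrix.diagonal D) = Matrix.diagonal fun A =>
          D (petrovPair A).1 * D (petrovPair A).2 := by
        ext A B
        fin_cases A <;> fin_cases B <;> simp [wedge2, petrovPair, Matrix.diagonal_apply]
      rw [this, Matrix.det_diagonal, Matrix.det_diagonal]
      simp only [Fin.prod_univ_six, Fin.prod_univ_four, petrovPair]
      simp
      ring
    · rintro ⟨i, j, hij, c⟩
      change (wedge2 (Matrix.transvection i j c)).det = (Matrix.transvection i j c).det ^ 3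
      -- A transvection is the square of the one with half the parameter, so only the known square
      -- of a determinant is needed.
      rw [Matrix.det_transvection_of_ne i j hij, one_pow,
        show c = c / 2 + c / 2 by ring, ← Matrix.transvection_mul_transvection_same i j hij,
        wedge2_mul, Matrix.det_mul, ← sq, det_sq_of_sigma (wedge2_sigma _),
        Matrix.det_transvection_of_ne i j hij, one_pow]
    · intro A B _ _ hA hB
      simp only [wedge2_mul, Matrix.det_mul, hA, hB]
      ring
  rw [key g (by rw [hg]; exact one_ne_zero), hg, one_pow]

end Wedge

/-! ### Isometries of `Σ` of determinant one come from `SL(4)` up to sign -/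

section SpecialOrthogonal

/-- The matrices that preserve `Σ`, with determinant one. -/
structure IsSpecialSigma (P : Matrix (Fin 6) (Fin 6) ℝ) : Prop where
  sigma : P.transpose * sigmaMatrix * P = sigmaMatrix
  det : P.det = 1

/-- The matrix is, up to sign, the action of an element of `SL(4)` on bivectors. -/
def IsWedge (P : Matrix (Fin 6) (Fin 6) ℝ) : Prop :=
  ∃ g : Matrix (Fin 4) (Fin 4) ℝ, g.det = 1 ∧ (P = wedge2 g ∨ P = -wedge2 g)

lemma IsWedge.mul_left {k : Matrix (Fin 4) (Fin 4) ℝ} (hk : k.det = 1)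
    {P : Matrix (Fin 6) (Fin 6) ℝ} (h : IsWedge P) : IsWedge (wedge2 k * P) := by
  obtain ⟨g, hg, rfl | rfl⟩ := h
  · exact ⟨k * g, by rw [Matrix.det_mul, hk, hg, one_mul], .inl (wedge2_mul k g).symm⟩
  · exact ⟨k * g, by rw [Matrix.det_mul, hk, hg, one_mul], .inr (by
      rw [wedge2_mul, Matrix.mul_neg])⟩

lemma IsSpecialSigma.wedge2_mul {k : Matrix (Fin 4) (Fin 4) ℝ} (hk : k.det = 1)
    {P : Matrix (Fin 6) (Fin 6) ℝ} (h : IsSpecialSigma P) : IsSpecialSigma (wedge2 k * P) := by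
  refine ⟨?_, by rw [Matrix.det_mul, det_wedge2_of_det_eq_one hk, h.det, one_mul]⟩
  rw [Matrix.transpose_mul]
  calc P.transpose * (wedge2 k).transpose * sigmaMatrix * (wedge2 k * P)
      = P.transpose * ((wedge2 k).transpose * sigmaMatrix * wedge2 k) * P := by
        simp only [Matrix.mul_assoc]
    _ = sigmaMatrix := by rw [wedge2_sigma, hk, one_smul, h.sigma]

/-- Moving the columns of `P` that are those of `wedge2 k` to standard basis vectors. -/
lemma IsSpecialSigma.exists_reduce {P : Matrix (Fin 6) (Fin 6) ℝ} (h : IsSpecialSigma P)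
    {k : Matrix (Fin 4) (Fin 4) ℝ} (hk : k.det = 1) :
    ∃ P', IsSpecialSigma P' ∧ (IsWedge P' → IsWedge P) ∧
      (∀ j a, (∀ i, P i j = wedge2 k i a) → ∀ i, P' i j = (1 : Matrix (Fin 6) (Fin 6) ℝ) i a) ∧
      P' = wedge2 k⁻¹ * P := by
  have hk0 : k.det ≠ 0 := by rw [hk]; exact one_ne_zero
  have hk1 : (k⁻¹).det = 1 := by
    rw [Matrix.det_nonsing_inv, hk, Ring.inverse_one]
  refine ⟨wedge2 k⁻¹ * P, h.wedge2_mul hk1, fun hw => ?_, fun j a hj i => ?_, rfl⟩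
  · have := hw.mul_left hk
    rwa [← Matrix.mul_assoc, wedge2_mul_inv hk0, one_mul] at this
  · rw [← wedge2_inv_mul hk0, Matrix.mul_apply, Matrix.mul_apply]
    simp only [hj]

lemma IsSpecialSigma.form_apply {P : Matrix (Fin 6) (Fin 6) ℝ} (h : IsSpecialSigma P) (i j : Fin 6) :
    ∑ k, P k i * P k.rev j = sigmaMatrix i j := by
  conv_rhs => rw [← h.sigma]
  rw [Matrix.mul_assoc, Matrix.mul_apply]
  simp only [sigmaMatrix_mul_apply, Matrix.transpose_apply]

/-- Pairing the standard column `a` with the other columns reads off row `a.rev`. -/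
lemma IsSpecialSigma.row_of_col {P : Matrix (Fin 6) (Fin 6) ℝ} (h : IsSpecialSigma P) {a : Fin 6}
    (ha : ∀ i, P i a = (1 : Matrix (Fin 6) (Fin 6) ℝ) i a) (j : Fin 6) :
    P a.rev j = if j = a.rev then 1 else 0 := by
  have h1 := h.form_apply a j
  simp only [ha, Matrix.one_apply, ite_mul, one_mul, zero_mul, Finset.sum_ite_eq',
    Finset.mem_univ, if_true, sigmaMatrix_apply] at h1
  exact h1

lemma IsSpecialSigma.form_expand {P : Matrix (Fin 6) (Fin 6) ℝ} (h : IsSpecialSigma P)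
    (i j : Fin 6) : P 0 i * P 5 j + P 1 i * P 4 j + P 2 i * P 3 j + P 3 i * P 2 j + P 4 i * P 1 j +
      P 5 i * P 0 j = if j = i.rev then 1 else 0 := by
  rw [← sigmaMatrix_apply, ← h.form_apply, Fin.sum_univ_six]
  rfl

/-- What remains is an isometry of a hyperbolic plane of determinant one, so a diagonal block with
entries `p` and `1 / p`. It comes from a diagonal matrix in `SL(4)` if `p > 0`; if `p < 0` its
negative does, which is the only source of the sign. -/
lemma IsSpecialSigma.isWedge_of_four {P : Matrix (Fin 6) (Fin 6) ℝ} (h : IsSpecialSigma P)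
    (h0 : ∀ i, P i 0 = (1 : Matrix (Fin 6) (Fin 6) ℝ) i 0)
    (h5 : ∀ i, P i 5 = (1 : Matrix (Fin 6) (Fin 6) ℝ) i 5)
    (h1 : ∀ i, P i 1 = (1 : Matrix (Fin 6) (Fin 6) ℝ) i 1)
    (h4 : ∀ i, P i 4 = (1 : Matrix (Fin 6) (Fin 6) ℝ) i 4) : IsWedge P := by
  obtain ⟨p, hp⟩ : ∃ p, p = P 2 2 := ⟨_, rfl⟩
  obtain ⟨q, hq⟩ : ∃ q, q = P 3 2 := ⟨_, rfl⟩
  obtain ⟨r, hr⟩ : ∃ r, r = P 2 3 := ⟨_, rfl⟩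
  obtain ⟨s, hs⟩ : ∃ s, s = P 3 3 := ⟨_, rfl⟩
  have hP : P = !![1, 0, 0, 0, 0, 0; 0, 1, 0, 0, 0, 0; 0, 0, p, r, 0, 0; 0, 0, q, s, 0, 0;
      0, 0, 0, 0, 1, 0; 0, 0, 0, 0, 0, 1] := by
    have e0 := h.row_of_col h5
    have e5 := h.row_of_col h0
    have e1 := h.row_of_col h4
    have e4 := h.row_of_col h1
    ext i j
    fin_cases j
    · fin_cases i <;> simp [h0]
    · fin_cases i <;> simp [h1]
    · fin_cases i
      · simpa using e0 2
      · simpa using e1 2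
      · simp [hp]
      · simp [hq]
      · simpa using e4 2
      · simpa using e5 2
    · fin_cases i
      · simpa using e0 3
      · simpa using e1 3
      · simp [hr]
      · simp [hs]
      · simpa using e4 3
      · simpa using e5 3
    · fin_cases i <;> simp [h4]
    · fin_cases i <;> simp [h5]
  have hd : p * s - r * q = 1 := by
    rw [← h.det, hP]
    simp [Matrix.det_succ_row_zero, Fin.sum_univ_succ, Fin.succAbove]
    ring
  have e22 := h.form_expand 2 2
  have e33 := h.form_expand 3 3
  have e23 := h.form_expand 2 3
  simp [hP] at e22 e33 e23
  have hps : p * s = 1 := by linarith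
  have hp0 : p ≠ 0 := left_ne_zero_of_mul_eq_one hps
  have hs0 : s ≠ 0 := right_ne_zero_of_mul_eq_one hps
  have hq0 : q = 0 := by
    have : p * q = 0 := by linarith
    exact (mul_eq_zero.1 this).resolve_left hp0
  have hr0 : r = 0 := by
    have : s * r = 0 := by linarith
    exact (mul_eq_zero.1 this).resolve_left hs0
  rw [hq0, hr0] at hP
  rcases lt_or_gt_of_ne hp0 with hneg | hpos
  · obtain ⟨a, ha⟩ : ∃ a, a = √(-p) := ⟨_, rfl⟩
    have haa : a * a = -p := by rw [ha, Real.mul_self_sqrt (by linarith)]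
    have ha0 : a ≠ 0 := by rintro rfl; simp at haa; exact hp0 haa
    have hs' : s = -(1 / (a * a)) := by rw [haa]; field_simp; linarith
    have hp' : p = -(a * a) := by linarith
    refine ⟨Matrix.diagonal ![a, -1 / a, -1 / a, a], ?_, .inr ?_⟩
    · rw [Matrix.det_diagonal, Fin.prod_univ_four]
      simp
      field_simp
    · rw [hP, hs', hp']
      ext A B
      fin_cases A <;> fin_cases B <;> simp [wedge2, petrovPair, Matrix.diagonal_apply] <;> field_simp
  · obtain ⟨a, ha⟩ : ∃ a, a = √p := ⟨_, rfl⟩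
    have haa : a * a = p := by rw [ha, Real.mul_self_sqrt hpos.le]
    have ha0 : a ≠ 0 := by rintro rfl; simp at haa; exact hp0 haa.symm
    have hs' : s = 1 / (a * a) := by rw [haa]; field_simp; linarith
    refine ⟨Matrix.diagonal ![a, 1 / a, 1 / a, a], ?_, .inl ?_⟩
    · rw [Matrix.det_diagonal, Fin.prod_univ_four]
      simp
      field_simp
    · rw [hP, hs', ← haa]
      ext A B
      fin_cases A <;> fin_cases B <;> simp [wedge2, petrovPair, Matrix.diagonal_apply] <;> field_simp

/-- Column 4 is isotropic with entry 1 at place 4, so its entries at places 2 and 3 determine it. A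
unipotent element of `SL(2) × SL(2)` has the same column and fixes the three standard ones. -/
lemma IsSpecialSigma.isWedge_of_three {P : Matrix (Fin 6) (Fin 6) ℝ} (h : IsSpecialSigma P)
    (h0 : ∀ i, P i 0 = (1 : Matrix (Fin 6) (Fin 6) ℝ) i 0)
    (h5 : ∀ i, P i 5 = (1 : Matrix (Fin 6) (Fin 6) ℝ) i 5)
    (h1 : ∀ i, P i 1 = (1 : Matrix (Fin 6) (Fin 6) ℝ) i 1) : IsWedge P := by
  have e0 := h.row_of_col h5 4
  have e5 := h.row_of_col h0 4
  have e4 := h.row_of_col h1 4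
  have e := h.form_expand 4 4
  simp at e0 e5 e4
  rw [e0, e5, e4] at e
  simp at e
  obtain ⟨P', hP', hw, hc, -⟩ := h.exists_reduce
    (k := !![1, -P 2 4, 0, 0; 0, 1, 0, 0; 0, 0, 1, -P 3 4; 0, 0, 0, 1])
    (by simp [Matrix.det_succ_row_zero, Fin.sum_univ_succ, Fin.succAbove])
  refine hw (hP'.isWedge_of_four (hc 0 0 ?_) (hc 5 5 ?_) (hc 1 1 ?_) (hc 4 4 ?_))
  · intro i; rw [h0, Matrix.one_apply]; fin_cases i <;> simp [wedge2, petrovPair]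
  · intro i; rw [h5, Matrix.one_apply]; fin_cases i <;> simp [wedge2, petrovPair]
  · intro i; rw [h1, Matrix.one_apply]; fin_cases i <;> simp [wedge2, petrovPair]
  · intro i; fin_cases i <;> simp [wedge2, petrovPair, e0, e5, e4]
    linarith

/-- The elements of `SL(2) × SL(2)`, acting on the frame vectors 0, 1 and 2, 3, fix the bivectors at
places 0 and 5. The middle four coordinates are the tensor product of the two planes, and the
isotropic column 1 is a pure tensor there, hence a column of `wedge2 k` for such a `k`. -/
lemma IsSpecialSigma.isWedge_of_two {P : Matrix (Fin 6) (Fin 6) ℝ} (h : IsSpecialSigma P)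
    (h0 : ∀ i, P i 0 = (1 : Matrix (Fin 6) (Fin 6) ℝ) i 0)
    (h5 : ∀ i, P i 5 = (1 : Matrix (Fin 6) (Fin 6) ℝ) i 5) : IsWedge P := by
  have key : ∀ {P : Matrix (Fin 6) (Fin 6) ℝ}, IsSpecialSigma P →
      (∀ i, P i 0 = (1 : Matrix (Fin 6) (Fin 6) ℝ) i 0) →
      (∀ i, P i 5 = (1 : Matrix (Fin 6) (Fin 6) ℝ) i 5) → P 1 1 ≠ 0 → IsWedge P := by
    intro P h h0 h5 hx
    have e0 := h.row_of_col h5 1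
    have e5 := h.row_of_col h0 1
    have e := h.form_expand 1 1
    simp at e0 e5
    rw [e0, e5] at e
    simp at e
    obtain ⟨P', hP', hw, hc, -⟩ := h.exists_reduce
      (k := !![1, 0, 0, 0; P 3 1 / P 1 1, 1, 0, 0; 0, 0, P 1 1, 0; 0, 0, P 2 1, 1 / P 1 1])
      (by simp [Matrix.det_succ_row_zero, Fin.sum_univ_succ, Fin.succAbove, hx])
    refine hw (hP'.isWedge_of_three (hc 0 0 ?_) (hc 5 5 ?_) (hc 1 1 ?_))
    · intro i; rw [h0, Matrix.one_apply]; fin_cases i <;> simp [wedge2, petrovPair]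
    · intro i; rw [h5, Matrix.one_apply]; fin_cases i <;> simp [wedge2, petrovPair, hx]
    · intro i; fin_cases i <;> simp [wedge2, petrovPair, e0, e5] <;> field_simp
      linarith
  by_cases hx1 : P 1 1 ≠ 0
  · exact key h h0 h5 hx1
  have red : ∀ k : Matrix (Fin 4) (Fin 4) ℝ, k.det = 1 →
      (∀ i, wedge2 k i 0 = (1 : Matrix (Fin 6) (Fin 6) ℝ) i 0) →
      (∀ i, wedge2 k i 5 = (1 : Matrix (Fin 6) (Fin 6) ℝ) i 5) →
      (wedge2 k * P) 1 1 ≠ 0 → IsWedge P := by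
    intro k hk hk0 hk5 hne
    have hkd : k.det ≠ 0 := by rw [hk]; exact one_ne_zero
    have hk1 : (k⁻¹).det = 1 := by rw [Matrix.det_nonsing_inv, hk, Ring.inverse_one]
    have := (key (h.wedge2_mul hk) (fun i => ?_) (fun i => ?_) hne).mul_left hk1
    · rwa [← Matrix.mul_assoc, wedge2_inv_mul hkd, one_mul] at this
    · rw [Matrix.mul_apply]
      simp only [h0, Matrix.one_apply, mul_ite, mul_one, mul_zero, Finset.sum_ite_eq',
        Finset.mem_univ, if_true]
      exact hk0 i
    · rw [Matrix.mul_apply]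
      simp only [h5, Matrix.one_apply, mul_ite, mul_one, mul_zero, Finset.sum_ite_eq',
        Finset.mem_univ, if_true]
      exact hk5 i
  -- Quarter turns in the planes of the frame vectors 0, 1 and 2, 3 bring any non-zero entry of the
  -- column to place 1.
  by_cases hx2 : P 2 1 ≠ 0
  · refine red !![1, 0, 0, 0; 0, 1, 0, 0; 0, 0, 0, 1; 0, 0, -1, 0]
      (by simp [Matrix.det_succ_row_zero, Fin.sum_univ_succ, Fin.succAbove])
      (fun i => by rw [Matrix.one_apply]; fin_cases i <;> simp [wedge2, petrovPair])
      (fun i => by rw [Matrix.one_apply]; fin_cases i <;> simp [wedge2, petrovPair]) ?_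
    simpa [Matrix.mul_apply, Fin.sum_univ_six, wedge2, petrovPair] using hx2
  by_cases hx3 : P 3 1 ≠ 0
  · refine red !![0, 1, 0, 0; -1, 0, 0, 0; 0, 0, 1, 0; 0, 0, 0, 1]
      (by simp [Matrix.det_succ_row_zero, Fin.sum_univ_succ, Fin.succAbove])
      (fun i => by rw [Matrix.one_apply]; fin_cases i <;> simp [wedge2, petrovPair])
      (fun i => by rw [Matrix.one_apply]; fin_cases i <;> simp [wedge2, petrovPair]) ?_
    simpa [Matrix.mul_apply, Fin.sum_univ_six, wedge2, petrovPair] using hx3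
  by_cases hx4 : P 4 1 ≠ 0
  · refine red !![0, 1, 0, 0; -1, 0, 0, 0; 0, 0, 0, 1; 0, 0, -1, 0]
      (by simp [Matrix.det_succ_row_zero, Fin.sum_univ_succ, Fin.succAbove])
      (fun i => by rw [Matrix.one_apply]; fin_cases i <;> simp [wedge2, petrovPair])
      (fun i => by rw [Matrix.one_apply]; fin_cases i <;> simp [wedge2, petrovPair]) ?_
    simpa [Matrix.mul_apply, Fin.sum_univ_six, wedge2, petrovPair] using hx4
  have e0 := h.row_of_col h5 1
  have e5 := h.row_of_col h0 1
  simp at e0 e5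
  push Not at hx1 hx2 hx3 hx4
  -- The column cannot vanish altogether, since it pairs to 1 with column 4.
  have e := h.form_expand 1 4
  rw [hx1, hx2, hx3, hx4, e0, e5] at e
  simp at e

/-- Column 5 is isotropic with entry 1 at place 5, so its middle entries determine it. They can be
written into the off-diagonal block of a unipotent matrix that fixes the first two frame vectors and
hence the bivector at place 0. -/
lemma IsSpecialSigma.isWedge_of_one {P : Matrix (Fin 6) (Fin 6) ℝ} (h : IsSpecialSigma P)
    (h0 : ∀ i, P i 0 = (1 : Matrix (Fin 6) (Fin 6) ℝ) i 0) : IsWedge P := by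
  have e5 := h.row_of_col h0 5
  have e := h.form_expand 5 5
  simp at e5
  rw [e5] at e
  simp at e
  obtain ⟨P', hP', hw, hc, -⟩ := h.exists_reduce
    (k := !![1, 0, P 2 5, -P 1 5; 0, 1, -P 4 5, -P 3 5; 0, 0, 1, 0; 0, 0, 0, 1])
    (by simp [Matrix.det_succ_row_zero, Fin.sum_univ_succ, Fin.succAbove])
  refine hw (hP'.isWedge_of_two (hc 0 0 ?_) (hc 5 5 ?_))
  · intro i; rw [h0, Matrix.one_apply]; fin_cases i <;> simp [wedge2, petrovPair]
  · intro i; fin_cases i <;> simp [wedge2, petrovPair, e5]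
    linarith

/-- The identity component of the isometry group of `Σ` and its negative come from `SL(4)`. -/
theorem IsSpecialSigma.isWedge {P : Matrix (Fin 6) (Fin 6) ℝ} (h : IsSpecialSigma P) :
    IsWedge P := by
  -- Isotropy of column 0 is the Plücker relation, so the column is a decomposable bivector. With a
  -- non-zero entry at place 0 its two factors can be written down as the first two columns of a
  -- matrix in `SL(4)`.
  have key : ∀ {P : Matrix (Fin 6) (Fin 6) ℝ}, IsSpecialSigma P → P 0 0 ≠ 0 → IsWedge P := by
    intro P h hx
    have e := h.form_expand 0 0
    simp at e
    obtain ⟨P', hP', hw, hc, -⟩ := h.exists_reduce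
      (k := !![1, 0, 0, 0; 0, P 0 0, 0, 0; -P 3 0 / P 0 0, P 1 0, 1, 0;
        P 4 0 / P 0 0, P 2 0, 0, 1 / P 0 0])
      (by simp [Matrix.det_succ_row_zero, Fin.sum_univ_succ, Fin.succAbove, hx])
    refine hw (hP'.isWedge_of_one (hc 0 0 ?_))
    intro i; fin_cases i <;> simp [wedge2, petrovPair] <;> field_simp
    linarith
  have red : ∀ k : Matrix (Fin 4) (Fin 4) ℝ, k.det = 1 → (wedge2 k * P) 0 0 ≠ 0 → IsWedge P := by
    intro k hk hne
    have hkd : k.det ≠ 0 := by rw [hk]; exact one_ne_zero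
    have hk1 : (k⁻¹).det = 1 := by rw [Matrix.det_nonsing_inv, hk, Ring.inverse_one]
    have := (key (h.wedge2_mul hk) hne).mul_left hk1
    rwa [← Matrix.mul_assoc, wedge2_inv_mul hkd, one_mul] at this
  -- Otherwise an even permutation of the frame brings a non-zero entry to place 0.
  by_cases hx0 : P 0 0 ≠ 0
  · exact key h hx0
  by_cases hx1 : P 1 0 ≠ 0
  · refine red !![1, 0, 0, 0; 0, 0, 1, 0; 0, 0, 0, 1; 0, 1, 0, 0]
      (by simp [Matrix.det_succ_row_zero, Fin.sum_univ_succ, Fin.succAbove]) ?_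
    simpa [Matrix.mul_apply, Fin.sum_univ_six, wedge2, petrovPair] using hx1
  by_cases hx2 : P 2 0 ≠ 0
  · refine red !![1, 0, 0, 0; 0, 0, 0, 1; 0, 1, 0, 0; 0, 0, 1, 0]
      (by simp [Matrix.det_succ_row_zero, Fin.sum_univ_succ, Fin.succAbove]) ?_
    simpa [Matrix.mul_apply, Fin.sum_univ_six, wedge2, petrovPair] using hx2
  by_cases hx3 : P 3 0 ≠ 0
  · refine red !![0, 1, 0, 0; 0, 0, 1, 0; 1, 0, 0, 0; 0, 0, 0, 1]
      (by simp [Matrix.det_succ_row_zero, Fin.sum_univ_succ, Fin.succAbove]) ?_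
    simpa [Matrix.mul_apply, Fin.sum_univ_six, wedge2, petrovPair] using hx3
  by_cases hx4 : P 4 0 ≠ 0
  · refine red !![0, 0, 0, 1; 0, 1, 0, 0; 1, 0, 0, 0; 0, 0, 1, 0]
      (by simp [Matrix.det_succ_row_zero, Fin.sum_univ_succ, Fin.succAbove]; norm_num) ?_
    simpa [Matrix.mul_apply, Fin.sum_univ_six, wedge2, petrovPair] using hx4
  by_cases hx5 : P 5 0 ≠ 0
  · refine red !![0, 0, 1, 0; 0, 0, 0, 1; 1, 0, 0, 0; 0, 1, 0, 0]
      (by simp [Matrix.det_succ_row_zero, Fin.sum_univ_succ, Fin.succAbove]) ?_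
    simpa [Matrix.mul_apply, Fin.sum_univ_six, wedge2, petrovPair] using hx5
  push Not at hx0 hx1 hx2 hx3 hx4 hx5
  have e := h.form_expand 0 5
  rw [hx0, hx1, hx2, hx3, hx4, hx5] at e
  simp at e

end SpecialOrthogonal

/-! ### Petrov matrices under changes of frame, and the endomorphism `J` -/

section AreaTensor

variable {V : Type*} [AddCommGroup V] [Module ℝ V]

/-- A tensor of rank four with the index symmetries of an area metric. -/
structure IsAreaTensor (F : V → V → V → V → ℝ) : Prop where
  add : ∀ X X' Y A B, F (X + X') Y A B = F X Y A B + F X' Y A B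
  smul : ∀ (c : ℝ) X Y A B, F (c • X) Y A B = c * F X Y A B
  antisymm : ∀ X Y A B, F X Y A B = -F Y X A B
  pair_symm : ∀ X Y A B, F X Y A B = F A B X Y

/-- The value of an alternating bilinear map in a new frame. -/
lemma bilin_expand {W : Type*} [AddCommGroup W] [Module ℝ W] (f : V →ₗ[ℝ] V →ₗ[ℝ] W)
    (hf : ∀ x y, f x y = -f y x) (b : Fin 4 → V) (g : Matrix (Fin 4) (Fin 4) ℝ) (i j : Fin 4) :
    f (∑ k, g k i • b k) (∑ k, g k j • b k) = ∑ K : Fin 6,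
      (g (petrovPair K).1 i * g (petrovPair K).2 j - g (petrovPair K).2 i * g (petrovPair K).1 j) •
        f (b (petrovPair K).1) (b (petrovPair K).2) := by
  have h0 : ∀ x, f x x = 0 := fun x => by
    have h := hf x x
    rw [eq_neg_iff_add_eq_zero, ← two_smul ℝ] at h
    exact (smul_eq_zero.1 h).resolve_left two_ne_zero
  simp only [Fin.sum_univ_four, Fin.sum_univ_six, petrovPair, map_add, map_smul,
    LinearMap.add_apply, LinearMap.smul_apply, h0, smul_zero]
  simp
  rw [hf (b 1) (b 0), hf (b 2) (b 0), hf (b 3) (b 0), hf (b 2) (b 1), hf (b 1) (b 3),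
    hf (b 3) (b 2)]
  module

/-- The tensor as a bilinear map of its first two arguments. -/
def IsAreaTensor.bilin {F : V → V → V → V → ℝ} (h : IsAreaTensor F) (A B : V) :
    V →ₗ[ℝ] V →ₗ[ℝ] ℝ :=
  LinearMap.mk₂ ℝ (fun X Y => F X Y A B) (fun X X' Y => h.add X X' Y A B)
    (fun c X Y => h.smul c X Y A B)
    (fun X Y Y' => by rw [h.antisymm X, h.add, h.antisymm X, h.antisymm X]; ring)
    (fun c X Y => by rw [h.antisymm X, h.smul, h.antisymm X]; simp)

lemma IsAreaTensor.expand {F : V → V → V → V → ℝ} (h : IsAreaTensor F) (b : Fin 4 → V)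
    (g : Matrix (Fin 4) (Fin 4) ℝ) (i j : Fin 4) (A B : V) :
    F (∑ k, g k i • b k) (∑ k, g k j • b k) A B = ∑ K : Fin 6,
      (g (petrovPair K).1 i * g (petrovPair K).2 j - g (petrovPair K).2 i * g (petrovPair K).1 j) *
        F (b (petrovPair K).1) (b (petrovPair K).2) A B :=
  bilin_expand (h.bilin A B) (fun x y => h.antisymm x y A B) b g i j

lemma IsAreaTensor.petrov_transpose {F : V → V → V → V → ℝ} (h : IsAreaTensor F)
    (b : Basis (Fin 4) ℝ V) : (petrov F b).transpose = petrov F b := by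
  ext A B
  exact h.pair_symm _ _ _ _

/-- Antisymmetry makes a change of frame act on an index pair by `Λ²`; the pair symmetry transfers
the expansion from the first two arguments to the last two. -/
lemma IsAreaTensor.petrov_change {F : V → V → V → V → ℝ} (h : IsAreaTensor F)
    (b b' : Basis (Fin 4) ℝ V) :
    petrov F b' = (wedge2 (b.toMatrix b')).transpose * petrov F b * wedge2 (b.toMatrix b') := by
  have hb : ∀ j, b' j = ∑ k, b.toMatrix b' k j • b k := fun j => (b.sum_toMatrix_smul_self b' j).symm
  ext A B
  rw [Matrix.mul_assoc, Matrix.mul_apply]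
  simp only [petrov, Matrix.of_apply, Matrix.mul_apply, Matrix.transpose_apply]
  rw [hb, hb (petrovPair A).2, h.expand]
  refine Finset.sum_congr rfl fun K _ => ?_
  rw [h.pair_symm, hb, hb (petrovPair B).2, h.expand]
  congr 1
  refine Finset.sum_congr rfl fun K' _ => ?_
  rw [h.pair_symm, mul_comm]
  rfl

/-- With the pair [31] in place of [13] every index pair followed by its complement is an even
permutation, so `ε` becomes `Σ` without signs. -/
lemma petrov_areaVolumeForm (F : V → V → V → V → ℝ) (b : Basis (Fin 4) ℝ V) :
    petrov (fun X Y A B => areaVolumeForm F b ![X, Y, A, B]) b =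
      |(petrov F b).det| ^ (1 / 6 : ℝ) • sigmaMatrix := by
  have key : ∀ i j k l : Fin 4, b.det ![b i, b j, b k, b l] =
      Matrix.det (Matrix.of fun r c => if ![i, j, k, l] c = r then (1 : ℝ) else 0) := by
    intro i j k l
    rw [Basis.det_apply]
    congr 1
    ext r c
    rw [Basis.toMatrix_apply, Matrix.of_apply]
    have hr : ∀ a, b.repr (b a) r = if a = r then 1 else 0 := fun a => by
      rw [Basis.repr_self, Finsupp.single_apply]
    fin_cases c <;> exact hr _
  ext A B
  simp only [petrov, areaVolumeForm, Matrix.of_apply, AlternatingMap.smul_apply, Matrix.smul_apply]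
  congr 1
  rw [key, Matrix.det_succ_row_zero]
  simp only [Matrix.det_fin_three, Fin.sum_univ_four]
  fin_cases A <;> fin_cases B <;> simp [petrovPair, sigmaMatrix, Fin.succAbove]

lemma endoJ_eq (F : V → V → V → V → ℝ) (b : Basis (Fin 4) ℝ V) (h : (petrov F b).det ≠ 0) :
    endoJ F b = (|(petrov F b).det| ^ (1 / 6 : ℝ))⁻¹ • (sigmaMatrix * petrov F b) := by
  have hc : |(petrov F b).det| ^ (1 / 6 : ℝ) ≠ 0 := (Real.rpow_pos_of_pos (abs_pos.2 h) _).ne'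
  rw [endoJ, petrov_areaVolumeForm, Matrix.inv_eq_right_inv
    (B := (|(petrov F b).det| ^ (1 / 6 : ℝ))⁻¹ • sigmaMatrix), Matrix.smul_mul]
  rw [Matrix.smul_mul, Matrix.mul_smul, smul_smul, mul_inv_cancel₀ hc, one_smul,
    sigmaMatrix_mul_self]

/-- The bivectors `b i ∧ b j` in Petrov order. -/
noncomputable def petrovBivector (b : Basis (Fin 4) ℝ V) (K : Fin 6) : ⋀[ℝ]^2 V :=
  exteriorPower.ιMulti ℝ 2 ![b (petrovPair K).1, b (petrovPair K).2]

lemma span_petrovBivector (b : Basis (Fin 4) ℝ V) :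
    Submodule.span ℝ (Set.range (petrovBivector b)) = ⊤ := by
  rw [eq_top_iff, ← exteriorPower.ιMulti_span, Submodule.span_le]
  rintro _ ⟨v, rfl⟩
  have hupd : ∀ x y z : V, (Function.update ![x, y] 0 z = ![z, y]) ∧
      (Function.update ![x, y] 1 z = ![x, z]) := fun x y z => by
    constructor <;> ext i <;> fin_cases i <;> simp
  let f : V →ₗ[ℝ] V →ₗ[ℝ] ⋀[ℝ]^2 V := LinearMap.mk₂ ℝ
    (fun x y => exteriorPower.ιMulti ℝ 2 ![x, y])
    (fun x x' y => by
      have := (exteriorPower.ιMulti ℝ 2 (M := V)).map_update_add ![x, y] 0 x x'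
      simpa only [(hupd _ _ _).1] using this)
    (fun c x y => by
      have := (exteriorPower.ιMulti ℝ 2 (M := V)).map_update_smul ![x, y] 0 c x
      simpa only [(hupd _ _ _).1] using this)
    (fun x y y' => by
      have := (exteriorPower.ιMulti ℝ 2 (M := V)).map_update_add ![x, y] 1 y y'
      simpa only [(hupd _ _ _).2] using this)
    (fun c x y => by
      have := (exteriorPower.ιMulti ℝ 2 (M := V)).map_update_smul ![x, y] 1 c y
      simpa only [(hupd _ _ _).2] using this)
  have hf : ∀ x y, f x y = -f y x := fun x y => by
    have := (exteriorPower.ιMulti ℝ 2 (M := V)).map_swap ![y, x] (i := 0) (j := 1) (by decide)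
    change exteriorPower.ιMulti ℝ 2 ![x, y] = _
    rw [show f y x = exteriorPower.ιMulti ℝ 2 ![y, x] from rfl, ← this]
    congr 1
    ext i; fin_cases i <;> simp
  -- The zeros only pad the two vectors to a 4×4 coordinate matrix, as `bilin_expand` expects.
  have hv : exteriorPower.ιMulti ℝ 2 v =
      f (∑ k, b.toMatrix ![v 0, v 1, 0, 0] k 0 • b k)
        (∑ k, b.toMatrix ![v 0, v 1, 0, 0] k 1 • b k) := by
    rw [b.sum_toMatrix_smul_self, b.sum_toMatrix_smul_self]
    change _ = exteriorPower.ιMulti ℝ 2 ![v 0, v 1]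
    congr 1
    ext i; fin_cases i <;> rfl
  rw [hv, bilin_expand f hf]
  exact Submodule.sum_mem _ fun K _ => Submodule.smul_mem _ _ (Submodule.subset_span ⟨K, rfl⟩)

lemma linearIndependent_petrovBivector (b : Basis (Fin 4) ℝ V) :
    LinearIndependent ℝ (petrovBivector b) := by
  have : Module.Finite ℝ V := Module.Finite.of_basis b
  refine linearIndependent_of_top_le_span_of_card_eq_finrank (span_petrovBivector b).ge ?_
  rw [exteriorPower.finrank_eq, finrank_eq_card_basis b]
  rfl

/-- A kernel vector of the Petrov matrix gives the coordinates of a bivector that `Ghat` sends to 0.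
-/
lemma IsAreaTensor.det_petrov_ne_zero {F : V → V → V → V → ℝ} (h : IsAreaTensor F)
    (hG : ∃ Ghat : (⋀[ℝ]^2 V) ≃ₗ[ℝ] Module.Dual ℝ (⋀[ℝ]^2 V), ∀ X Y A B : V,
      Ghat (exteriorPower.ιMulti ℝ 2 ![X, Y]) (exteriorPower.ιMulti ℝ 2 ![A, B]) = F X Y A B)
    (b : Basis (Fin 4) ℝ V) : (petrov F b).det ≠ 0 := by
  intro hd
  obtain ⟨Ghat, hG⟩ := hG
  obtain ⟨v, hv, hMv⟩ := Matrix.exists_mulVec_eq_zero_iff.2 hd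
  have hw : Ghat (∑ K, v K • petrovBivector b K) = 0 := by
    refine LinearMap.ext_on_range (span_petrovBivector b) fun A => ?_
    rw [map_sum, LinearMap.sum_apply, LinearMap.zero_apply, ← show (petrov F b).mulVec v A = 0 by
      rw [hMv]; rfl, Matrix.mulVec, dotProduct]
    refine Finset.sum_congr rfl fun K _ => ?_
    rw [map_smul, LinearMap.smul_apply, smul_eq_mul, mul_comm]
    congr 1
    rw [petrovBivector, petrovBivector, hG, h.pair_symm]
    rfl
  have hw0 := (LinearEquiv.map_eq_zero_iff Ghat).1 hw
  exact hv (funext (Fintype.linearIndependent_iff.1 (linearIndependent_petrovBivector b) v hw0))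

/-- A frame with a given matrix of coordinates. -/
lemma exists_basis_toMatrix_eq (b : Basis (Fin 4) ℝ V) {g : Matrix (Fin 4) (Fin 4) ℝ}
    (hg : g.det ≠ 0) : ∃ b' : Basis (Fin 4) ℝ V, b.toMatrix b' = g := by
  refine ⟨b.map (Matrix.toLinearEquiv b g (isUnit_iff_ne_zero.2 hg)), ?_⟩
  ext i j
  rw [Basis.toMatrix_apply, Basis.map_apply]
  change b.repr (Matrix.toLin b b g (b j)) i = g i j
  rw [Matrix.toLin_self, map_sum, Finsupp.finsetSum_apply]
  simp [Finsupp.single_apply]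

lemma orientation_eq_iff (b b' : Basis (Fin 4) ℝ V) :
    b.orientation = b'.orientation ↔ 0 < (b.toMatrix b').det := by
  rw [Basis.orientation_eq_iff_det_pos, Basis.det_apply]

end AreaTensor

section AreaMetric

variable {M : Type*} [TopologicalSpace M] [ChartedSpace (EuclideanSpace ℝ (Fin 4)) M]
  [IsManifold (𝓡 4) ∞ M] (G : AreaMetric M) (p : M)

lemma AreaMetric.isAreaTensor : IsAreaTensor (G.at p) where
  add X X' Y A B := by
    have := (G.toFun p).map_update_add ![X, Y, A, B] 0 X X'
    have hupd : ∀ z, Function.update ![X, Y, A, B] 0 z = ![z, Y, A, B] := fun z => by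
      ext i; fin_cases i <;> simp
    simp only [hupd] at this
    exact this
  smul c X Y A B := by
    have := (G.toFun p).map_update_smul ![X, Y, A, B] 0 c X
    have hupd : ∀ z, Function.update ![X, Y, A, B] 0 z = ![z, Y, A, B] := fun z => by
      ext i; fin_cases i <;> simp
    simp only [hupd] at this
    exact this
  antisymm := G.antisymm p
  pair_symm := G.pair_symm p

lemma AreaMetric.det_petrov_ne_zero (b : Basis (Fin 4) ℝ (TangentSpace (𝓡 4) p)) :
    (petrov (G.at p) b).det ≠ 0 :=
  (G.isAreaTensor p).det_petrov_ne_zero (G.invertible p) b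

end AreaMetric

/-! ### Transport of chain families along isometries -/

section Transport

variable {LP : List (ℂ × ℕ)} {LR : List (ℝ × ℕ × ℤˣ)}
variable {E : Type*} [AddCommGroup E] [Module ℂ E] [StarAddMonoid E]
variable {E' : Type*} [AddCommGroup E'] [Module ℂ E'] [StarAddMonoid E']

/-- Isometries that commute with the conjugations transport chain families. -/
lemma IsChainFamily.map {B : LinearMap.BilinForm ℂ E} {J : Module.End ℂ E}
    {B' : LinearMap.BilinForm ℂ E'} {J' : Module.End ℂ E'} {W : ChainIndex LP LR → E}
    (hW : IsChainFamily B J W) (P : E →ₗ[ℂ] E') (hP : ∀ x y, B' (P x) (P y) = B x y)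
    (hPJ : ∀ x, P (J x) = J' (P x)) (hPs : ∀ x, P (star x) = star (P x)) :
    IsChainFamily B' J' fun i => P (W i) := by
  have hpow : ∀ (z : ℂ) (j : ℕ) (x : E), ((J' - z • 1) ^ j) (P x) = P (((J - z • 1) ^ j) x) := by
    intro z j
    induction j with
    | zero => intro x; rfl
    | succ j ih =>
      intro x
      rw [pow_succ, Module.End.mul_apply, pow_succ, Module.End.mul_apply, ← ih]
      simp [hPJ]
  have haeval : ∀ (p : ℂ[X]) (x : E), aeval J' p (P x) = P (aeval J p x) := by
    intro p
    induction p using Polynomial.induction_on' with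
    | add p q hp hq => intro x; simp [hp, hq]
    | monomial n a =>
      intro x
      have h : (J' ^ n) (P x) = P ((J ^ n) x) := by simpa using hpow 0 n x
      simp only [aeval_monomial, Module.End.mul_apply, h]
      simp [Algebra.algebraMap_eq_smul_one]
  refine ⟨fun i => ⟨(hW.chain i).pos, ?_, fun j hj => ?_⟩, fun i j hij p => ?_, fun i => ?_⟩
  · rw [hpow, (hW.chain i).pow_eq_zero, map_zero]
  · rw [hpow, hP, (hW.chain i).pairing j hj]
  · rw [haeval, hP, hW.orth i j hij p]
  · rw [← hPs, hW.star_eq]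

end Transport

/-! ### Real matrices, isometries and congruence -/

section RealMatrices

lemma complexEnd_mul (A B : Matrix (Fin 6) (Fin 6) ℝ) :
    complexEnd (A * B) = complexEnd A * complexEnd B := by
  rw [complexEnd, complexEnd, complexEnd, Module.End.mul_eq_comp, ← Matrix.toLin'_mul]
  congr 1
  exact Matrix.map_mul (f := Complex.ofRealHom)

lemma complexEnd_stdVec_apply (A : Matrix (Fin 6) (Fin 6) ℝ) (i j : Fin 6) :
    complexEnd A (stdVec j) i = (A i j : ℂ) := by
  rw [complexEnd_apply, Finset.sum_eq_single j]
  · simp [stdVec]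
  · intro k _ hk
    rw [stdVec, Pi.single_eq_of_ne hk, mul_zero]
  · simp

lemma complexEnd_injective : Function.Injective complexEnd := by
  intro A B h
  ext i j
  have := congrFun (congrArg (fun f : Module.End ℂ (Fin 6 → ℂ) => f (stdVec j)) h) i
  simpa only [complexEnd_stdVec_apply, Complex.ofReal_inj] using this

lemma complexEnd_star (A : Matrix (Fin 6) (Fin 6) ℝ) (x : Fin 6 → ℂ) :
    complexEnd A (star x) = star (complexEnd A x) := by
  ext i
  simp [complexEnd_apply]

lemma det_complexEnd (A : Matrix (Fin 6) (Fin 6) ℝ) :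
    LinearMap.det (complexEnd A) = (A.det : ℂ) := by
  rw [complexEnd, LinearMap.det_toLin']
  exact (RingHom.map_det Complex.ofRealHom A).symm

lemma exists_complexEnd_eq (P : Module.End ℂ (Fin 6 → ℂ)) (hP : ∀ x, P (star x) = star (P x)) :
    ∃ Q : Matrix (Fin 6) (Fin 6) ℝ, complexEnd Q = P := by
  refine ⟨Matrix.of fun i j => (P (stdVec j) i).re, ?_⟩
  refine (Pi.basisFun ℂ (Fin 6)).ext fun j => ?_
  rw [Pi.basisFun_apply]
  change complexEnd _ (stdVec j) = P (stdVec j)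
  ext i
  rw [complexEnd_stdVec_apply, Matrix.of_apply]
  have := congrFun (hP (stdVec j)) i
  rw [star_stdVec] at this
  exact (Complex.conj_eq_iff_re.1 this.symm)

lemma sigma_iff_isometry (Q : Matrix (Fin 6) (Fin 6) ℝ) :
    Q.transpose * sigmaMatrix * Q = sigmaMatrix ↔
      ∀ x y, sigmaForm (complexEnd Q x) (complexEnd Q y) = sigmaForm x y := by
  have key : ∀ i j, sigmaForm (complexEnd Q (stdVec i)) (complexEnd Q (stdVec j)) =
      (((Q.transpose * sigmaMatrix * Q) i j : ℝ) : ℂ) := by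
    intro i j
    rw [sigmaForm_apply, Matrix.mul_assoc, Matrix.mul_apply]
    simp only [complexEnd_stdVec_apply, sigmaMatrix_mul_apply, Matrix.transpose_apply]
    push_cast
    rfl
  have key' : ∀ i j, sigmaForm (stdVec i) (stdVec j) = ((sigmaMatrix i j : ℝ) : ℂ) := by
    intro i j
    rw [sigmaForm_stdVec, sigmaMatrix_apply]
    split_ifs <;> simp
  constructor
  · intro h x y
    have h2 : sigmaForm.compl₁₂ (complexEnd Q) (complexEnd Q) = sigmaForm := by
      refine (Pi.basisFun ℂ (Fin 6)).ext fun i => (Pi.basisFun ℂ (Fin 6)).ext fun j => ?_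
      rw [Pi.basisFun_apply, Pi.basisFun_apply]
      change sigmaForm (complexEnd Q (stdVec i)) (complexEnd Q (stdVec j)) =
        sigmaForm (stdVec i) (stdVec j)
      rw [key, key', h]
    exact congrFun (congrArg DFunLike.coe (congrFun (congrArg DFunLike.coe h2) x)) y
  · intro h
    ext i j
    have := h (stdVec i) (stdVec j)
    rw [key, key'] at this
    exact_mod_cast this

/-- A similarity by an isometry of `Σ` is a congruence. -/
lemma congruent_of_commute {A N Q : Matrix (Fin 6) (Fin 6) ℝ}
    (hQ : Q.transpose * sigmaMatrix * Q = sigmaMatrix)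
    (h : Q * (sigmaMatrix * N) = sigmaMatrix * A * Q) : Q.transpose * A * Q = N := by
  calc Q.transpose * A * Q = Q.transpose * sigmaMatrix * (sigmaMatrix * A * Q) := by
        simp only [← Matrix.mul_assoc]
        rw [Matrix.mul_assoc _ sigmaMatrix sigmaMatrix, sigmaMatrix_mul_self, mul_one]
    _ = Q.transpose * sigmaMatrix * Q * (sigmaMatrix * N) := by rw [← h, ← Matrix.mul_assoc]
    _ = N := by rw [hQ, ← Matrix.mul_assoc, sigmaMatrix_mul_self, one_mul]

/-- A similitude has the inverse `d⁻¹ Σ Qᵀ Σ`, which turns congruence of symmetric matrices into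
similarity of the endomorphisms `ΣA` and `ΣN` up to the factor `d`. For `wedge2 g` the factor is
`det g`. -/
lemma commute_of_congruent {A N Q : Matrix (Fin 6) (Fin 6) ℝ} {d : ℝ} (hd : d ≠ 0)
    (hQ : Q.transpose * sigmaMatrix * Q = d • sigmaMatrix)
    (h : Q.transpose * A * Q = N) : Q * (sigmaMatrix * N) = d • (sigmaMatrix * A * Q) := by
  have hi : (d⁻¹ • (sigmaMatrix * Q.transpose * sigmaMatrix)) * Q = 1 := by
    rw [Matrix.smul_mul, Matrix.mul_assoc, Matrix.mul_assoc, ← Matrix.mul_assoc Q.transpose, hQ,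
      Matrix.mul_smul, sigmaMatrix_mul_self, smul_smul, inv_mul_cancel₀ hd, one_smul]
  have hi' := mul_eq_one_comm.1 hi
  rw [← h]
  calc Q * (sigmaMatrix * (Q.transpose * A * Q))
      = d • ((Q * (d⁻¹ • (sigmaMatrix * Q.transpose * sigmaMatrix))) * (sigmaMatrix * A * Q)) := by
        rw [Matrix.mul_smul, Matrix.smul_mul, smul_smul, mul_inv_cancel₀ hd, one_smul]
        simp only [← Matrix.mul_assoc]
        rw [Matrix.mul_assoc _ sigmaMatrix sigmaMatrix, sigmaMatrix_mul_self, mul_one]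
    _ = d • (sigmaMatrix * A * Q) := by rw [hi', one_mul]

end RealMatrices

/-! ### Existence and uniqueness of the family under all isometries of `Σ` -/

section Families

/-- The labels of the non-real blocks of a normal form. -/
noncomputable def NormalFamily.pairLabels (f : NormalFamily) (θ : f.metaclass.ScalarIndex → ℝ) :
    List (ℂ × ℕ) :=
  f.1.1.pairLabels (fun i => θ (.inl i)) fun i => θ (.inr (.inl i))

/-- The labels of the real blocks of a normal form. -/
noncomputable def NormalFamily.realLabels (f : NormalFamily) (θ : f.metaclass.ScalarIndex → ℝ) :
    List (ℝ × ℕ × ℤˣ) :=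
  f.1.1.realLabels f.1.2 fun i => θ (.inr (.inr i))

namespace NormalFamily

variable {f : NormalFamily} {θ : f.metaclass.ScalarIndex → ℝ}

lemma form_transpose (f : NormalFamily) (θ : f.metaclass.ScalarIndex → ℝ) :
    (f.form θ).transpose = f.form θ :=
  Metaclass.normalForm_transpose _ _ _ _ _

lemma hasLabels_form (hτ : ∀ i, 0 < θ (.inr (.inl i))) :
    HasLabels sigmaForm (complexEnd (sigmaMatrix * f.form θ)) ⊤ (f.pairLabels θ) (f.realLabels θ) :=
  Metaclass.hasLabels_normalForm _ _ _ _ hτ _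

lemma pairLabels_map (f : NormalFamily) (θ : f.metaclass.ScalarIndex → ℝ) :
    (f.pairLabels θ).map Prod.snd = List.ofFn f.1.1.pairSize := by
  rw [pairLabels, Metaclass.pairLabels, List.map_ofFn]
  rfl

lemma realLabels_map (f : NormalFamily) (θ : f.metaclass.ScalarIndex → ℝ) :
    (f.realLabels θ).map Prod.snd = List.ofFn (f.1.1.realShape f.1.2) := by
  rw [realLabels, Metaclass.realLabels, List.map_ofFn]
  rfl

lemma coe_pairLabels (f : NormalFamily) (θ : f.metaclass.ScalarIndex → ℝ) :
    ((f.pairLabels θ).map Prod.snd : Multiset ℕ) = f.metaclass.segre.pairs := by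
  rw [pairLabels_map]
  exact Metaclass.coe_ofFn_pairSize _

lemma coe_realLabels (f : NormalFamily) (θ : f.metaclass.ScalarIndex → ℝ) :
    ((f.realLabels θ).map fun r => r.2.1 : Multiset ℕ) = f.metaclass.segre.reals := by
  have : ((f.realLabels θ).map fun r => r.2.1) = ((f.realLabels θ).map Prod.snd).map Prod.fst := by
    rw [List.map_map]; rfl
  rw [this, realLabels_map]
  exact Metaclass.coe_ofFn_realShape _ _

end NormalFamily

lemma Metaclass.segre_sum (m : Metaclass) : 2 * m.segre.pairs.sum + m.segre.reals.sum = 6 := by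
  cases m <;> rfl

lemma Metaclass.zero_notMem (m : Metaclass) : 0 ∉ m.segre.pairs ∧ 0 ∉ m.segre.reals := by
  cases m <;> decide

namespace NormalFamily

lemma totalSize_eq (f : NormalFamily) (θ : f.metaclass.ScalarIndex → ℝ) :
    totalSize (f.pairLabels θ) (f.realLabels θ) = 6 := by
  rw [totalSize, ← Multiset.sum_coe, ← Multiset.sum_coe, coe_pairLabels, coe_realLabels]
  exact Metaclass.segre_sum _

variable {f : NormalFamily} {θ : f.metaclass.ScalarIndex → ℝ}

lemma hasSegreType_form (hτ : ∀ i, 0 < θ (.inr (.inl i))) :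
    HasSegreType (sigmaMatrix * f.form θ) f.metaclass.segre := by
  have hB := realSelfAdjoint_sigma (f.form_transpose θ)
  obtain ⟨him, W, hW⟩ := (hasLabels_form hτ).exists_isChainFamily hB
  have := hW.hasSegreType hB (f.totalSize_eq θ) him
  rwa [coe_pairLabels, coe_realLabels] at this

/-- Two normal forms that are congruent by an isometry of `Σ` belong to the same family. -/
theorem eq_of_congruent {f' : NormalFamily} {θ' : f'.metaclass.ScalarIndex → ℝ}
    (hτ : ∀ i, 0 < θ (.inr (.inl i))) (hτ' : ∀ i, 0 < θ' (.inr (.inl i)))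
    {P : Matrix (Fin 6) (Fin 6) ℝ} (hP : P.transpose * sigmaMatrix * P = sigmaMatrix)
    (h : P.transpose * f.form θ * P = f'.form θ') : f' = f := by
  have hB := realSelfAdjoint_sigma (f.form_transpose θ)
  have hB' := realSelfAdjoint_sigma (f'.form_transpose θ')
  obtain ⟨him, W, hW⟩ := (hasLabels_form hτ).exists_isChainFamily hB
  obtain ⟨him', W', hW'⟩ := (hasLabels_form hτ').exists_isChainFamily hB'
  have hcomm : P * (sigmaMatrix * f'.form θ') = sigmaMatrix * f.form θ * P := by
    rw [commute_of_congruent one_ne_zero (by rw [hP, one_smul]) h, one_smul]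
  -- Moving the chains of the second form by `P` gives two chain families for one endomorphism,
  -- which can be compared.
  have hW'' := hW'.map (B' := sigmaForm) (J' := complexEnd (sigmaMatrix * f.form θ)) (complexEnd P)
    ((sigma_iff_isometry P).1 hP) (fun x => by
      rw [← Module.End.mul_apply, ← complexEnd_mul, hcomm, complexEnd_mul, Module.End.mul_apply])
    (complexEnd_star P)
  have h6 : ∀ (f : NormalFamily) θ, finrank ℂ (Fin 6 → ℂ) =
      totalSize (f.pairLabels θ) (f.realLabels θ) := fun f θ => by rw [totalSize_eq]; simp
  -- Sizes and signs of the real blocks come from this permutation, the sizes of the non-real ones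
  -- from the Segré type below.
  have hperm := hW''.real_perm hB (h6 f' θ') him' hW (h6 f θ) him
  have hs := hW''.hasSegreType hB (f'.totalSize_eq θ') him'
  rw [coe_pairLabels, coe_realLabels] at hs
  have hseg := hs.unique (hasSegreType_form hτ) f'.metaclass.zero_notMem.1
    f'.metaclass.zero_notMem.2 f.metaclass.zero_notMem.1 f.metaclass.zero_notMem.2
  refine eq_of_perm f' f ?_ ?_
  · rw [← Multiset.coe_eq_coe, Metaclass.coe_ofFn_pairSize, Metaclass.coe_ofFn_pairSize]
    exact congrArg SegreSymbol.pairs hseg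
  · rw [← realLabels_map f' θ', ← realLabels_map f θ]
    exact hperm.map _

/-- If some real block has odd size, the normal form has an isometry of determinant `-1`. -/
lemma exists_det_eq_neg_one (hτ : ∀ i, 0 < θ (.inr (.inl i)))
    (hodd : ¬∀ k ∈ f.metaclass.segre.reals, Even k) :
    ∃ Q : Matrix (Fin 6) (Fin 6) ℝ, Q.transpose * sigmaMatrix * Q = sigmaMatrix ∧
      Q.transpose * f.form θ * Q = f.form θ ∧ Q.det = -1 := by
  have hB := realSelfAdjoint_sigma (f.form_transpose θ)
  obtain ⟨him, W, hW⟩ := (hasLabels_form hτ).exists_isChainFamily hB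
  have hr : ∃ r ∈ f.realLabels θ, Odd r.2.1 := by
    push Not at hodd
    obtain ⟨k, hk, hk'⟩ := hodd
    rw [← coe_realLabels f θ, Multiset.mem_coe, List.mem_map] at hk
    obtain ⟨r, hr, rfl⟩ := hk
    exact ⟨r, hr, by simpa using hk'⟩
  obtain ⟨r, hr, hro⟩ := hr
  obtain ⟨P, hP, hPJ, hPs, hPd⟩ := hW.exists_det_neg_one hB (by rw [totalSize_eq]; simp) hr hro
  obtain ⟨Q, hQ⟩ := exists_complexEnd_eq (P : (Fin 6 → ℂ) →ₗ[ℂ] (Fin 6 → ℂ)) hPs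
  have hQs : Q.transpose * sigmaMatrix * Q = sigmaMatrix :=
    (sigma_iff_isometry Q).2 fun x y => by rw [hQ]; exact hP x y
  refine ⟨Q, hQs, congruent_of_commute hQs (complexEnd_injective ?_), ?_⟩
  · rw [complexEnd_mul Q, complexEnd_mul _ Q, hQ]
    exact LinearMap.ext hPJ
  · rw [← hQ, det_complexEnd] at hPd
    exact_mod_cast hPd

end NormalFamily

lemma List.exists_eq_ofFn_prod {α β : Type*} {n : ℕ} {g : Fin n → β} {l : List (α × β)}
    (h : l.map Prod.snd = List.ofFn g) : ∃ a : Fin n → α, l = List.ofFn fun i => (a i, g i) := by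
  have hn : l.length = n := by simpa using congrArg List.length h
  subst hn
  refine ⟨fun i => (l.get i).1, ?_⟩
  have hg : (fun i => (l.get i).2) = g := by
    refine List.ofFn_injective ?_
    rw [← h]
    conv_rhs => rw [← List.ofFn_get l, List.map_ofFn]
    rfl
  rw [← hg]
  exact (List.ofFn_get l).symm

/-- A list of labels of the right shape is that of a normal form. -/
lemma NormalFamily.exists_labels_eq (f : NormalFamily) {LP : List (ℂ × ℕ)}
    {LR : List (ℝ × ℕ × ℤˣ)} (hP : LP.map Prod.snd = List.ofFn f.1.1.pairSize)
    (hR : LR.map Prod.snd = List.ofFn (f.1.1.realShape f.1.2)) (him : ∀ p ∈ LP, 0 < p.1.im) :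
    ∃ θ : f.metaclass.ScalarIndex → ℝ, (∀ i, 0 < θ (.inr (.inl i))) ∧
      f.pairLabels θ = LP ∧ f.realLabels θ = LR := by
  obtain ⟨z, rfl⟩ := List.exists_eq_ofFn_prod hP
  obtain ⟨x, rfl⟩ := List.exists_eq_ofFn_prod hR
  refine ⟨Sum.elim (fun i => (z i).re) (Sum.elim (fun i => (z i).im)
    (f.1.1.scalarsOfEigenvalue x)), fun i => ?_, ?_, ?_⟩
  · exact him _ (List.mem_ofFn.2 ⟨i, rfl⟩)
  · refine congrArg List.ofFn (funext fun i => Prod.ext ?_ rfl)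
    exact Complex.re_add_im (z i)
  · refine congrArg List.ofFn (funext fun i => Prod.ext ?_ rfl)
    exact congrFun (f.1.1.realEigenvalue_scalarsOfEigenvalue x) i

/-- Every symmetric matrix is congruent to a normal form by an isometry of `Σ`. -/
theorem exists_form_congruent {A : Matrix (Fin 6) (Fin 6) ℝ} (hA : A.transpose = A) :
    ∃ (f : NormalFamily) (θ : f.metaclass.ScalarIndex → ℝ), (∀ i, 0 < θ (.inr (.inl i))) ∧
      ∃ P : Matrix (Fin 6) (Fin 6) ℝ, P.transpose * sigmaMatrix * P = sigmaMatrix ∧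
        P.transpose * A * P = f.form θ := by
  have hB := realSelfAdjoint_sigma hA
  obtain ⟨LP, LR, hL, h6⟩ := exists_hasLabels hB 6 ⊤ (by simp) (fun _ _ => trivial)
    (fun _ _ => trivial) (fun x _ hx => sigmaForm_nondegenerate x fun y => hx y trivial)
  obtain ⟨him, W, hW⟩ := hL.exists_isChainFamily hB
  have hbal := hW.balanced hB h6
  have hpos : (∀ p ∈ LP, 0 < p.2) ∧ ∀ r ∈ LR, 0 < r.2.1 := by
    constructor
    · intro p hp
      obtain ⟨n, rfl⟩ := List.mem_iff_get.1 hp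
      exact (hW.chain (.inl n)).pos
    · intro r hr
      obtain ⟨n, rfl⟩ := List.mem_iff_get.1 hr
      exact (hW.chain (.inr (.inr n))).pos
  obtain ⟨f, hfP, hfR⟩ := exists_family (LP.map Prod.snd) (LR.map Prod.snd)
    (by simpa [List.mem_map] using fun k z h => hpos.1 _ h)
    (by
      intro r hr
      obtain ⟨q, hq, rfl⟩ := List.mem_map.1 hr
      exact hpos.2 q hq)
    (by rw [List.map_map]; exact h6)
    (by rw [List.map_map]; exact hbal)
  -- The chains are put in the order of the blocks of `f`; the scalars are then read off from their
  -- eigenvalues.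
  obtain ⟨LP', hPP, hP'⟩ := hfP.exists_map_eq rfl
  obtain ⟨LR', hRR, hR'⟩ := hfR.exists_map_eq rfl
  obtain ⟨θ, hτ, rfl, rfl⟩ := f.exists_labels_eq hP' hR' fun p hp => him p (hPP.mem_iff.2 hp)
  obtain ⟨-, W₁, hW₁⟩ := (hL.perm hB hPP hRR).exists_isChainFamily hB
  have hB₂ := realSelfAdjoint_sigma (f.form_transpose θ)
  obtain ⟨-, W₂, hW₂⟩ := (NormalFamily.hasLabels_form hτ).exists_isChainFamily hB₂
  obtain ⟨P, hP, hPJ, hPs, -⟩ := hW₂.exists_equiv hB₂ hB (by rw [f.totalSize_eq]; simp) hW₁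
    (by rw [f.totalSize_eq]; simp)
  obtain ⟨Q, hQ⟩ := exists_complexEnd_eq (P : (Fin 6 → ℂ) →ₗ[ℂ] (Fin 6 → ℂ)) hPs
  have hQs : Q.transpose * sigmaMatrix * Q = sigmaMatrix :=
    (sigma_iff_isometry Q).2 fun x y => by rw [hQ]; exact hP x y
  refine ⟨f, θ, hτ, Q, hQs, congruent_of_commute hQs (complexEnd_injective ?_)⟩
  rw [complexEnd_mul Q, complexEnd_mul _ Q, hQ]
  exact LinearMap.ext hPJ

end Families

/-! ### Normal forms in oriented frames and the Segré type of `J` -/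

section MainTheorem

lemma det_sigmaMatrix : sigmaMatrix.det = -1 := by
  simp [sigmaMatrix, Matrix.det_succ_row_zero, Fin.sum_univ_succ, Fin.succAbove]
  norm_num

/-- Every symmetric matrix with determinant `±1` takes a normal form in some frame of the given
orientation. -/
theorem exists_wedge2_form {A : Matrix (Fin 6) (Fin 6) ℝ} (hA : A.transpose = A)
    (hd : |A.det| = 1) :
    ∃ (f : NormalFamily) (θ : f.metaclass.ScalarIndex → ℝ), f.Admissible θ ∧
      ∃ g : Matrix (Fin 4) (Fin 4) ℝ, g.det = 1 ∧
        ((wedge2 g).transpose * A * wedge2 g = f.form θ ∨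
          (∀ k ∈ f.metaclass.segre.reals, Even k) ∧
            (wedge2 g).transpose * A * wedge2 g =
              sigmaMatrix.transpose * f.form θ * sigmaMatrix) := by
  obtain ⟨f, θ, hτ, P, hP, hPA⟩ := exists_form_congruent hA
  have hPd : P.det = 1 ∨ P.det = -1 := by
    have := det_sq_of_sigma (c := 1) (by rw [hP, one_smul])
    rw [one_pow] at this
    exact mul_self_eq_one_iff.1 (by rw [← sq]; exact this)
  have hadm : f.Admissible θ := by
    refine ⟨hτ, ?_⟩
    rw [← hPA, Matrix.det_mul, Matrix.det_mul, Matrix.det_transpose]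
    rcases hPd with h | h <;> rw [h] <;> simpa using hd
  -- Congruence does not change when `P` is replaced by `-P`, so the sign left open by
  -- `IsSpecialSigma.isWedge` is harmless.
  have key : ∀ {P N : Matrix (Fin 6) (Fin 6) ℝ}, P.transpose * sigmaMatrix * P = sigmaMatrix →
      P.transpose * A * P = N → P.det = 1 → ∃ g : Matrix (Fin 4) (Fin 4) ℝ, g.det = 1 ∧
        (wedge2 g).transpose * A * wedge2 g = N := by
    intro P N hP hN hPd
    obtain ⟨g, hg, rfl | rfl⟩ := IsSpecialSigma.isWedge ⟨hP, hPd⟩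
    · exact ⟨g, hg, hN⟩
    · exact ⟨g, hg, by simpa using hN⟩
  have hcomp : ∀ {Q N N' : Matrix (Fin 6) (Fin 6) ℝ}, Q.transpose * sigmaMatrix * Q = sigmaMatrix →
      P.transpose * A * P = N → Q.transpose * N * Q = N' →
      (P * Q).transpose * sigmaMatrix * (P * Q) = sigmaMatrix ∧
        (P * Q).transpose * A * (P * Q) = N' := by
    intro Q N N' hQ hN hN'
    rw [Matrix.transpose_mul]
    constructor
    · calc _ = Q.transpose * (P.transpose * sigmaMatrix * P) * Q := by simp only [Matrix.mul_assoc]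
        _ = _ := by rw [hP, hQ]
    · calc _ = Q.transpose * (P.transpose * A * P) * Q := by simp only [Matrix.mul_assoc]
        _ = _ := by rw [hN, hN']
  refine ⟨f, θ, hadm, ?_⟩
  rcases hPd with h | h
  · obtain ⟨g, hg, hgN⟩ := key hP hPA h
    exact ⟨g, hg, .inl hgN⟩
  -- Now `det P = -1`. The determinant is corrected by `Σ` at the price of the conjugated form or,
  -- if some real block is odd, by an isometry that preserves the normal form itself.
  by_cases heven : ∀ k ∈ f.metaclass.segre.reals, Even k
  · have hS : sigmaMatrix.transpose * sigmaMatrix * sigmaMatrix = sigmaMatrix := by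
      rw [Matrix.mul_assoc, sigmaMatrix_mul_self, mul_one, sigmaMatrix_transpose]
    have h1 := hcomp hS hPA rfl
    obtain ⟨g, hg, hgN⟩ := key h1.1 h1.2 (by rw [Matrix.det_mul, h, det_sigmaMatrix]; norm_num)
    exact ⟨g, hg, .inr ⟨heven, hgN⟩⟩
  · obtain ⟨Q, hQ, hQN, hQd⟩ := NormalFamily.exists_det_eq_neg_one hτ heven
    have h1 := hcomp hQ hPA hQN
    obtain ⟨g, hg, hgN⟩ := key h1.1 h1.2 (by rw [Matrix.det_mul, h, hQd]; norm_num)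
    exact ⟨g, hg, .inl hgN⟩

/-- The Petrov matrix of a tensor that takes a normal form is congruent to it by an isometry. -/
lemma NormalFamily.TakenBy.exists_isometry {V : Type*} [AddCommGroup V] [Module ℝ V]
    {f : NormalFamily} {F : V → V → V → V → ℝ} {b : Basis (Fin 4) ℝ V} (h : f.TakenBy F b) :
    ∃ θ : f.metaclass.ScalarIndex → ℝ, f.Admissible θ ∧ |(petrov F b).det| = 1 ∧
      ∃ S : Matrix (Fin 6) (Fin 6) ℝ, S * S = 1 ∧ S.transpose * sigmaMatrix * S = sigmaMatrix ∧
        petrov F b = S.transpose * f.form θ * S := by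
  obtain ⟨θ, hθ, h | ⟨-, h⟩⟩ := h
  · exact ⟨θ, hθ, by rw [h, hθ.2], 1, by simp, by simp, by simpa using h⟩
  · refine ⟨θ, hθ, ?_, sigmaMatrix, sigmaMatrix_mul_self, ?_, h⟩
    · rw [h, Matrix.det_mul, Matrix.det_mul, Matrix.det_transpose, det_sigmaMatrix]
      simpa using hθ.2
    · rw [Matrix.mul_assoc, sigmaMatrix_mul_self, mul_one, sigmaMatrix_transpose]

/-- The congruence is a similarity of the endomorphisms up to the factor `d`, and neither affects
the block sizes. A negative `d`, from a frame of the other orientation, is allowed. -/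
lemma HasSegreType.congr_sigma {N Q : Matrix (Fin 6) (Fin 6) ℝ} {d : ℝ} {s : SegreSymbol}
    (hd : d ≠ 0) (hQ : Q.transpose * sigmaMatrix * Q = d • sigmaMatrix)
    (h : HasSegreType (sigmaMatrix * N) s) :
    HasSegreType (sigmaMatrix * (Q.transpose * N * Q)) s := by
  have hQd : Q.det ≠ 0 := fun h0 => by
    have := det_sq_of_sigma hQ
    rw [h0] at this
    exact pow_ne_zero 6 hd (by rw [← this]; ring)
  have h1 := commute_of_congruent (A := N) hd hQ rfl
  have h2 := h.of_similar (A' := d⁻¹ • (sigmaMatrix * (Q.transpose * N * Q)))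
    (isUnit_iff_ne_zero.2 hQd) (by
      rw [Matrix.mul_smul, h1, smul_smul, inv_mul_cancel₀ hd, one_smul])
  have h3 := h2.smul hd
  rwa [smul_smul, mul_inv_cancel₀ hd, one_smul] at h3

variable {V : Type*} [AddCommGroup V] [Module ℝ V] {F : V → V → V → V → ℝ}

/-- A non-degenerate tensor takes a normal form in a frame with the orientation of a given frame. -/
theorem IsAreaTensor.exists_takenBy (h : IsAreaTensor F) (b : Basis (Fin 4) ℝ V)
    (hd : (petrov F b).det ≠ 0) :
    ∃ (f : NormalFamily) (b' : Basis (Fin 4) ℝ V), b'.orientation = b.orientation ∧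
      f.TakenBy F b' := by
  -- Scaling the frame by `t` scales bivectors by `t ^ 2`, the Petrov matrix by `t ^ 4` and its 6×6
  -- determinant by `t ^ 24`.
  set t : ℝ := |(petrov F b).det| ^ (-(1 / 24) : ℝ) with ht
  have ht0 : 0 < t := Real.rpow_pos_of_pos (abs_pos.2 hd) _
  have ht24 : t ^ 24 * |(petrov F b).det| = 1 := by
    rw [ht, ← Real.rpow_natCast, ← Real.rpow_mul (abs_nonneg _)]
    norm_num
    rw [Real.rpow_neg_one]
    exact inv_mul_cancel₀ (abs_ne_zero.2 hd)
  have hwt : wedge2 (t • 1) = t ^ 2 • 1 := by rw [wedge2_smul, wedge2_one]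
  have hA : (t ^ 4 • petrov F b).transpose = t ^ 4 • petrov F b := by
    rw [Matrix.transpose_smul, h.petrov_transpose]
  have hdet : |(t ^ 4 • petrov F b).det| = 1 := by
    rw [Matrix.det_smul, Fintype.card_fin, abs_mul, abs_of_pos (by positivity), ← ht24]
    ring
  obtain ⟨f, θ, hθ, g, hg, hform⟩ := exists_wedge2_form hA hdet
  have hgd : (t • g).det = t ^ 4 := by rw [Matrix.det_smul, hg, Fintype.card_fin, mul_one]
  obtain ⟨b', hb'⟩ := exists_basis_toMatrix_eq b (g := t • g) (by rw [hgd]; positivity)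
  have hpet : petrov F b' = (wedge2 g).transpose * (t ^ 4 • petrov F b) * wedge2 g := by
    rw [h.petrov_change b b', hb', wedge2_smul, Matrix.transpose_smul, Matrix.smul_mul,
      Matrix.mul_smul, Matrix.smul_mul, Matrix.mul_smul, Matrix.smul_mul, smul_smul]
    congr 1
    ring
  refine ⟨f, b', ?_, θ, hθ, ?_⟩
  · rw [eq_comm, orientation_eq_iff, hb', hgd]
    positivity
  · rw [hpet]
    exact hform

/-- The family of the normal form is unique. -/
theorem IsAreaTensor.takenBy_unique (h : IsAreaTensor F) {f f' : NormalFamily}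
    {b b' : Basis (Fin 4) ℝ V} (hb : b.orientation = b'.orientation) (hf : f.TakenBy F b)
    (hf' : f'.TakenBy F b') : f' = f := by
  obtain ⟨θ, hθ, hd, S, hSS, hS, hN⟩ := hf.exists_isometry
  obtain ⟨θ', hθ', hd', S', hSS', hS', hN'⟩ := hf'.exists_isometry
  set g := b.toMatrix b' with hg
  have hch := h.petrov_change b b'
  rw [← hg] at hch
  have hgpos : 0 < g.det := (orientation_eq_iff b b').1 hb
  -- Both determinants have absolute value 1, so `det (wedge2 g) ^ 2 = (det g) ^ 6` is 1; equal
  -- orientations exclude `det g = -1`.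
  have hg1 : g.det = 1 := by
    have h1 : |(wedge2 g).det| ^ 2 = 1 := by
      have := congrArg (fun M => |Matrix.det M|) hch
      simp only [Matrix.det_mul, Matrix.det_transpose, abs_mul, hd, hd'] at this
      linear_combination -this
    rw [sq_abs, det_sq_of_sigma (wedge2_sigma g)] at h1
    exact (pow_eq_one_iff_of_nonneg hgpos.le (by norm_num)).1 h1
  have hgs := wedge2_sigma g
  rw [hg1, one_smul] at hgs
  -- `S` and `S'` are isometries and involutions that undo a possible conjugation by `Σ`. Their
  -- determinant may be -1, but uniqueness holds under all isometries.
  refine NormalFamily.eq_of_congruent hθ.1 hθ'.1 (P := S * wedge2 g * S') ?_ ?_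
  · rw [Matrix.transpose_mul, Matrix.transpose_mul]
    calc _ = S'.transpose * ((wedge2 g).transpose * (S.transpose * sigmaMatrix * S) * wedge2 g) *
          S' := by simp only [Matrix.mul_assoc]
      _ = _ := by rw [hS, hgs, hS']
  · have hT : S'.transpose * S'.transpose = 1 := by
      rw [← Matrix.transpose_mul, hSS', Matrix.transpose_one]
    rw [Matrix.transpose_mul, Matrix.transpose_mul]
    calc _ = S'.transpose * ((wedge2 g).transpose * (S.transpose * f.form θ * S) * wedge2 g) *
          S' := by simp only [Matrix.mul_assoc]
      _ = S'.transpose * (S'.transpose * f'.form θ' * S') * S' := by rw [← hN, ← hch, hN']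
      _ = (S'.transpose * S'.transpose) * f'.form θ' * (S' * S') := by
        simp only [Matrix.mul_assoc]
      _ = f'.form θ' := by rw [hT, hSS', one_mul, mul_one]

/-- The Segré type of `J` is that of the metaclass of the normal form. -/
theorem IsAreaTensor.hasSegreType_endoJ (h : IsAreaTensor F) {f : NormalFamily}
    {b : Basis (Fin 4) ℝ V} (hf : f.TakenBy F b) (b' : Basis (Fin 4) ℝ V)
    (hd' : (petrov F b').det ≠ 0) : HasSegreType (endoJ F b') f.metaclass.segre := by
  obtain ⟨θ, hθ, hd, S, hSS, hS, hN⟩ := hf.exists_isometry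
  rw [endoJ_eq F b' hd']
  refine HasSegreType.smul ?_ (inv_ne_zero (Real.rpow_pos_of_pos (abs_pos.2 hd') _).ne')
  rw [h.petrov_change b b']
  have hg : (b.toMatrix b').det ≠ 0 := by
    rw [← Basis.det_apply]
    exact (b.isUnit_det b').ne_zero
  refine HasSegreType.congr_sigma hg (wedge2_sigma _) ?_
  rw [hN]
  refine HasSegreType.congr_sigma one_ne_zero (by rw [hS, one_smul]) ?_
  exact NormalFamily.hasSegreType_form hθ.1

theorem IsAreaTensor.hasSegreType_iff (h : IsAreaTensor F) {f : NormalFamily}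
    {b : Basis (Fin 4) ℝ V} (hf : f.TakenBy F b) (b' : Basis (Fin 4) ℝ V)
    (hd' : (petrov F b').det ≠ 0) (m : Metaclass) :
    HasSegreType (endoJ F b') m.segre ↔ m = f.metaclass := by
  have hs := h.hasSegreType_endoJ hf b' hd'
  refine ⟨fun h1 => Metaclass.segre_injective (h1.unique hs m.zero_notMem.1 m.zero_notMem.2
    f.metaclass.zero_notMem.1 f.metaclass.zero_notMem.2), fun h1 => by rwa [h1]⟩

/-- A frame of each orientation. -/
lemma exists_basis_orientation (b : Basis (Fin 4) ℝ V) (o : Orientation ℝ V (Fin 4)) :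
    ∃ b' : Basis (Fin 4) ℝ V, b'.orientation = o :=
  ⟨b.adjustToOrientation o, b.orientation_adjustToOrientation o⟩

end MainTheorem

/-! ### The determinant of a normal form as a function of its scalars -/

section Determinant

lemma Matrix.det_blockDiagonal_eq_prod {R I : Type*} [CommRing R] [Fintype I] [DecidableEq I]
    {k : I → ℕ} (d : ∀ i, Matrix (Fin (k i)) (Fin (k i)) R) :
    (Matrix.blockDiagonal' d).det = ∏ i, (d i).det := by
  let e := Fintype.equivFin I
  have hbt : (Matrix.blockDiagonal' d).BlockTriangular fun p => e p.1 := by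
    rintro ⟨i, a⟩ ⟨j, c⟩ hij
    exact Matrix.blockDiagonal'_apply_ne d a c fun h => by subst h; exact lt_irrefl _ hij
  rw [hbt.det_fintype, ← Equiv.prod_comp e]
  refine Finset.prod_congr rfl fun i _ => ?_
  let φ : Fin (k i) ≃ {p : Σ i, Fin (k i) // e p.1 = e i} :=
    { toFun := fun a => ⟨⟨i, a⟩, rfl⟩
      invFun := fun p => Fin.cast (by rw [e.injective p.2]) p.1.2
      left_inv := fun a => rfl
      right_inv := by
        rintro ⟨⟨j, a⟩, h⟩
        obtain rfl := e.injective h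
        rfl }
  rw [← Matrix.det_submatrix_equiv_self φ]
  congr 1
  ext a c
  exact Matrix.blockDiagonal'_apply_eq d i a c

lemma det_jordanBlock (k : ℕ) (z : ℂ) : (jordanBlock k z).det = z ^ k := by
  rw [Matrix.det_of_isUpperTriangular]
  · simp [jordanBlock]
  · intro i j hij
    have h1 : (j : ℕ) < i := hij
    simp only [jordanBlock, Matrix.of_apply]
    rw [if_neg (by rintro rfl; omega), if_neg (by omega)]

/-- Similarity to the Jordan matrix makes the determinant a product over the blocks, in which a
conjugate pair contributes powers of `|z|²`. -/
lemma IsChainFamily.det_eq_prod {LP : List (ℂ × ℕ)} {LR : List (ℝ × ℕ × ℤˣ)}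
    {B : LinearMap.BilinForm ℂ (Fin 6 → ℂ)} {M : Matrix (Fin 6) (Fin 6) ℝ}
    (hB : RealSelfAdjoint B (complexEnd M)) {W : ChainIndex LP LR → Fin 6 → ℂ}
    (hW : IsChainFamily B (complexEnd M) W) (h6 : totalSize LP LR = 6) :
    M.det = (LP.map fun p => (p.1.re ^ 2 + p.1.im ^ 2) ^ p.2).prod *
      (LR.map fun r => r.1 ^ r.2.1).prod := by
  obtain ⟨e, S, hS, hMS⟩ := hW.exists_jordan_form hB h6
  have h1 := congrArg Matrix.det hMS
  rw [Matrix.det_mul, Matrix.det_mul, mul_comm, Matrix.det_reindex_self,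
    Matrix.det_blockDiagonal_eq_prod] at h1
  have h2 := mul_left_cancel₀ hS.ne_zero h1
  have h3 : (M.map fun a => (a : ℂ)).det = ((M.det : ℝ) : ℂ) :=
    (RingHom.map_det Complex.ofRealHom M).symm
  rw [h3] at h2
  simp only [det_jordanBlock, Fintype.prod_sum_type] at h2
  apply Complex.ofReal_injective
  rw [h2, Complex.ofReal_mul, ← mul_assoc, ← Finset.prod_mul_distrib]
  congr 1
  · conv_rhs => rw [← List.ofFn_get LP, List.map_ofFn, List.prod_ofFn]
    rw [Complex.ofReal_prod]
    refine Finset.prod_congr rfl fun i _ => ?_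
    simp only [chainEigenvalue, chainSize, Sum.elim_inl, Sum.elim_inr, Function.comp_apply]
    rw [← mul_pow, Complex.mul_conj, Complex.normSq_apply]
    push_cast
    simp only [List.get_eq_getElem]
    ring
  · conv_rhs => rw [← List.ofFn_get LR, List.map_ofFn, List.prod_ofFn]
    rw [Complex.ofReal_prod]
    refine Finset.prod_congr rfl fun i _ => ?_
    simp [chainEigenvalue, chainSize]

namespace Metaclass

/-- The product of the eigenvalues of the normal form. -/
noncomputable def eigenvalueProd (m : Metaclass) (ε : Fin m.numSigns → ℤˣ)
    (σ τ : Fin m.numPairs → ℝ) (l : Fin m.numReals → ℝ) : ℝ :=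
  (∏ i, (σ i ^ 2 + τ i ^ 2) ^ m.pairSize i) * ∏ i, m.realEigenvalue l i ^ (m.realShape ε i).1

/-- The scalars `λ` enter the eigenvalues linearly, and the total size of the blocks is 6. -/
lemma eigenvalueProd_smul (m : Metaclass) (ε : Fin m.numSigns → ℤˣ)
    (σ τ : Fin m.numPairs → ℝ) (l : Fin m.numReals → ℝ) (t : ℝ) :
    m.eigenvalueProd ε (fun i => t * σ i) (fun i => t * τ i) (fun i => t * l i) =
      t ^ 6 * m.eigenvalueProd ε σ τ l := by
  have h6 : ∑ i, 2 * m.pairSize i + ∑ i, (m.realShape ε i).1 = 6 := by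
    have := m.segre_sum
    rw [← coe_ofFn_pairSize, ← coe_ofFn_realShape _ ε, Multiset.sum_coe, Multiset.sum_coe,
      List.map_ofFn, List.sum_ofFn, List.sum_ofFn] at this
    rw [← Finset.mul_sum]
    exact this
  rw [← h6, pow_add, ← Finset.prod_pow_eq_pow_sum, ← Finset.prod_pow_eq_pow_sum, eigenvalueProd,
    eigenvalueProd, mul_mul_mul_comm, ← Finset.prod_mul_distrib, ← Finset.prod_mul_distrib]
  congr 1
  · refine Finset.prod_congr rfl fun i _ => ?_
    rw [pow_mul, ← mul_pow]
    ring
  · refine Finset.prod_congr rfl fun i _ => ?_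
    rw [← mul_pow, realEigenvalue_smul]

lemma contDiff_realEigenvalue (m : Metaclass) :
    ∀ i, ContDiff ℝ ∞ fun l : Fin m.numReals → ℝ => m.realEigenvalue l i := by
  cases m
  case I | II | III => exact fun i => i.elim0
  case VIII | X | XII | XVI =>
    change ∀ i : Fin 1, ContDiff ℝ ∞ fun l : Fin 1 → ℝ => ![l 0] i
    intro i; fin_cases i; simp; fun_prop
  case IV | V =>
    change ∀ i : Fin 2, ContDiff ℝ ∞ fun l : Fin 2 → ℝ =>
      ![l 1 + l 0, l 1 - l 0] i
    intro i; fin_cases i <;> simp <;> fun_prop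
  case VI =>
    change ∀ i : Fin 4, ContDiff ℝ ∞ fun l : Fin 4 → ℝ =>
      ![l 1 + l 0, l 1 - l 0, l 3 + l 2, l 3 - l 2] i
    intro i; fin_cases i <;> simp <;> fun_prop
  case VII =>
    change ∀ i : Fin 6, ContDiff ℝ ∞ fun l : Fin 6 → ℝ =>
      ![l 1 + l 0, l 1 - l 0, l 3 + l 2, l 3 - l 2, l 5 + l 4, l 5 - l 4] i
    intro i; fin_cases i <;> simp <;> fun_prop
  case IX | XIV | XIX | XX | XXII =>
    change ∀ i : Fin 2, ContDiff ℝ ∞ fun l : Fin 2 → ℝ =>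
      ![l 0, l 1] i
    intro i; fin_cases i <;> simp <;> fun_prop
  case XI =>
    change ∀ i : Fin 3, ContDiff ℝ ∞ fun l : Fin 3 → ℝ =>
      ![l 0, l 1 + l 2, l 1 - l 2] i
    intro i; fin_cases i <;> simp <;> fun_prop
  case XIII =>
    change ∀ i : Fin 3, ContDiff ℝ ∞ fun l : Fin 3 → ℝ =>
      ![l 0, l 1, l 2] i
    intro i; fin_cases i <;> simp <;> fun_prop
  case XV | XXIII =>
    change ∀ i : Fin 4, ContDiff ℝ ∞ fun l : Fin 4 → ℝ =>
      ![l 0, l 1, l 3 + l 2, l 3 - l 2] i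
    intro i; fin_cases i <;> simp <;> fun_prop
  case XVII =>
    change ∀ i : Fin 3, ContDiff ℝ ∞ fun l : Fin 3 → ℝ =>
      ![l 0, l 2 + l 1, l 2 - l 1] i
    intro i; fin_cases i <;> simp <;> fun_prop
  case XVIII =>
    change ∀ i : Fin 5, ContDiff ℝ ∞ fun l : Fin 5 → ℝ =>
      ![l 0, l 4 + l 3, l 4 - l 3, l 2 + l 1, l 2 - l 1] i
    intro i; fin_cases i <;> simp <;> fun_prop
  case XXI =>
    change ∀ i : Fin 3, ContDiff ℝ ∞ fun l : Fin 3 → ℝ =>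
      ![l 1, l 0, l 2] i
    intro i; fin_cases i <;> simp <;> fun_prop

end Metaclass

namespace NormalFamily

/-- The product of the eigenvalues of the normal form. -/
noncomputable def eigenvalueProd (f : NormalFamily) (θ : f.metaclass.ScalarIndex → ℝ) : ℝ :=
  f.1.1.eigenvalueProd f.1.2 (fun i => θ (.inl i)) (fun i => θ (.inr (.inl i)))
    fun i => θ (.inr (.inr i))

variable {f : NormalFamily} {θ : f.metaclass.ScalarIndex → ℝ}

lemma det_form (hτ : ∀ i, 0 < θ (.inr (.inl i))) : (f.form θ).det = -f.eigenvalueProd θ := by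
  have hB := realSelfAdjoint_sigma (f.form_transpose θ)
  obtain ⟨-, W, hW⟩ := (hasLabels_form hτ).exists_isChainFamily hB
  have h := hW.det_eq_prod hB (f.totalSize_eq θ)
  rw [Matrix.det_mul, det_sigmaMatrix] at h
  rw [← neg_eq_iff_eq_neg, ← neg_one_mul, h, eigenvalueProd, Metaclass.eigenvalueProd, pairLabels, realLabels,
    Metaclass.pairLabels, Metaclass.realLabels, List.map_ofFn, List.map_ofFn, List.prod_ofFn,
    List.prod_ofFn]
  congr 1
  refine Finset.prod_congr rfl fun i _ => ?_
  simp

lemma admissible_iff : f.Admissible θ ↔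
    (∀ i, 0 < θ (.inr (.inl i))) ∧ |f.eigenvalueProd θ| = 1 :=
  and_congr_right fun hτ => by rw [det_form hτ, abs_neg]

/-- Admissible scalars exist: those with eigenvalues `±I` and `1`. -/
lemma exists_admissible (f : NormalFamily) : ∃ θ, f.Admissible θ := by
  obtain ⟨θ, hτ, hP, hR⟩ := f.exists_labels_eq
    (LP := List.ofFn fun i => (Complex.I, f.1.1.pairSize i))
    (LR := List.ofFn fun i => ((1 : ℝ), f.1.1.realShape f.1.2 i))
    (by rw [List.map_ofFn]; rfl) (by rw [List.map_ofFn]; rfl) (by simp [List.mem_ofFn])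
  refine ⟨θ, admissible_iff.2 ⟨hτ, ?_⟩⟩
  have h1 := List.ofFn_injective hP
  have h2 := List.ofFn_injective hR
  have h3 : ∀ i, θ (.inl i) ^ 2 + θ (.inr (.inl i)) ^ 2 = 1 := fun i => by
    have h := congrArg Prod.fst (congrFun h1 i)
    have hre := congrArg Complex.re h
    have him := congrArg Complex.im h
    simp at hre him
    rw [hre, him]
    norm_num
  have h4 : ∀ i, f.1.1.realEigenvalue (fun j => θ (.inr (.inr j))) i = 1 := fun i =>
    congrArg Prod.fst (congrFun h2 i)
  rw [eigenvalueProd, Metaclass.eigenvalueProd, Finset.prod_eq_one, Finset.prod_eq_one]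
  · simp
  · exact fun i _ => by exact (congrArg (· ^ _) (h4 _)).trans (one_pow _)
  · exact fun i _ => by exact (congrArg (· ^ f.1.1.pairSize _) (h3 _)).trans (one_pow _)

lemma eigenvalueProd_smul (f : NormalFamily) (θ : f.metaclass.ScalarIndex → ℝ) (t : ℝ) :
    f.eigenvalueProd (t • θ) = t ^ 6 * f.eigenvalueProd θ :=
  f.1.1.eigenvalueProd_smul _ _ _ _ t

lemma contDiff_eigenvalueProd (f : NormalFamily) : ContDiff ℝ ∞ f.eigenvalueProd := by
  have h1 : ∀ i, ContDiff ℝ ∞ fun θ : f.metaclass.ScalarIndex → ℝ =>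
      f.1.1.realEigenvalue (fun j => θ (.inr (.inr j))) i := by
    intro i
    exact (f.1.1.contDiff_realEigenvalue i).comp (contDiff_pi.2 fun j => contDiff_apply ℝ ℝ _)
  unfold eigenvalueProd Metaclass.eigenvalueProd
  refine ContDiff.mul (contDiff_prod fun i _ => ?_) (contDiff_prod fun i _ => (h1 i).pow _)
  exact (((contDiff_apply ℝ ℝ _).pow 2).add ((contDiff_apply ℝ ℝ _).pow 2)).pow _

end NormalFamily

end Determinant

/-! ### Level sets as graphs over all but one coordinate -/

section Implicit

variable {ι : Type*} [DecidableEq ι]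

/-- A vector with the coordinate `i` separated from the others. -/
def insertCoord (i : ι) (v : ({j : ι // j ≠ i} → ℝ) × ℝ) (j : ι) : ℝ :=
  if h : j = i then v.2 else v.1 ⟨j, h⟩

lemma insertCoord_restrict (i : ι) (θ : ι → ℝ) :
    insertCoord i (fun j : {j : ι // j ≠ i} => θ j, θ i) = θ := by
  ext j
  unfold insertCoord
  split_ifs with h
  · rw [h]
  · rfl

lemma contDiff_insertCoord [Fintype ι] (i : ι) : ContDiff ℝ ∞ (insertCoord i) := by
  refine contDiff_pi.2 fun j => ?_
  unfold insertCoord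
  by_cases h : j = i
  · simp only [h, dif_pos]
    exact contDiff_snd
  · simp only [h, dif_neg, not_false_eq_true]
    exact (contDiff_apply ℝ ℝ _).comp contDiff_fst

/-- Near a regular point, a level set is the graph of a smooth function of all but one
coordinate. -/
theorem exists_implicit_coord [Fintype ι] {D : (ι → ℝ) → ℝ} (hD : ContDiff ℝ ∞ D) (θ : ι → ℝ)
    (h : fderiv ℝ D θ ≠ 0) :
    ∃ (i : ι) (g : ({j : ι // j ≠ i} → ℝ) → ℝ), ContDiffAt ℝ ∞ g (fun j => θ j) ∧
      ∀ᶠ θ' in 𝓝 θ, D θ' = D θ ↔ θ' i = g fun j => θ' j := by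
  -- A non-zero differential has a non-zero partial derivative; that coordinate is the one to solve
  -- for.
  obtain ⟨i, hi⟩ : ∃ i, fderiv ℝ D θ (Pi.single i 1) ≠ 0 := by
    by_contra! hall
    refine h (ContinuousLinearMap.ext fun x => ?_)
    rw [← Finset.univ_sum_single x, map_sum, zero_apply]
    refine Finset.sum_eq_zero fun i _ => ?_
    rw [show Pi.single i (x i) = x i • (Pi.single i 1 : ι → ℝ) by
      rw [← Pi.single_smul, smul_eq_mul, mul_one], map_smul, hall i, smul_zero]
  let u : ({j : ι // j ≠ i} → ℝ) × ℝ := (fun j => θ j, θ i)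
  have hu : insertCoord i u = θ := insertCoord_restrict i θ
  have hf : ContDiffAt ℝ ∞ (D ∘ insertCoord i) u := (hD.comp (contDiff_insertCoord i)).contDiffAt
  -- Separating the coordinate `i` is compared with the original `D` along the line in direction
  -- `i`, where both derivatives compute the same number.
  have hder : (fderiv ℝ (D ∘ insertCoord i) u) (0, 1) ≠ 0 := by
    have hline : HasDerivAt (fun s : ℝ => insertCoord i (u + s • (0, 1))) (Pi.single i 1) 0 := by
      refine hasDerivAt_pi.2 fun j => ?_
      by_cases hj : j = i
      · subst hj
        simp only [insertCoord, dif_pos, Pi.single_eq_same]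
        simpa using (hasDerivAt_id (0 : ℝ)).const_add (θ j)
      · simp only [insertCoord, hj, dif_neg, not_false_eq_true, Pi.single_eq_of_ne hj]
        simpa using hasDerivAt_const (0 : ℝ) (θ j)
    have h1 : HasDerivAt (fun s : ℝ => D (insertCoord i (u + s • (0, 1))))
        (fderiv ℝ D θ (Pi.single i 1)) 0 := by
      have hd : HasFDerivAt D (fderiv ℝ D θ) (insertCoord i (u + (0 : ℝ) • (0, 1))) := by
        rw [zero_smul, add_zero, hu]
        exact (hD.differentiable (by simp)).differentiableAt.hasFDerivAt
      exact hd.comp_hasDerivAt (0 : ℝ) hline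
    have h2 : HasDerivAt (fun s : ℝ => D (insertCoord i (u + s • (0, 1))))
        (fderiv ℝ (D ∘ insertCoord i) u (0, 1)) 0 := by
      have hl : HasDerivAt (fun s : ℝ => u + s • ((0, 1) : ({j : ι // j ≠ i} → ℝ) × ℝ)) (0, 1) 0 := by
        simpa using ((hasDerivAt_id (0 : ℝ)).smul_const
          ((0, 1) : ({j : ι // j ≠ i} → ℝ) × ℝ)).const_add u
      have hd : HasFDerivAt (D ∘ insertCoord i) (fderiv ℝ (D ∘ insertCoord i) u)
          (u + (0 : ℝ) • (0, 1)) := by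
        rw [zero_smul, add_zero]
        exact (hf.differentiableAt (by simp)).hasFDerivAt
      exact hd.comp_hasDerivAt (0 : ℝ) hl
    rw [h2.unique h1]
    exact hi
  have hinv : (fderiv ℝ (D ∘ insertCoord i) u ∘L .inr ℝ ({j : ι // j ≠ i} → ℝ) ℝ).IsInvertible := by
    refine ⟨ContinuousLinearEquiv.unitsEquivAut ℝ (Units.mk0 _ hder), ?_⟩
    ext
    simp
  have hn : (∞ : WithTop ℕ∞) ≠ 0 := by simp
  refine ⟨i, hf.implicitFunction hn hinv, hf.contDiffAt_implicitFunction hn hinv, ?_⟩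
  have hcont : Filter.Tendsto (fun θ' : ι → ℝ => ((fun j : {j : ι // j ≠ i} => θ' j, θ' i) :
      ({j : ι // j ≠ i} → ℝ) × ℝ)) (𝓝 θ) (𝓝 u) := by
    refine Continuous.tendsto' ?_ θ u rfl
    fun_prop
  filter_upwards [hcont.eventually (hf.eventually_apply_eq_iff_implicitFunction hn hinv)]
    with θ' hθ'
  simp only [Function.comp_apply, insertCoord_restrict, hu] at hθ'
  rw [hθ', eq_comm]

end Implicit

/-! ### Local dependence of the scalars, and the theorem -/

namespace NormalFamily

/-- Euler's relation: by homogeneity of degree 6 the derivative of the product of the eigenvalues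
along `θ` is six times its value, which is `±1`. So the level set is regular at every admissible
point. -/
theorem exists_implicit (f : NormalFamily) {θ : f.metaclass.ScalarIndex → ℝ}
    (hθ : f.Admissible θ) :
    ∃ (i : f.metaclass.ScalarIndex) (g : ({j : f.metaclass.ScalarIndex // j ≠ i} → ℝ) → ℝ),
      ContDiffAt ℝ ∞ g (fun j => θ j) ∧
        ∀ᶠ θ' in 𝓝 θ, f.Admissible θ' ↔ θ' i = g fun j => θ' j := by
  obtain ⟨hτ, h1⟩ := admissible_iff.1 hθ
  have hcd := f.contDiff_eigenvalueProd
  have hne : f.eigenvalueProd θ ≠ 0 := fun h0 => by simp [h0] at h1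
  have hreg : fderiv ℝ f.eigenvalueProd θ ≠ 0 := by
    intro h0
    have ha : HasDerivAt (fun t : ℝ => f.eigenvalueProd (t • θ)) 0 1 := by
      have hl : HasDerivAt (fun t : ℝ => t • θ) θ 1 := by
        simpa using (hasDerivAt_id (1 : ℝ)).smul_const θ
      have hd : HasFDerivAt f.eigenvalueProd (0 : _ →L[ℝ] ℝ) ((1 : ℝ) • θ) := by
        rw [one_smul, ← h0]
        exact (hcd.differentiable (by simp)).differentiableAt.hasFDerivAt
      exact hd.comp_hasDerivAt (1 : ℝ) hl
    have hb : HasDerivAt (fun t : ℝ => f.eigenvalueProd (t • θ)) (6 * f.eigenvalueProd θ) 1 := by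
      simp only [eigenvalueProd_smul]
      simpa using (hasDerivAt_pow 6 (1 : ℝ)).mul_const (f.eigenvalueProd θ)
    have := ha.unique hb
    exact hne (by linarith)
  obtain ⟨i, g, hg, hev⟩ := exists_implicit_coord hcd θ hreg
  refine ⟨i, g, hg, ?_⟩
  -- Positivity of the `τ` is an open condition, and near `θ` the product keeps its sign. So there
  -- admissibility is the single equation that the product has its value at `θ`.
  have hpos : ∀ᶠ θ' in 𝓝 θ, ∀ i, 0 < θ' (.inr (.inl i)) :=
    Filter.eventually_all.2 fun i => (continuous_apply _).continuousAt.eventually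
      (lt_mem_nhds (hτ i))
  have hsign : ∀ᶠ θ' in 𝓝 θ, 0 < f.eigenvalueProd θ' * f.eigenvalueProd θ := by
    refine (hcd.continuous.mul continuous_const).continuousAt.eventually (lt_mem_nhds ?_)
    exact mul_self_pos.2 hne
  filter_upwards [hev, hpos, hsign] with θ' h2 h3 h4
  rw [← h2, admissible_iff, and_iff_right h3]
  constructor
  · intro h5
    rcases abs_eq_abs.1 (h5.trans h1.symm) with h6 | h6
    · exact h6
    · rw [h6] at h4
      nlinarith [mul_self_pos.2 hne]
  · intro h5
    rw [h5, h1]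

end NormalFamily

lemma Metaclass.card_scalarIndex_le (m : Metaclass) : Fintype.card m.ScalarIndex ≤ 6 := by
  simp only [Fintype.card_sum, Fintype.card_fin]
  cases m <;> decide

theorem theorem3p3 :
    (Nat.card Metaclass = 23 ∧ Function.Injective Metaclass.segre ∧
      Nat.card NormalFamily = 46) ∧
    (∀ f : NormalFamily,
      (∃ θ, f.Admissible θ) ∧
      Fintype.card f.metaclass.ScalarIndex ≤ 6 ∧
      ∀ θ, f.Admissible θ → ∃ (i : f.metaclass.ScalarIndex)
        (g : ({j : f.metaclass.ScalarIndex // j ≠ i} → ℝ) → ℝ),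
        ContDiffAt ℝ ∞ g (fun j => θ j) ∧
        ∀ᶠ θ' in 𝓝 θ, f.Admissible θ' ↔ θ' i = g (fun j => θ' j)) ∧
    ∀ {M : Type*} [TopologicalSpace M] [ChartedSpace (EuclideanSpace ℝ (Fin 4)) M]
      [IsManifold (𝓡 4) ∞ M] (G : AreaMetric M) (p : M)
      (o : Orientation ℝ (TangentSpace (𝓡 4) p) (Fin 4)),
      ∃ f : NormalFamily,
        (∃ b : Module.Basis (Fin 4) ℝ (TangentSpace (𝓡 4) p),
          b.orientation = o ∧ f.TakenBy (G.at p) b) ∧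
        (∀ (f' : NormalFamily) (b : Module.Basis (Fin 4) ℝ (TangentSpace (𝓡 4) p)),
          b.orientation = o → f'.TakenBy (G.at p) b → f' = f) ∧
        ∀ (b : Module.Basis (Fin 4) ℝ (TangentSpace (𝓡 4) p)) (m : Metaclass),
          HasSegreType (endoJ (G.at p) b) m.segre ↔ m = f.metaclass := by
  refine ⟨⟨Metaclass.card_eq, Metaclass.segre_injective, NormalFamily.card_eq⟩, fun f =>
    ⟨f.exists_admissible, f.metaclass.card_scalarIndex_le, fun θ hθ => f.exists_implicit hθ⟩, ?_⟩
  intro M _ _ _ G p o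
  have hG := G.isAreaTensor p
  -- The tangent space at `p` is by definition the model space, whose standard basis supplies a
  -- first frame.
  let b₀ : Basis (Fin 4) ℝ (TangentSpace (𝓡 4) p) := (EuclideanSpace.basisFun (Fin 4) ℝ).toBasis
  obtain ⟨b, hb⟩ := exists_basis_orientation b₀ o
  obtain ⟨f, b', hb', hf⟩ := hG.exists_takenBy b (G.det_petrov_ne_zero p b)
  exact ⟨f, ⟨b', hb'.trans hb, hf⟩,
    fun f' b'' hb'' hf' => hG.takenBy_unique (by rw [hb', hb, hb'']) hf hf',
    fun b'' m => hG.hasSegreType_iff hf b'' (G.det_petrov_ne_zero p b'') m⟩
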